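/- Notation. Let $d$ be a dimension, $|\cdot|$ the Euclidean norm on $\mathbf R^d$, and $\lesssim$ an inequality up to a constant not depending on the variables $x,\xi\in\mathbf R^d$ and $\alpha\in\mathbf N^d$. For $s>0$ let $\mathcal S_s(\mathbf R^d)$ (resp. $\Sigma_s(\mathbf R^d)$) be the set of all $\psi\in C^\infty(\mathbf R^d)$ such that $\sup_{\alpha,\beta,x}\frac{|x^\beta\partial^\alpha \psi(x)|}{h^{|\alpha|+|\beta|}(\alpha!\beta!)^s}<\infty$ for some $h>0$ (resp. for every $h>0$); for $s=\frac12$ and fixed $h$ these functions form a Banach space, and $\mathcal S_{1/2}'(\mathbf R^d)$ is the set of linear forms on $\mathcal S_{1/2}(\mathbf R^d)$ that are bounded on each of these Banach spaces. For $f\in\mathcal S_{1/2}'(\mathbf R^d)$ and $\phi\in\Sigma_s(\mathbf R^d)$ or $\phi\in\mathcal S_s(\mathbf R^d)$, the short-time Fourier transform $V_\phi f\in\mathcal S_{1/2}'(\mathbf R^{2d})$ is defined by $$\langle V_\phi f,\Psi\rangle=\langle f,g_\Psi\rangle,\qquad g_\Psi(y)=(2\pi)^{-d/2}\iint\overline{\phi(y-x)}\,e^{-i\langle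 y,\xi\rangle}\Psi(x,\xi)\,dx\,d\xi ,\qquad \Psi\in\mathcal S_{1/2}(\mathbf R^{2d}).$$ A bound on $|V_\phi f(x,\xi)|$ includes the assertion that $V_\phi f$ is a continuous function, and $f\in C^\infty$ or $f\in\Gamma$ means that $f$ is given by integration against such a function. Let $\kappa(r)=1$ for $r\le1$ and $\kappa(r)=2^{r-1}$ for $r>1$. For $s>\frac12$ and $h\in\mathbf R$ put $h^*=\kappa(1/s)\,h$ if $h\ge0$ and $h^*=h/\kappa(1/s)$ if $h<0$. Consider the estimate $$(*)\qquad |\partial^\alpha f(x)|\lesssim e^{h|x|^{1/s}}\varepsilon^{|\alpha|}(\alpha!)^s .$$ Let $\Gamma^\infty_{0,s}(\mathbf R^d)$, $\Gamma^\infty_{1,s}(\mathbf R^d)$, $\Gamma^\infty_s(\mathbf R^d)$ be the sets of all $f\in C^\infty(\mathbf R^d)$ such that, respectively: for some $h>0$, $(*)$ holds for every $\varepsilon>0$; $(*)$ holds for some $\varepsilon,h>0$; for some $\varepsilon>0$, $(*)$ holds for every $h>0$. Theorem. Let $f\in\mathcal S_{1/2}'(\mathbf R^d)$. (A) Let $s>\frac12$,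 $\phi\in\Sigma_s(\mathbf R^d)\setminus\{0\}$ and $h\in\mathbf R$. (1) If $f\in C^\infty(\mathbf R^d)$ satisfies $(*)$ for every $\varepsilon>0$ (resp. for some $\varepsilon>0$), then $V_\phi f$ is given by the absolutely convergent integral $V_\phi f(x,\xi)=(2\pi)^{-d/2}\int f(y)\overline{\phi(y-x)}e^{-i\langle y,\xi\rangle}dy$, and $|V_\phi f(x,\xi)|\lesssim e^{h^*|x|^{1/s}-\varepsilon|\xi|^{1/s}}$ for every $\varepsilon>0$ (resp. for some new $\varepsilon>0$). (2) If $|V_\phi f(x,\xi)|\lesssim e^{h|x|^{1/s}-\varepsilon|\xi|^{1/s}}$ for every $\varepsilon>0$ (resp. for some $\varepsilon>0$), then $f\in C^\infty(\mathbf R^d)$ and $|\partial^\alpha f(x)|\lesssim e^{h^*|x|^{1/s}}\varepsilon^{|\alpha|}(\alpha!)^s$ for every $\varepsilon>0$ (resp. for some new $\varepsilon>0$). (B) Let $s>\frac12$ and $\phi\in\Sigma_s(\mathbf R^d)\setminus\{0\}$. Then $f\in\Gamma^\infty_{0,s}(\mathbf R^d)$ (resp. $f\in\Gamma^\infty_{1,s}(\mathbf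 R^d)$) if and only if there is $h>0$ such that $|V_\phi f(x,\xi)|\lesssim e^{h|x|^{1/s}-\varepsilon|\xi|^{1/s}}$ for every $\varepsilon>0$ (resp. for some $\varepsilon>0$). (C) Let $s\ge\frac12$ and $\phi\in\mathcal S_s(\mathbf R^d)\setminus\{0\}$. Then $f\in\Gamma^\infty_s(\mathbf R^d)$ if and only if there is $h>0$ such that $|V_\phi f(x,\xi)|\lesssim e^{\varepsilon|x|^{1/s}-h|\xi|^{1/s}}$ for every $\varepsilon>0$. -/

import Mathlib

open MeasureTheory
open scoped ContDiff

/-- Euclidean space `ℝ^d`. -/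
abbrev RSpace (d : ℕ) : Type := EuclideanSpace ℝ (Fin d)

/-- The length `|α| = α₁ + ⋯ + α_d` of a multi-index. -/
def multiLength {d : ℕ} (α : Fin d → ℕ) : ℕ := ∑ i, α i

/-- The factorial `α! = α₁! ⋯ α_d!` of a multi-index. -/
def multiFactorial {d : ℕ} (α : Fin d → ℕ) : ℕ := ∏ i, (α i).factorial

/-- The monomial `x^β`. -/
def monomialAt {d : ℕ} (β : Fin d → ℕ) (x : RSpace d) : ℝ := ∏ i, x i ^ β i

/-- The partial derivative `∂_i g`. -/
noncomputable def partialDeriv {d : ℕ} (i : Fin d) (g : RSpace d → ℂ) : RSpace d → ℂ :=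
  fun x => fderiv ℝ g x (EuclideanSpace.single i 1)

/-- The partial derivative `∂^α g = ∂_1^{α_1} ⋯ ∂_d^{α_d} g`. -/
noncomputable def multiDeriv {d : ℕ} (α : Fin d → ℕ) (g : RSpace d → ℂ) : RSpace d → ℂ :=
  (List.finRange d).foldr (fun i u => (partialDeriv i)^[α i] u) g

theorem partialDeriv_contDiff {d : ℕ} (i : Fin d) {g : RSpace d → ℂ} (hg : ContDiff ℝ ∞ g) :
    ContDiff ℝ ∞ (partialDeriv i g) :=
  (hg.fderiv_right (m := ∞) (by simp)).clm_apply contDiff_const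

theorem partialDeriv_iterate_contDiff {d : ℕ} (i : Fin d) (n : ℕ) {g : RSpace d → ℂ}
    (hg : ContDiff ℝ ∞ g) : ContDiff ℝ ∞ ((partialDeriv i)^[n] g) := by
  induction n generalizing g with
  | zero => simpa using hg
  | succ n ih => exact ih (partialDeriv_contDiff i hg)

theorem partialDeriv_combo {d : ℕ} (i : Fin d) (a b : ℂ) {f g : RSpace d → ℂ}
    (hf : ContDiff ℝ ∞ f) (hg : ContDiff ℝ ∞ g) :
    partialDeriv i (a • f + b • g) = a • partialDeriv i f + b • partialDeriv i g := by
  funext x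
  have hf' : DifferentiableAt ℝ f x := (hf.differentiable (by simp)) x
  have hg' : DifferentiableAt ℝ g x := (hg.differentiable (by simp)) x
  simp only [partialDeriv, Pi.add_apply, Pi.smul_apply]
  rw [fderiv_add (hf'.const_smul a) (hg'.const_smul b), fderiv_const_smul hf' a,
    fderiv_const_smul hg' b]
  rfl

theorem partialDeriv_iterate_combo {d : ℕ} (i : Fin d) (n : ℕ) (a b : ℂ) {f g : RSpace d → ℂ}
    (hf : ContDiff ℝ ∞ f) (hg : ContDiff ℝ ∞ g) :
    (partialDeriv i)^[n] (a • f + b • g)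
      = a • (partialDeriv i)^[n] f + b • (partialDeriv i)^[n] g := by
  induction n generalizing f g with
  | zero => rfl
  | succ n ih =>
    simp only [Function.iterate_succ, Function.comp_apply]
    rw [partialDeriv_combo i a b hf hg,
      ih (partialDeriv_contDiff i hf) (partialDeriv_contDiff i hg)]

theorem multiDeriv_combo {d : ℕ} (α : Fin d → ℕ) (a b : ℂ) {f g : RSpace d → ℂ}
    (hf : ContDiff ℝ ∞ f) (hg : ContDiff ℝ ∞ g) :
    multiDeriv α (a • f + b • g) = a • multiDeriv α f + b • multiDeriv α g := by
  have smooth : ∀ (l : List (Fin d)) {u : RSpace d → ℂ}, ContDiff ℝ ∞ u →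
      ContDiff ℝ ∞ (l.foldr (fun i u => (partialDeriv i)^[α i] u) u) := by
    intro l u hu
    induction l with
    | nil => exact hu
    | cons i l ih => exact partialDeriv_iterate_contDiff i _ ih
  unfold multiDeriv
  induction List.finRange d with
  | nil => rfl
  | cons i l ih =>
    simp only [List.foldr_cons]
    rw [ih, partialDeriv_iterate_combo i _ a b (smooth l hf) (smooth l hg)]

/-- The estimate `|x^β ∂^α f(x)| ≤ M h^{|α|+|β|} (α! β!)^s` for all `α`, `β`, `x`; in other words
the norm of `f` in the Banach space `S_{s,h}^s` is at most `M`. -/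
def GSEstimate {d : ℕ} (s h M : ℝ) (f : RSpace d → ℂ) : Prop :=
  ∀ (α β : Fin d → ℕ) (x : RSpace d),
    ‖(monomialAt β x : ℂ) * multiDeriv α f x‖
      ≤ M * (h ^ (multiLength α + multiLength β)
          * ((multiFactorial α : ℝ) ^ s * (multiFactorial β : ℝ) ^ s))

theorem GSEstimate.combo {d : ℕ} {s h k M N : ℝ} {f g : RSpace d → ℂ} (a b : ℂ)
    (hh : 0 < h) (hk : 0 < k) (hf : ContDiff ℝ ∞ f) (hg : ContDiff ℝ ∞ g)
    (ef : GSEstimate s h M f) (eg : GSEstimate s k N g) :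
    GSEstimate s (max h k) (‖a‖ * |M| + ‖b‖ * |N|) (a • f + b • g) := by
  intro α β x
  rw [multiDeriv_combo α a b hf hg]
  have hw : 0 ≤ (multiFactorial α : ℝ) ^ s * (multiFactorial β : ℝ) ^ s := by positivity
  have key : ∀ (l K : ℝ) (u : RSpace d → ℂ), 0 < l → l ≤ max h k → GSEstimate s l K u →
      ‖(monomialAt β x : ℂ) * multiDeriv α u x‖
        ≤ |K| * (max h k ^ (multiLength α + multiLength β)
          * ((multiFactorial α : ℝ) ^ s * (multiFactorial β : ℝ) ^ s)) := by
    intro l K u hl hle hu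
    refine (hu α β x).trans ?_
    have h1 : l ^ (multiLength α + multiLength β) ≤ max h k ^ (multiLength α + multiLength β) :=
      pow_le_pow_left₀ hl.le hle _
    have h2 : 0 ≤ l ^ (multiLength α + multiLength β) := by positivity
    exact mul_le_mul (le_abs_self K) (mul_le_mul_of_nonneg_right h1 hw)
      (mul_nonneg h2 hw) (abs_nonneg K)
  have kf := key h M f hh (le_max_left _ _) ef
  have kg := key k N g hk (le_max_right _ _) eg
  have e : (monomialAt β x : ℂ) * (a • multiDeriv α f + b • multiDeriv α g) x
      = a * ((monomialAt β x : ℂ) * multiDeriv α f x)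
        + b * ((monomialAt β x : ℂ) * multiDeriv α g x) := by
    simp only [Pi.add_apply, Pi.smul_apply, smul_eq_mul]
    ring
  rw [e]
  refine (norm_add_le _ _).trans ?_
  rw [norm_mul a, norm_mul b, add_mul, mul_assoc ‖a‖, mul_assoc ‖b‖]
  exact add_le_add (mul_le_mul_of_nonneg_left kf (norm_nonneg a))
    (mul_le_mul_of_nonneg_left kg (norm_nonneg b))

theorem GSEstimate.zero {d : ℕ} (s h : ℝ) : GSEstimate s h 0 (0 : RSpace d → ℂ) := by
  intro α β x
  have e : multiDeriv α (0 : RSpace d → ℂ) = 0 := by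
    have h0 : ContDiff ℝ ∞ (0 : RSpace d → ℂ) := contDiff_const
    simpa using multiDeriv_combo α 0 0 h0 h0
  simp [e]

/-- The Gelfand-Shilov space `S_s(ℝ^d)` of Roumieu type. -/
def gelfandShilov (d : ℕ) (s : ℝ) : Submodule ℂ (RSpace d → ℂ) where
  carrier := {f | ContDiff ℝ ∞ f ∧ ∃ h > 0, ∃ M, GSEstimate s h M f}
  zero_mem' := ⟨contDiff_const, 1, one_pos, 0, GSEstimate.zero s 1⟩
  add_mem' := by
    rintro f g ⟨hf, h, hh, M, ef⟩ ⟨hg, k, hk, N, eg⟩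
    refine ⟨hf.add hg, max h k, lt_max_of_lt_left hh, ‖(1 : ℂ)‖ * |M| + ‖(1 : ℂ)‖ * |N|, ?_⟩
    simpa only [one_smul] using GSEstimate.combo 1 1 hh hk hf hg ef eg
  smul_mem' := by
    rintro c f ⟨hf, h, hh, M, ef⟩
    refine ⟨hf.const_smul c, max h h, lt_max_of_lt_left hh, ‖c‖ * |M| + ‖(0 : ℂ)‖ * |M|, ?_⟩
    simpa only [zero_smul, add_zero] using GSEstimate.combo c 0 hh hh hf hf ef ef

/-- The Gelfand-Shilov space `Σ_s(ℝ^d)` of Beurling type. -/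
def gelfandShilovBeurling (d : ℕ) (s : ℝ) : Set (RSpace d → ℂ) :=
  {f | ContDiff ℝ ∞ f ∧ ∀ h > 0, ∃ M, GSEstimate s h M f}

/-- The Gelfand-Shilov distributions `S_{1/2}'(ℝ^d)`: the linear forms on `S_{1/2}(ℝ^d)` whose
restriction to each of the Banach spaces `S_{1/2,h}^{1/2}(ℝ^d)`, `h > 0`, is bounded. -/
structure GSDistribution (d : ℕ) where
  toLinearMap : gelfandShilov d (1 / 2) →ₗ[ℂ] ℂ
  bounded : ∀ h > 0, ∃ C : ℝ, ∀ (ψ : gelfandShilov d (1 / 2)) (M : ℝ),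
    GSEstimate (1 / 2) h M (ψ : RSpace d → ℂ) → ‖toLinearMap ψ‖ ≤ C * M

/-- The distribution `f` is (given by integration against) the function `u`. -/
def GSDistribution.EqFun {d : ℕ} (f : GSDistribution d) (u : RSpace d → ℂ) : Prop :=
  ∀ ψ : gelfandShilov d (1 / 2),
    Integrable (fun x => u x * (ψ : RSpace d → ℂ) x) ∧
      f.toLinearMap ψ = ∫ x, u x * (ψ : RSpace d → ℂ) x

/-- The point `(x, ξ)` of `ℝ^{2d}`. -/
noncomputable def joinPoint {d : ℕ} (x ξ : RSpace d) : RSpace (d + d) :=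
  WithLp.toLp 2 (Fin.append x.ofLp ξ.ofLp)

/-- The character `e^{-i⟨y,ξ⟩}`. -/
noncomputable def charNeg {d : ℕ} (y ξ : RSpace d) : ℂ :=
  Complex.exp (-(Complex.I * ((inner ℝ y ξ : ℝ) : ℂ)))

/-- The constant `(2π)^{-d/2}`. -/
noncomputable def fourierConst (d : ℕ) : ℝ := (2 * Real.pi) ^ (-(d : ℝ) / 2)

/-- The short-time Fourier transform of a function `u` with window `φ`,
`V_φ u(x,ξ) = (2π)^{-d/2} ∫ u(y) \overline{φ(y-x)} e^{-i⟨y,ξ⟩} dy`. -/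
noncomputable def stftIntegral {d : ℕ} (φ u : RSpace d → ℂ) (x ξ : RSpace d) : ℂ :=
  (fourierConst d : ℂ) * ∫ y, u y * (starRingEnd ℂ) (φ (y - x)) * charNeg y ξ

/-- The formal transpose of `f ↦ V_φ f`, applied to a test function `Ψ` on `ℝ^{2d}`:
`y ↦ (2π)^{-d/2} ∬ \overline{φ(y-x)} e^{-i⟨y,ξ⟩} Ψ(x,ξ) dx dξ`. -/
noncomputable def stftTranspose {d : ℕ} (φ : RSpace d → ℂ) (Ψ : RSpace (d + d) → ℂ)
    (y : RSpace d) : ℂ :=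
  (fourierConst d : ℂ) *
    ∫ p : RSpace d × RSpace d,
      (starRingEnd ℂ) (φ (y - p.1)) * charNeg y p.2 * Ψ (joinPoint p.1 p.2)

/-- The short-time Fourier transform `V_φ f` of the distribution `f ∈ S_{1/2}'(ℝ^d)`, which is an
element of `S_{1/2}'(ℝ^{2d})` defined by duality, is the continuous function `F`:
for every `Ψ ∈ S_{1/2}(ℝ^{2d})`, the transpose of `Ψ` (which belongs to `S_{1/2}(ℝ^d)`) is
mapped by `f` to `∬ F(x,ξ) Ψ(x,ξ) dx dξ`. -/
def IsSTFT {d : ℕ} (φ : RSpace d → ℂ) (f : GSDistribution d)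
    (F : RSpace d → RSpace d → ℂ) : Prop :=
  Continuous (fun p : RSpace d × RSpace d => F p.1 p.2) ∧
  ∀ Ψ ∈ gelfandShilov (d + d) (1 / 2),
    Integrable (fun p : RSpace d × RSpace d => F p.1 p.2 * Ψ (joinPoint p.1 p.2)) ∧
    ∃ hg : stftTranspose φ Ψ ∈ gelfandShilov d (1 / 2),
      f.toLinearMap ⟨stftTranspose φ Ψ, hg⟩
        = ∫ p : RSpace d × RSpace d, F p.1 p.2 * Ψ (joinPoint p.1 p.2)

/-- `|∂^α u(x)| ≲ e^{h|x|^{1/s}} ε^{|α|} α!^s`, uniformly in `α` and `x`. -/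
def DerivBound {d : ℕ} (s h ε : ℝ) (u : RSpace d → ℂ) : Prop :=
  ∃ C : ℝ, ∀ (α : Fin d → ℕ) (x : RSpace d),
    ‖multiDeriv α u x‖
      ≤ C * (Real.exp (h * ‖x‖ ^ (1 / s)) * ε ^ multiLength α * (multiFactorial α : ℝ) ^ s)

/-- `|F(x,ξ)| ≲ e^{h|x|^{1/s} - ε|ξ|^{1/s}}`, uniformly in `x` and `ξ`. -/
def PhaseBound {d : ℕ} (s h ε : ℝ) (F : RSpace d → RSpace d → ℂ) : Prop :=
  ∃ C : ℝ, ∀ x ξ : RSpace d,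
    ‖F x ξ‖ ≤ C * Real.exp (h * ‖x‖ ^ (1 / s) - ε * ‖ξ‖ ^ (1 / s))

/-- The class `Γ^∞_s(ℝ^d)`. -/
def gammaInf (d : ℕ) (s : ℝ) : Set (RSpace d → ℂ) :=
  {u | ContDiff ℝ ∞ u ∧ ∃ ε > 0, ∀ h > 0, DerivBound s h ε u}

/-- The class `Γ^∞_{0,s}(ℝ^d)`. -/
def gammaInfZero (d : ℕ) (s : ℝ) : Set (RSpace d → ℂ) :=
  {u | ContDiff ℝ ∞ u ∧ ∃ h > 0, ∀ ε > 0, DerivBound s h ε u}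

/-- The class `Γ^∞_{1,s}(ℝ^d)`. -/
def gammaInfOne (d : ℕ) (s : ℝ) : Set (RSpace d → ℂ) :=
  {u | ContDiff ℝ ∞ u ∧ ∃ ε > 0, ∃ h > 0, DerivBound s h ε u}

/-- `κ(r) = 1` for `r ≤ 1` and `κ(r) = 2^{r-1}` for `r > 1`. -/
noncomputable def kappa (r : ℝ) : ℝ := if r ≤ 1 then 1 else 2 ^ (r - 1)

/-- The exponent `h` after its change by the factor `κ(1/s)`: `κ(1/s) h` for `h ≥ 0` and
`h / κ(1/s)` for `h < 0` (so it is `h` for every real `h` when `s ≥ 1`). -/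
noncomputable def changedExponent (s h : ℝ) : ℝ :=
  if 0 ≤ h then kappa (1 / s) * h else h / kappa (1 / s)

/-! The short-time Fourier transform trades regularity for decay in `ξ`, and the factorial weights
match the exponentials: moments bounded by `k^m (m!)^s` for all `m` amount to decay
`e^{-ε|ξ|^{1/s}}` with `ε` of order `k^{-1/s}` (`le_exp_of_moment_le`, `pow_mul_exp_neg_rpow_le`).
Growth in `x` is carried along by the quasi-triangle inequality for `|·|^{1/s}` with constant
`κ(1/s)`: it replaces `e^{h|y|^{1/s}}` by `e^{h^*|x|^{1/s}}` at a cost `e^{|h|κ(1/s)|y-x|^{1/s}}`,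
which the decay of the window pays for (`mul_norm_add_rpow_le`).

From `f` to `V_φ f`: a power `ξ_j^m` is exchanged by `m` integrations by parts for derivatives of
`f` and of the window. This gives `2^m` terms, each of size `ρ^m (m!)^s e^{h^*|x|^{1/s}}`
(`phaseBound_stftIntegral`). Fubini identifies the integral with the transform defined by duality
(`isSTFT_stftIntegral`).

From `V_φ f` to `f`: for a Gaussian `ψ` with `∫ conj φ · ψ ≠ 0`, `f` is a constant times the
synthesis integral `∬ F(x,ξ) ψ(y-x) e^{i⟨y,ξ⟩} dx dξ`. To see this, `V_φ f` is tested on a function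
built from `χ` and `ψ` whose transpose is a multiple of `χ`, by Fourier inversion
(`stftTranspose_stftPair`, `eqFun_synth`). Derivatives of the synthesis integral fall on `ψ` or
produce powers of `ξ`, which the decay of `F` absorbs (`derivBound_synth`). A Gaussian lies in
`S_{1/2}`, so for `s > 1/2` its derivatives and decay are as good as desired. At `s = 1/2` its rates
are fixed, which suffices for `Γ^∞_s` because there the exponent in `x` may be taken arbitrarily
small.

The duality requires the transpose and the special test functions to lie in `S_{1/2}`. That space is
described by words in the operators `∂_j` and `x_j`: a word of length `n` maps `f` to a function
bounded by `M h^n √(n!)`. A letter applied to a transform is a short linear combination of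
transforms of functions to which a letter has been applied, so such bounds pass through the
transforms (`mem_gelfandShilov_of_family`). -/

/-! ### Multi-indices, iterated partial derivatives and monomials. -/

theorem partialDeriv_comm {d : ℕ} (i j : Fin d) {g : RSpace d → ℂ} (hg : ContDiff ℝ ∞ g) :
    partialDeriv i (partialDeriv j g) = partialDeriv j (partialDeriv i g) := by
  funext x
  have hd : DifferentiableAt ℝ (fderiv ℝ g) x :=
    (hg.fderiv_right (m := ∞) (by simp)).differentiable (by simp) x
  have key : ∀ v w : RSpace d,
      fderiv ℝ (fun y => fderiv ℝ g y v) x w = fderiv ℝ (fderiv ℝ g) x w v := by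
    intro v w
    rw [fderiv_clm_apply hd (differentiableAt_const v)]
    simp
  have hs : IsSymmSndFDerivAt ℝ g x := hg.contDiffAt.isSymmSndFDerivAt
    (by
      rw [minSmoothness_of_isRCLikeNormedField]
      exact WithTop.coe_le_coe.2 (le_top : (2 : ℕ∞) ≤ ⊤))
  show fderiv ℝ (fun y => fderiv ℝ g y _) x _ = fderiv ℝ (fun y => fderiv ℝ g y _) x _
  rw [key, key]
  exact hs _ _

theorem partialDeriv_iterate_comm {d : ℕ} (i j : Fin d) (n : ℕ) {g : RSpace d → ℂ}
    (hg : ContDiff ℝ ∞ g) :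
    (partialDeriv i)^[n] (partialDeriv j g) = partialDeriv j ((partialDeriv i)^[n] g) := by
  induction n generalizing g with
  | zero => rfl
  | succ n ih =>
    simp only [Function.iterate_succ, Function.comp_apply]
    rw [partialDeriv_comm i j hg, ih (partialDeriv_contDiff i hg)]

theorem foldr_partialDeriv_contDiff {d : ℕ} (α : Fin d → ℕ) (l : List (Fin d))
    {g : RSpace d → ℂ} (hg : ContDiff ℝ ∞ g) :
    ContDiff ℝ ∞ (l.foldr (fun i u => (partialDeriv i)^[α i] u) g) := by
  induction l with
  | nil => exact hg
  | cons i l ih => exact partialDeriv_iterate_contDiff i _ ih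

theorem multiDeriv_contDiff {d : ℕ} (α : Fin d → ℕ) {g : RSpace d → ℂ} (hg : ContDiff ℝ ∞ g) :
    ContDiff ℝ ∞ (multiDeriv α g) :=
  foldr_partialDeriv_contDiff α _ hg

theorem multiDeriv_zero {d : ℕ} (g : RSpace d → ℂ) : multiDeriv 0 g = g := by
  unfold multiDeriv
  induction List.finRange d with
  | nil => rfl
  | cons i l ih => simp

theorem multiDeriv_partialDeriv {d : ℕ} (α : Fin d → ℕ) (j : Fin d) {g : RSpace d → ℂ}
    (hg : ContDiff ℝ ∞ g) :
    multiDeriv α (partialDeriv j g) = partialDeriv j (multiDeriv α g) := by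
  unfold multiDeriv
  induction List.finRange d with
  | nil => rfl
  | cons i l ih =>
    simp only [List.foldr_cons]
    rw [ih, partialDeriv_iterate_comm i j _ (foldr_partialDeriv_contDiff α l hg)]

/-- The fold applies the derivatives in a fixed order, so an extra `∂_j` has to be commuted outwards
past the later operators; a list without repetition meets `j` at most once. -/
theorem foldr_partialDeriv_add_single {d : ℕ} (α : Fin d → ℕ) (j : Fin d) (l : List (Fin d))
    (hl : l.Nodup) {g : RSpace d → ℂ} (hg : ContDiff ℝ ∞ g) :
    l.foldr (fun i u => (partialDeriv i)^[(α + Pi.single j 1 : Fin d → ℕ) i] u) g =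
      if j ∈ l then partialDeriv j (l.foldr (fun i u => (partialDeriv i)^[α i] u) g)
      else l.foldr (fun i u => (partialDeriv i)^[α i] u) g := by
  induction l with
  | nil => simp
  | cons i l ih =>
    rw [List.nodup_cons] at hl
    have hs := foldr_partialDeriv_contDiff α l hg
    simp only [List.foldr_cons, ih hl.2, List.mem_cons]
    by_cases hji : j = i
    · subst hji
      simp only [hl.1, if_false, true_or, if_true, Pi.add_apply, Pi.single_eq_same]
      rw [Function.iterate_succ_apply']
    · have : (α + Pi.single j 1 : Fin d → ℕ) i = α i := by
        simp [Pi.single_eq_of_ne (Ne.symm hji)]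
      rw [this]
      by_cases hjl : j ∈ l
      · simp only [hjl, or_true, if_true]
        exact partialDeriv_iterate_comm i j _ hs
      · simp [hjl, hji]

theorem multiDeriv_add_single {d : ℕ} (α : Fin d → ℕ) (j : Fin d) {g : RSpace d → ℂ}
    (hg : ContDiff ℝ ∞ g) :
    multiDeriv (α + Pi.single j 1) g = partialDeriv j (multiDeriv α g) := by
  have := foldr_partialDeriv_add_single α j _ (List.nodup_finRange d) hg
  simpa [multiDeriv] using this

theorem multiLength_add {d : ℕ} (α β : Fin d → ℕ) :
    multiLength (α + β) = multiLength α + multiLength β := by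
  simp [multiLength, Finset.sum_add_distrib]

theorem multiLength_single {d : ℕ} (j : Fin d) (m : ℕ) :
    multiLength (Pi.single j m : Fin d → ℕ) = m := by
  simp [multiLength]

theorem multiLength_zero {d : ℕ} : multiLength (0 : Fin d → ℕ) = 0 := by
  simp [multiLength]

theorem multiFactorial_single {d : ℕ} (j : Fin d) (m : ℕ) :
    multiFactorial (Pi.single j m : Fin d → ℕ) = m.factorial := by
  unfold multiFactorial
  rw [Finset.prod_eq_single j]
  · simp
  · intro i _ hi; simp [Pi.single_eq_of_ne hi]
  · simp

theorem multiFactorial_zero {d : ℕ} : multiFactorial (0 : Fin d → ℕ) = 1 := by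
  simp [multiFactorial]

theorem multiFactorial_mul_le_add {d : ℕ} (α β : Fin d → ℕ) :
    multiFactorial α * multiFactorial β ≤ multiFactorial (α + β) := by
  unfold multiFactorial
  rw [← Finset.prod_mul_distrib]
  exact Finset.prod_le_prod' fun i _ =>
    Nat.le_of_dvd (Nat.factorial_pos _) (Nat.factorial_mul_factorial_dvd_factorial_add _ _)

theorem factorial_add_le (a b : ℕ) :
    (a + b).factorial ≤ 2 ^ (a + b) * (a.factorial * b.factorial) := by
  rw [← Nat.add_choose_mul_factorial_mul_factorial a b, mul_assoc]
  exact Nat.mul_le_mul_right _ (Nat.choose_le_two_pow _ _)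

theorem multiFactorial_le_factorial {d : ℕ} (α : Fin d → ℕ) :
    multiFactorial α ≤ (multiLength α).factorial :=
  Nat.le_of_dvd (Nat.factorial_pos _) (Nat.prod_factorial_dvd_factorial_sum _ _)

/-- Each coordinate split off from the sum costs one binomial coefficient, at most a power of `2`;
hence the base `2 ^ d`. -/
theorem factorial_multiLength_le {d : ℕ} (α : Fin d → ℕ) :
    (multiLength α).factorial ≤ (2 ^ d) ^ multiLength α * multiFactorial α := by
  have key : ∀ s : Finset (Fin d), (∑ i ∈ s, α i).factorial
      ≤ (2 ^ s.card) ^ (∑ i ∈ s, α i) * ∏ i ∈ s, (α i).factorial := by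
    intro s
    induction s using Finset.induction_on with
    | empty => simp
    | insert i s hi ih =>
      rw [Finset.sum_insert hi, Finset.prod_insert hi, Finset.card_insert_of_notMem hi]
      refine (factorial_add_le _ _).trans ?_
      have h2 : (2 ^ s.card) ^ (∑ i ∈ s, α i) ≤ (2 ^ s.card) ^ (α i + ∑ i ∈ s, α i) :=
        Nat.pow_le_pow_right (by positivity) (by omega)
      calc 2 ^ (α i + ∑ i ∈ s, α i) * ((α i).factorial * (∑ i ∈ s, α i).factorial)
          ≤ 2 ^ (α i + ∑ i ∈ s, α i) * ((α i).factorial *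
            ((2 ^ s.card) ^ (α i + ∑ i ∈ s, α i) * ∏ i ∈ s, (α i).factorial)) := by
              gcongr
              exact ih.trans (Nat.mul_le_mul_right _ h2)
        _ = _ := by rw [pow_succ, mul_pow]; ring
  simpa [multiLength, multiFactorial] using key Finset.univ

theorem multiIndex_induction {d : ℕ} {P : (Fin d → ℕ) → Prop} (h0 : P 0)
    (hs : ∀ α j, P α → P (α + Pi.single j 1)) (α : Fin d → ℕ) : P α := by
  induction hn : multiLength α generalizing α with
  | zero =>
    have : α = 0 := by
      funext i
      have := (Finset.sum_eq_zero_iff.mp hn) i (Finset.mem_univ i)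
      simpa using this
    rw [this]; exact h0
  | succ n ih =>
    obtain ⟨j, hj⟩ : ∃ j, α j ≠ 0 := by
      by_contra! hcon
      have : multiLength α = 0 := Finset.sum_eq_zero fun i _ => hcon i
      omega
    have hα : α = (α - Pi.single j 1) + Pi.single j 1 := by
      funext i
      by_cases hi : i = j
      · subst hi; simp; omega
      · simp [Pi.single_eq_of_ne hi]
    rw [hα]
    apply hs
    apply ih
    have := multiLength_add (α - Pi.single j 1) (Pi.single j 1)
    rw [← hα, multiLength_single] at this
    omega

theorem monomialAt_zero {d : ℕ} (x : RSpace d) : monomialAt 0 x = 1 := by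
  simp [monomialAt]

theorem monomialAt_add {d : ℕ} (α β : Fin d → ℕ) (x : RSpace d) :
    monomialAt (α + β) x = monomialAt α x * monomialAt β x := by
  simp [monomialAt, pow_add, Finset.prod_mul_distrib]

theorem monomialAt_single {d : ℕ} (j : Fin d) (m : ℕ) (x : RSpace d) :
    monomialAt (Pi.single j m) x = x j ^ m := by
  unfold monomialAt
  rw [Finset.prod_eq_single j]
  · simp
  · intro i _ hi; simp [Pi.single_eq_of_ne hi]
  · simp

theorem coord_contDiff {d : ℕ} (j : Fin d) : ContDiff ℝ ∞ (fun x : RSpace d => ((x j : ℝ) : ℂ)) :=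
  (Complex.ofRealCLM.contDiff).comp (EuclideanSpace.proj (𝕜 := ℝ) j).contDiff

theorem monomialAt_contDiff {d : ℕ} (β : Fin d → ℕ) :
    ContDiff ℝ ∞ (fun x : RSpace d => (monomialAt β x : ℂ)) := by
  simp only [monomialAt, Complex.ofReal_prod, Complex.ofReal_pow]
  exact contDiff_prod fun i _ => (coord_contDiff i).pow _

theorem partialDeriv_mul {d : ℕ} (j : Fin d) {f g : RSpace d → ℂ} (x : RSpace d)
    (hf : DifferentiableAt ℝ f x) (hg : DifferentiableAt ℝ g x) :
    partialDeriv j (fun y => f y * g y) x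
      = partialDeriv j f x * g x + f x * partialDeriv j g x := by
  simp only [partialDeriv]
  rw [fderiv_fun_mul hf hg]
  simp only [add_apply, smul_apply, smul_eq_mul]
  ring

theorem partialDeriv_coord {d : ℕ} (j i : Fin d) (x : RSpace d) :
    partialDeriv j (fun x : RSpace d => ((x i : ℝ) : ℂ)) x = if i = j then 1 else 0 := by
  have : HasFDerivAt (fun x : RSpace d => ((x i : ℝ) : ℂ))
      (Complex.ofRealCLM.comp (EuclideanSpace.proj (𝕜 := ℝ) i)) x :=
    (Complex.ofRealCLM.comp (EuclideanSpace.proj (𝕜 := ℝ) i)).hasFDerivAt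
  rw [partialDeriv, this.fderiv]
  by_cases h : i = j
  · subst h; simp
  · simp [h]

theorem partialDeriv_monomialAt {d : ℕ} (j : Fin d) (β : Fin d → ℕ) (x : RSpace d) :
    partialDeriv j (fun x : RSpace d => (monomialAt β x : ℂ)) x
      = β j * (monomialAt (β - Pi.single j 1) x : ℂ) := by
  induction β using multiIndex_induction generalizing x with
  | h0 => simp [monomialAt_zero, partialDeriv]
  | hs β i ih =>
    have e : (fun x : RSpace d => (monomialAt (β + Pi.single i 1) x : ℂ))
        = fun x => ((x i : ℝ) : ℂ) * (monomialAt β x : ℂ) := by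
      funext x
      rw [monomialAt_add, monomialAt_single]
      push_cast; ring
    rw [e, partialDeriv_mul j x ((coord_contDiff i).differentiable (by simp) x)
      ((monomialAt_contDiff β).differentiable (by simp) x), ih, partialDeriv_coord]
    by_cases hij : i = j
    · subst hij
      have e1 : (β + Pi.single i 1 - Pi.single i 1 : Fin d → ℕ) = β := by
        funext k; simp
      rw [e1]
      simp only [if_true, Pi.add_apply, Pi.single_eq_same, Nat.cast_add, Nat.cast_one]
      -- Subtraction of multi-indices is truncated; when it truncates, the coefficient `β i`
      -- vanishes.
      by_cases h0 : β i = 0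
      · simp [h0]
      · have e2 : β = (β - Pi.single i 1) + Pi.single i 1 := by
          funext k
          by_cases hk : k = i
          · subst hk; simp; omega
          · simp [Pi.single_eq_of_ne hk]
        have e3 : (monomialAt β x : ℂ) = (monomialAt (β - Pi.single i 1) x : ℂ) * (x i : ℂ) := by
          conv_lhs => rw [e2]
          rw [monomialAt_add, monomialAt_single]
          push_cast; ring
        rw [e3]; ring
    · have e1 : (β + Pi.single i 1 - Pi.single j 1 : Fin d → ℕ)
          = (β - Pi.single j 1) + Pi.single i 1 := by
        funext k
        by_cases hk : k = j
        · subst hk; simp [Pi.single_eq_of_ne (Ne.symm hij)]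
        · simp [Pi.single_eq_of_ne hk]
      rw [e1, monomialAt_add, monomialAt_single]
      have e4 : (β + Pi.single i 1 : Fin d → ℕ) j = β j := by
        simp [Pi.single_eq_of_ne (Ne.symm hij)]
      rw [e4]
      simp only [hij, if_false]
      push_cast; ring

theorem fderiv_eq_sum_partialDeriv {d : ℕ} (g : RSpace d → ℂ) (x : RSpace d) :
    fderiv ℝ g x = ∑ j, (EuclideanSpace.proj (𝕜 := ℝ) j).smulRight (partialDeriv j g x) := by
  ext v
  have hv : v = ∑ j, v j • EuclideanSpace.single j (1 : ℝ) := by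
    ext i; simp [Finset.sum_apply, Pi.single_apply]
  conv_lhs => rw [hv]
  simp [map_sum, partialDeriv]

/-- The norm is at most the sum of the coordinates in absolute value. This reduces moments in `‖x‖`
to powers of a single coordinate. -/
theorem exists_coord_norm_le {d : ℕ} (x : RSpace d) (hx : x ≠ 0) :
    ∃ j, ‖x‖ ≤ d * |x j| := by
  by_contra! hcon
  have hd : (Finset.univ : Finset (Fin d)).Nonempty := by
    by_contra hne
    rw [Finset.not_nonempty_iff_eq_empty] at hne
    apply hx; ext i
    have : i ∈ (Finset.univ : Finset (Fin d)) := Finset.mem_univ i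
    rw [hne] at this; simp at this
  have h1 : ‖x‖ ≤ ∑ j, |x j| := by
    have hv : x = ∑ j, x j • EuclideanSpace.single j (1 : ℝ) := by
      ext i; simp [Finset.sum_apply, Pi.single_apply]
    conv_lhs => rw [hv]
    refine (norm_sum_le _ _).trans (Finset.sum_le_sum fun j _ => ?_)
    simp [norm_smul]
  have h2 : ∑ j : Fin d, (d : ℝ) * |x j| < ∑ _j : Fin d, ‖x‖ :=
    Finset.sum_lt_sum_of_nonempty hd fun j _ => hcon j
  rw [← Finset.mul_sum] at h2
  simp only [Finset.sum_const, Finset.card_univ, Fintype.card_fin, nsmul_eq_mul] at h2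
  have := mul_le_mul_of_nonneg_left h1 (Nat.cast_nonneg (α := ℝ) d)
  linarith
-- Factorial moments and exponential decay.
theorem rpow_inv_pow {t s : ℝ} (ht : 0 ≤ t) (m : ℕ) : (t ^ m) ^ (1 / s) = (t ^ (1 / s)) ^ m := by
  rw [← Real.rpow_natCast, ← Real.rpow_natCast, ← Real.rpow_mul ht, ← Real.rpow_mul ht, mul_comm]

theorem rpow_one_div_rpow {t s : ℝ} (ht : 0 ≤ t) (hs : 0 < s) : (t ^ (1 / s)) ^ s = t := by
  rw [← Real.rpow_mul ht, one_div_mul_cancel hs.ne', Real.rpow_one]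

theorem rpow_rpow_one_div {t s : ℝ} (ht : 0 ≤ t) (hs : 0 < s) : (t ^ s) ^ (1 / s) = t := by
  rw [← Real.rpow_mul ht, mul_one_div_cancel hs.ne', Real.rpow_one]

/-- Factorial growth of all moments gives exponential decay. -/
theorem le_exp_of_moment_le {s k t A B : ℝ} (hs : 0 < s) (hk : 0 < k) (ht : 0 ≤ t) (hA : 0 ≤ A)
    (hB : 0 ≤ B) (h : ∀ m : ℕ, t ^ m * A ≤ B * (k ^ m * (m.factorial : ℝ) ^ s)) :
    A ≤ 2 ^ s * B * Real.exp (-(s / (2 * k ^ (1 / s))) * t ^ (1 / s)) := by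
  set τ := t ^ (1 / s) with hτ
  set q := k ^ (1 / s) with hq
  set a := A ^ (1 / s) with ha
  set b := B ^ (1 / s) with hb
  have hq0 : 0 < q := Real.rpow_pos_of_pos hk _
  have hτ0 : 0 ≤ τ := Real.rpow_nonneg ht _
  have ha0 : 0 ≤ a := Real.rpow_nonneg hA _
  have hb0 : 0 ≤ b := Real.rpow_nonneg hB _
  -- The power `1/s` turns `(m!)^s` into `m!`. The `2` in `τ / (2 * q)` leaves a geometric series of
  -- sum `2`, the source of the factor `2 ^ s`.
  have h1 : ∀ m : ℕ, (τ / (2 * q)) ^ m / m.factorial * a ≤ b * (1 / 2) ^ m := by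
    intro m
    have h2 := Real.rpow_le_rpow (by positivity) (h m) (one_div_pos.2 hs).le
    rw [Real.mul_rpow (by positivity) hA, Real.mul_rpow hB (by positivity),
      Real.mul_rpow (by positivity) (by positivity), rpow_inv_pow ht, rpow_inv_pow hk.le,
      rpow_rpow_one_div (by positivity) hs] at h2
    have hf : (0 : ℝ) < m.factorial := by positivity
    rw [div_pow, mul_pow, div_div, div_mul_eq_mul_div, div_le_iff₀ (by positivity)]
    calc τ ^ m * a ≤ b * (q ^ m * m.factorial) := h2
      _ = b * (1 / 2) ^ m * (2 ^ m * q ^ m * m.factorial) := by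
        rw [div_pow, one_pow]; field_simp
  have h3 : Real.exp (τ / (2 * q)) * a ≤ b * 2 := by
    have e1 : HasSum (fun m : ℕ => (τ / (2 * q)) ^ m / m.factorial) (Real.exp (τ / (2 * q))) := by
      rw [Real.exp_eq_exp_ℝ]
      exact NormedSpace.expSeries_div_hasSum_exp (τ / (2 * q))
    exact hasSum_le h1 (e1.mul_right a) (hasSum_geometric_two.mul_left b)
  have h4 : a ≤ 2 * b * Real.exp (-(τ / (2 * q))) := by
    rw [Real.exp_neg, ← div_eq_mul_inv, le_div_iff₀ (Real.exp_pos _)]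
    linarith
  have h5 := Real.rpow_le_rpow ha0 h4 hs.le
  rw [rpow_one_div_rpow hA hs, Real.mul_rpow (by positivity) (by positivity),
    Real.mul_rpow (by positivity) hb0, rpow_one_div_rpow hB hs, ← Real.exp_mul] at h5
  refine h5.trans (le_of_eq ?_)
  congr 2
  field_simp

/-- A single term of the exponential series, `y^m / m! ≤ e^y`, taken at `y = r t^{1/s} / s` and
raised to the power `s`. It is the converse of the moment criterion. -/
theorem pow_mul_exp_neg_rpow_le {s r t : ℝ} (hs : 0 < s) (hr : 0 < r) (ht : 0 ≤ t) (m : ℕ) :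
    t ^ m * Real.exp (-r * t ^ (1 / s)) ≤ ((s / r) ^ s) ^ m * (m.factorial : ℝ) ^ s := by
  set τ := t ^ (1 / s) with hτ
  have hτ0 : 0 ≤ τ := Real.rpow_nonneg ht _
  have h1 := Real.pow_div_factorial_le_exp (r * τ / s) (by positivity) m
  have hf : (0 : ℝ) < m.factorial := by positivity
  have h2 : τ ^ m * Real.exp (-(r * τ / s)) ≤ (s / r) ^ m * m.factorial := by
    rw [Real.exp_neg, ← div_eq_mul_inv, div_le_iff₀ (Real.exp_pos _)]
    rw [div_le_iff₀ hf] at h1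
    calc τ ^ m = (s / r) ^ m * (r * τ / s) ^ m := by
          rw [← mul_pow]; congr 1; field_simp
      _ ≤ (s / r) ^ m * (Real.exp (r * τ / s) * m.factorial) := by gcongr
      _ = _ := by ring
  have h3 := Real.rpow_le_rpow (by positivity) h2 hs.le
  rw [Real.mul_rpow (by positivity) (by positivity), Real.mul_rpow (by positivity) (by positivity),
    ← Real.exp_mul] at h3
  have e1 : ∀ c : ℝ, 0 ≤ c → (c ^ m) ^ s = (c ^ s) ^ m := fun c hc => by
    rw [← Real.rpow_natCast, ← Real.rpow_natCast, ← Real.rpow_mul hc, ← Real.rpow_mul hc, mul_comm]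
  rw [e1 _ hτ0, e1 _ (by positivity), rpow_one_div_rpow ht hs] at h3
  refine le_trans (le_of_eq ?_) h3
  congr 2
  field_simp

theorem pow_le_factorial_rpow {σ T : ℝ} (hσ : 0 < σ) (hT : 0 ≤ T) (m : ℕ) :
    T ^ m ≤ Real.exp (σ * T ^ (1 / σ)) * (m.factorial : ℝ) ^ σ := by
  have h := pow_mul_exp_neg_rpow_le hσ hσ hT m
  rw [div_self hσ.ne', Real.one_rpow, one_pow, one_mul, neg_mul, Real.exp_neg, ← div_eq_mul_inv,
    div_le_iff₀ (Real.exp_pos _)] at h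
  linarith

/-! ### The weight `|x|^{1/s}` under translation, and comparison with Gaussians. -/

theorem one_le_kappa (p : ℝ) : 1 ≤ kappa p := by
  unfold kappa
  split_ifs with h
  · exact le_rfl
  · exact Real.one_le_rpow (by norm_num) (by linarith)

theorem kappa_pos (p : ℝ) : 0 < kappa p := lt_of_lt_of_le one_pos (one_le_kappa p)

theorem rpow_add_le_kappa {p a b : ℝ} (hp : 0 ≤ p) (ha : 0 ≤ a) (hb : 0 ≤ b) :
    (a + b) ^ p ≤ kappa p * (a ^ p + b ^ p) := by
  unfold kappa
  split_ifs with h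
  · rw [one_mul]; exact Real.rpow_add_le_add_rpow ha hb hp h
  · lift a to NNReal using ha
    lift b to NNReal using hb
    exact_mod_cast NNReal.rpow_add_le_mul_rpow_add_rpow a b (by linarith)

theorem norm_add_rpow_le {E : Type*} [NormedAddCommGroup E] {p : ℝ} (hp : 0 ≤ p) (x z : E) :
    ‖x + z‖ ^ p ≤ kappa p * (‖x‖ ^ p + ‖z‖ ^ p) :=
  (Real.rpow_le_rpow (norm_nonneg _) (norm_add_le x z) hp).trans
    (rpow_add_le_kappa hp (norm_nonneg _) (norm_nonneg _))

/-- The origin of `h^*`. For `h ≥ 0` the quasi-triangle inequality is applied to `x + z`; for `h <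
0` a lower bound of `‖x + z‖` is needed, and it is applied to `x = (x + z) + (-z)`, so that `κ`
appears in the denominator. -/
theorem mul_norm_add_rpow_le {E : Type*} [NormedAddCommGroup E] {s : ℝ} (hs : 0 < s) (h : ℝ)
    (x z : E) :
    h * ‖x + z‖ ^ (1 / s) ≤ changedExponent s h * ‖x‖ ^ (1 / s)
      + |h| * kappa (1 / s) * ‖z‖ ^ (1 / s) := by
  have hp : 0 ≤ 1 / s := (one_div_pos.2 hs).le
  have hκ := kappa_pos (1 / s)
  have hz : 0 ≤ ‖z‖ ^ (1 / s) := by positivity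
  unfold changedExponent
  split_ifs with h0
  · rw [abs_of_nonneg h0]
    have := mul_le_mul_of_nonneg_left (norm_add_rpow_le hp x z) h0
    linarith
  · push Not at h0
    rw [abs_of_neg h0]
    have h1 := norm_add_rpow_le hp (x + z) (-z)
    rw [add_neg_cancel_right, norm_neg] at h1
    have h2 : ‖x‖ ^ (1 / s) / kappa (1 / s) ≤ ‖x + z‖ ^ (1 / s) + ‖z‖ ^ (1 / s) := by
      rw [div_le_iff₀ hκ]; linarith
    have h3 := mul_le_mul_of_nonneg_left h2 (neg_pos.2 h0).le
    have h4 : -h * ‖z‖ ^ (1 / s) ≤ -h * kappa (1 / s) * ‖z‖ ^ (1 / s) := by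
      have := mul_le_mul_of_nonneg_left (one_le_kappa (1 / s))
        (mul_nonneg (neg_pos.2 h0).le hz)
      linarith
    have e : h / kappa (1 / s) * ‖x‖ ^ (1 / s) = -(-h * (‖x‖ ^ (1 / s) / kappa (1 / s))) := by
      ring
    rw [e]; linarith

theorem one_add_pow_mul_exp_le (N : ℕ) {r p : ℝ} (hr : 0 < r) (hp : 0 < p) :
    ∃ C, ∀ t : ℝ, 0 ≤ t → (1 + t) ^ N * Real.exp (-r * t ^ p) ≤ C := by
  refine ⟨2 ^ N * (1 + ((1 / p / r) ^ (1 / p)) ^ N * (N.factorial : ℝ) ^ (1 / p)), fun t ht => ?_⟩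
  have h1 := pow_mul_exp_neg_rpow_le (one_div_pos.2 hp) hr ht N
  rw [one_div_one_div] at h1
  have h2 : (1 + t) ^ N ≤ 2 ^ N * (1 + t ^ N) := by
    rcases le_total t 1 with h | h
    · calc (1 + t) ^ N ≤ 2 ^ N := pow_le_pow_left₀ (by positivity) (by linarith) N
        _ ≤ 2 ^ N * (1 + t ^ N) := by
          have : (0 : ℝ) ≤ t ^ N := by positivity
          exact le_mul_of_one_le_right (by positivity) (by linarith)
    · calc (1 + t) ^ N ≤ (2 * t) ^ N := pow_le_pow_left₀ (by positivity) (by linarith) N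
        _ = 2 ^ N * t ^ N := mul_pow _ _ _
        _ ≤ _ := by gcongr; linarith
  have h3 : Real.exp (-r * t ^ p) ≤ 1 := by
    rw [Real.exp_le_one_iff]
    have : 0 ≤ t ^ p := by positivity
    nlinarith
  calc (1 + t) ^ N * Real.exp (-r * t ^ p)
      ≤ 2 ^ N * (1 + t ^ N) * Real.exp (-r * t ^ p) := by gcongr
    _ = 2 ^ N * (Real.exp (-r * t ^ p) + t ^ N * Real.exp (-r * t ^ p)) := by ring
    _ ≤ _ := by gcongr

theorem integrable_one_add_norm_pow_inv (d : ℕ) :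
    Integrable (fun x : RSpace d => ((1 + ‖x‖) ^ (d + 1))⁻¹) := by
  have := integrable_one_add_norm (E := RSpace d) (μ := volume) (r := d + 1) (by simp)
  refine this.congr (Filter.Eventually.of_forall fun x => ?_)
  simp only
  rw [Real.rpow_neg (by positivity)]
  congr 1
  exact_mod_cast Real.rpow_natCast _ _

theorem integrable_exp_neg_mul_norm_rpow (d : ℕ) {r p : ℝ} (hr : 0 < r) (hp : 0 < p) :
    Integrable (fun x : RSpace d => Real.exp (-r * ‖x‖ ^ p)) := by
  obtain ⟨C, hC⟩ := one_add_pow_mul_exp_le (d + 1) hr hp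
  refine ((integrable_one_add_norm_pow_inv d).const_mul C).mono' ?_ ?_
  · exact Continuous.aestronglyMeasurable
      (by have := hp.le; fun_prop (disch := simp [hp.le]))
  · refine Filter.Eventually.of_forall fun x => ?_
    rw [Real.norm_of_nonneg (Real.exp_pos _).le, ← div_eq_mul_inv, le_div_iff₀ (by positivity),
      mul_comm]
    exact hC _ (norm_nonneg x)

theorem exp_mul_rpow_le_exp_sq {p : ℝ} (hp : 0 ≤ p) (hp2 : p < 2) (h : ℝ) {c : ℝ} (hc : 0 < c) :
    ∃ C, 0 ≤ C ∧ ∀ t : ℝ, 0 ≤ t → Real.exp (h * t ^ p) ≤ C * Real.exp (c * t ^ 2) := by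
  -- The point where `|h| t^p = c t^2`; beyond it the square dominates because `p < 2`.
  set T := (|h| / c) ^ (1 / (2 - p)) with hT
  have hT0 : 0 ≤ T := by positivity
  refine ⟨Real.exp (|h| * T ^ p), (Real.exp_pos _).le, fun t ht => ?_⟩
  rw [← Real.exp_add, Real.exp_le_exp]
  have h0 : h * t ^ p ≤ |h| * t ^ p := mul_le_mul_of_nonneg_right (le_abs_self h) (by positivity)
  rcases le_total t T with h1 | h1
  · have : |h| * t ^ p ≤ |h| * T ^ p := by gcongr
    have : 0 ≤ c * t ^ 2 := by positivity
    linarith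
  · have h2 : |h| / c ≤ t ^ (2 - p) := by
      have := Real.rpow_le_rpow hT0 h1 (by linarith : 0 ≤ 2 - p)
      rwa [hT, rpow_one_div_rpow (by positivity) (by linarith)] at this
    have h3 : |h| * t ^ p ≤ c * t ^ 2 := by
      rw [div_le_iff₀ hc] at h2
      rcases ht.eq_or_lt with rfl | ht'
      · rcases hp.eq_or_lt with rfl | hp'
        · rw [Real.zero_rpow (by norm_num)] at h2
          simp at h2; simp [h2]
        · rw [Real.zero_rpow hp'.ne']; simp
      calc |h| * t ^ p ≤ t ^ (2 - p) * c * t ^ p := by gcongr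
        _ = c * (t ^ (2 - p) * t ^ p) := by ring
        _ = c * t ^ 2 := by rw [← Real.rpow_add ht']; norm_num
    have : 0 ≤ |h| * T ^ p := by positivity
    linarith

/-! ### Windows in Gelfand-Shilov spaces. -/

/-- `|∂^γ φ(x)| ≲ k^{|γ|} γ!^s e^{-r|x|^{1/s}}`, uniformly in `γ` and `x`. -/
def WindowBound {d : ℕ} (s k r : ℝ) (φ : RSpace d → ℂ) : Prop :=
  ∃ C, 0 ≤ C ∧ ∀ (γ : Fin d → ℕ) (x : RSpace d), ‖multiDeriv γ φ x‖
    ≤ C * (k ^ multiLength γ * (multiFactorial γ : ℝ) ^ s * Real.exp (-r * ‖x‖ ^ (1 / s)))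

theorem GSEstimate.nonneg {d : ℕ} {s h M : ℝ} {f : RSpace d → ℂ} (hf : GSEstimate s h M f) :
    0 ≤ M := by
  have := (norm_nonneg _).trans (hf 0 0 0)
  simpa [multiLength_zero, multiFactorial_zero] using this

/-- The monomials `x_j^m` in one coordinate suffice, as the largest coordinate controls the norm;
the moment criterion then gives the decay. The factor `d + 1` in place of `d` keeps the constants
positive in dimension zero. -/
theorem GSEstimate.windowBound {d : ℕ} {s h M : ℝ} {f : RSpace d → ℂ} (hs : 0 < s) (hh : 0 < h)
    (hf : GSEstimate s h M f) : WindowBound s h (s / (2 * ((d + 1) * h) ^ (1 / s))) f := by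
  have hM := hf.nonneg
  refine ⟨2 ^ s * M, by positivity, fun γ x => ?_⟩
  have key := le_exp_of_moment_le (s := s) (k := (d + 1) * h) (t := ‖x‖)
    (A := ‖multiDeriv γ f x‖) (B := M * (h ^ multiLength γ * (multiFactorial γ : ℝ) ^ s)) hs
    (by positivity) (norm_nonneg x) (norm_nonneg _) (by positivity) ?_
  · refine key.trans (le_of_eq ?_); ring
  intro m
  have h0 : ∀ j, |x j| ^ m * ‖multiDeriv γ f x‖
      ≤ M * (h ^ (multiLength γ + m) * ((multiFactorial γ : ℝ) ^ s * (m.factorial : ℝ) ^ s)) := by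
    intro j
    have := hf γ (Pi.single j m) x
    rwa [monomialAt_single, multiLength_single, multiFactorial_single, norm_mul,
      Complex.norm_real, norm_pow, Real.norm_eq_abs] at this
  rcases Nat.eq_zero_or_pos m with rfl | hm
  · have := hf γ 0 x
    simpa [multiLength_zero, multiFactorial_zero, monomialAt_zero] using this
  by_cases hx : x = 0
  · subst hx
    rw [norm_zero, zero_pow hm.ne', zero_mul]
    positivity
  obtain ⟨j, hj⟩ := exists_coord_norm_le x hx
  have hj' : ‖x‖ ≤ (d + 1) * |x j| := hj.trans (by gcongr; linarith)
  calc ‖x‖ ^ m * ‖multiDeriv γ f x‖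
      ≤ ((d + 1) * |x j|) ^ m * ‖multiDeriv γ f x‖ := by gcongr
    _ = (d + 1) ^ m * (|x j| ^ m * ‖multiDeriv γ f x‖) := by rw [mul_pow]; ring
    _ ≤ (d + 1) ^ m * (M * (h ^ (multiLength γ + m)
          * ((multiFactorial γ : ℝ) ^ s * (m.factorial : ℝ) ^ s))) :=
          mul_le_mul_of_nonneg_left (h0 j) (by positivity)
    _ = _ := by rw [mul_pow, pow_add]; ring

theorem WindowBound.mono {d : ℕ} {s k r k' r' : ℝ} {φ : RSpace d → ℂ} (hk : 0 ≤ k) (hkk : k ≤ k')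
    (hr : r' ≤ r) (h : WindowBound s k r φ) : WindowBound s k' r' φ := by
  obtain ⟨C, hC, hb⟩ := h
  refine ⟨C, hC, fun γ x => (hb γ x).trans ?_⟩
  have : 0 ≤ k' := hk.trans hkk
  gcongr

theorem windowBound_of_mem_gelfandShilov {d : ℕ} {s : ℝ} {φ : RSpace d → ℂ} (hs : 0 < s)
    (h : φ ∈ gelfandShilov d s) : ∃ k > 0, ∃ r > 0, WindowBound s k r φ := by
  obtain ⟨-, k, hk, M, e⟩ := h
  exact ⟨k, hk, _, by positivity, e.windowBound hs hk⟩

theorem windowBound_of_mem_gelfandShilovBeurling {d : ℕ} {s : ℝ} {φ : RSpace d → ℂ} (hs : 0 < s)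
    (h : φ ∈ gelfandShilovBeurling d s) {k : ℝ} (hk : 0 < k) (r : ℝ) : WindowBound s k r φ := by
  -- The decay rate `s / (2 ((d+1)ρ)^{1/s})` equals `|r| + 1` for this `ρ`, and smaller parameters
  -- only increase it.
  set ρ := (s / (2 * (|r| + 1))) ^ s / (d + 1) with hρ
  have hρ0 : 0 < ρ := by positivity
  obtain ⟨M, e⟩ := h.2 (min k ρ) (lt_min hk hρ0)
  refine (e.windowBound hs (lt_min hk hρ0)).mono (lt_min hk hρ0).le (min_le_left _ _) ?_
  have h1 : ((d + 1) * min k ρ) ^ (1 / s) ≤ s / (2 * (|r| + 1)) := by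
    have : (d + 1) * min k ρ ≤ (s / (2 * (|r| + 1))) ^ s := by
      calc (d + 1) * min k ρ ≤ (d + 1) * ρ := by gcongr; exact min_le_right _ _
        _ = _ := by rw [hρ]; field_simp
    have hm : 0 < min k ρ := lt_min hk hρ0
    have := Real.rpow_le_rpow (by positivity) this (one_div_pos.2 hs).le
    rwa [rpow_rpow_one_div (by positivity) hs] at this
  have hm : 0 < min k ρ := lt_min hk hρ0
  have h2 : 0 < ((d + 1) * min k ρ) ^ (1 / s) := by positivity
  rw [le_div_iff₀ (by positivity)]
  rw [le_div_iff₀ (by positivity)] at h1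
  have h3 := le_abs_self r
  nlinarith

/-- Why a function of `S_{1/2}` is as good as one of `Σ_s` for `s > 1/2`: the surplus `(γ!)^{s-1/2}`
absorbs any geometric factor `(k₀/k)^{|γ|}`, and a Gaussian beats `e^{-r|x|^{1/s}}` for every `r`,
since `1/s < 2`. -/
theorem WindowBound.of_half {d : ℕ} {s k₀ r₀ : ℝ} {φ : RSpace d → ℂ} (hs : 1 / 2 < s)
    (hk₀ : 0 < k₀) (hr₀ : 0 < r₀) (h : WindowBound (1 / 2) k₀ r₀ φ) {k : ℝ} (hk : 0 < k) (r : ℝ) :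
    WindowBound s k r φ := by
  obtain ⟨C, hC, hb⟩ := h
  have hs0 : 0 < s := by linarith
  obtain ⟨C', hC', hb'⟩ := exp_mul_rpow_le_exp_sq (p := 1 / s) (by positivity)
    (by rw [div_lt_iff₀ hs0]; linarith) r hr₀
  -- The constant of `pow_le_factorial_rpow` for `σ = s - 1/2` and `T = k₀/k`, incurred once in each
  -- coordinate.
  set D := Real.exp ((s - 1 / 2) * (k₀ / k) ^ (1 / (s - 1 / 2)))
  refine ⟨C * (D ^ d * C'), by positivity, fun γ x => (hb γ x).trans ?_⟩
  have h1 : k₀ ^ multiLength γ * (multiFactorial γ : ℝ) ^ (1 / 2 : ℝ)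
      ≤ D ^ d * (k ^ multiLength γ * (multiFactorial γ : ℝ) ^ s) := by
    have e : ∀ (c σ : ℝ), c ^ multiLength γ * (multiFactorial γ : ℝ) ^ σ
        = ∏ i, (c ^ γ i * ((γ i).factorial : ℝ) ^ σ) := by
      intro c σ
      rw [Finset.prod_mul_distrib, Finset.prod_pow_eq_pow_sum]
      congr 1
      simp only [multiFactorial, Nat.cast_prod]
      exact (Real.finsetProd_rpow _ _ (fun i _ => by positivity) _).symm
    rw [e, e]
    have e2 : D ^ d = ∏ _i : Fin d, D := by simp
    rw [e2, ← Finset.prod_mul_distrib]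
    refine Finset.prod_le_prod (fun i _ => by positivity) fun i _ => ?_
    have h2 := pow_le_factorial_rpow (σ := s - 1 / 2) (T := k₀ / k) (by linarith) (by positivity)
      (γ i)
    rw [div_pow, div_le_iff₀ (by positivity)] at h2
    have hf : (0 : ℝ) < (γ i).factorial := by positivity
    calc k₀ ^ γ i * ((γ i).factorial : ℝ) ^ (1 / 2 : ℝ)
        ≤ (D * ((γ i).factorial : ℝ) ^ (s - 1 / 2) * k ^ γ i)
          * ((γ i).factorial : ℝ) ^ (1 / 2 : ℝ) := by gcongr
      _ = D * (k ^ γ i * (((γ i).factorial : ℝ) ^ (s - 1 / 2)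
          * ((γ i).factorial : ℝ) ^ (1 / 2 : ℝ))) := by ring
      _ = _ := by rw [← Real.rpow_add hf]; norm_num
  have h3 : Real.exp (-r₀ * ‖x‖ ^ (1 / (1 / 2 : ℝ))) ≤ C' * Real.exp (-r * ‖x‖ ^ (1 / s)) := by
    have h4 := hb' ‖x‖ (norm_nonneg x)
    have e : ‖x‖ ^ (1 / (1 / 2 : ℝ)) = ‖x‖ ^ 2 := by norm_num
    rw [e, neg_mul, neg_mul, Real.exp_neg, Real.exp_neg, ← div_eq_mul_inv,
      le_div_iff₀ (Real.exp_pos _), inv_mul_le_iff₀ (Real.exp_pos _)]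
    linarith
  calc _ ≤ C * ((D ^ d * (k ^ multiLength γ * (multiFactorial γ : ℝ) ^ s))
        * (C' * Real.exp (-r * ‖x‖ ^ (1 / s)))) := by gcongr
    _ = _ := by ring
-- `S_{1/2}` through words in `∂_j` and `x_j`.
/-- The action of a generator of the Weyl algebra: `Sum.inl j` acts as `∂_j`, and `Sum.inr j` as
multiplication by `x_j`. -/
noncomputable def letterAct {d : ℕ} : Fin d ⊕ Fin d → (RSpace d → ℂ) → RSpace d → ℂ
  | .inl j, f => partialDeriv j f
  | .inr j, f => fun x => ((x j : ℝ) : ℂ) * f x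

/-- The action of a word in the generators; the first letter acts first. -/
noncomputable def wordAct {d : ℕ} (w : List (Fin d ⊕ Fin d)) (f : RSpace d → ℂ) : RSpace d → ℂ :=
  w.foldl (fun g A => letterAct A g) f

theorem wordAct_nil {d : ℕ} (f : RSpace d → ℂ) : wordAct [] f = f := rfl

theorem wordAct_cons {d : ℕ} (A : Fin d ⊕ Fin d) (w : List (Fin d ⊕ Fin d)) (f : RSpace d → ℂ) :
    wordAct (A :: w) f = wordAct w (letterAct A f) := rfl

theorem wordAct_append {d : ℕ} (v w : List (Fin d ⊕ Fin d)) (f : RSpace d → ℂ) :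
    wordAct (v ++ w) f = wordAct w (wordAct v f) := by
  simp [wordAct, List.foldl_append]

theorem letterAct_contDiff {d : ℕ} (A : Fin d ⊕ Fin d) {f : RSpace d → ℂ} (hf : ContDiff ℝ ∞ f) :
    ContDiff ℝ ∞ (letterAct A f) := by
  cases A with
  | inl j => exact partialDeriv_contDiff j hf
  | inr j => exact (coord_contDiff j).mul hf

theorem wordAct_contDiff {d : ℕ} (w : List (Fin d ⊕ Fin d)) {f : RSpace d → ℂ}
    (hf : ContDiff ℝ ∞ f) : ContDiff ℝ ∞ (wordAct w f) := by
  induction w generalizing f with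
  | nil => exact hf
  | cons A w ih => exact ih (letterAct_contDiff A hf)

theorem letterAct_combo {d : ℕ} (A : Fin d ⊕ Fin d) (a b : ℂ) {f g : RSpace d → ℂ}
    (hf : ContDiff ℝ ∞ f) (hg : ContDiff ℝ ∞ g) :
    letterAct A (a • f + b • g) = a • letterAct A f + b • letterAct A g := by
  cases A with
  | inl j => exact partialDeriv_combo j a b hf hg
  | inr j =>
    funext x
    simp only [letterAct, Pi.add_apply, Pi.smul_apply, smul_eq_mul]
    ring

theorem wordAct_combo {d : ℕ} (w : List (Fin d ⊕ Fin d)) (a b : ℂ) {f g : RSpace d → ℂ}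
    (hf : ContDiff ℝ ∞ f) (hg : ContDiff ℝ ∞ g) :
    wordAct w (a • f + b • g) = a • wordAct w f + b • wordAct w g := by
  induction w generalizing f g with
  | nil => rfl
  | cons A w ih =>
    simp only [wordAct_cons]
    rw [letterAct_combo A a b hf hg, ih (letterAct_contDiff A hf) (letterAct_contDiff A hg)]

theorem wordAct_sum {d : ℕ} (w : List (Fin d ⊕ Fin d)) {ι : Type*} (t : Finset ι) (c : ι → ℂ)
    (G : ι → RSpace d → ℂ) (hG : ∀ k, ContDiff ℝ ∞ (G k)) :
    wordAct w (∑ k ∈ t, c k • G k) = ∑ k ∈ t, c k • wordAct w (G k) := by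
  classical
  induction t using Finset.induction_on with
  | empty =>
    have h0 : ContDiff ℝ ∞ (0 : RSpace d → ℂ) := contDiff_const
    simpa using wordAct_combo w 0 0 h0 h0
  | insert k t hk ih =>
    rw [Finset.sum_insert hk, Finset.sum_insert hk, ← ih]
    have hs : ContDiff ℝ ∞ (∑ k ∈ t, c k • G k) := by
      have : (∑ k ∈ t, c k • G k) = fun x => ∑ k ∈ t, c k • G k x := by
        funext x; simp
      rw [this]
      exact ContDiff.sum fun k _ => (hG k).const_smul (c k)
    simpa using wordAct_combo w (c k) 1 (hG k) hs

theorem letterAct_monomial_deriv {d : ℕ} (j : Fin d) (β : Fin d → ℕ) {g : RSpace d → ℂ}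
    (hg : ContDiff ℝ ∞ g) :
    letterAct (Sum.inl j) (fun x => (monomialAt β x : ℂ) * g x)
      = (1 : ℂ) • (fun x => (monomialAt β x : ℂ) * partialDeriv j g x)
        + (β j : ℂ) • (fun x => (monomialAt (β - Pi.single j 1) x : ℂ) * g x) := by
  funext x
  simp only [letterAct, Pi.add_apply, Pi.smul_apply, smul_eq_mul]
  rw [partialDeriv_mul j x ((monomialAt_contDiff β).differentiable (by simp) x)
    (hg.differentiable (by simp) x), partialDeriv_monomialAt]
  ring

theorem letterAct_monomial_mul {d : ℕ} (j : Fin d) (β : Fin d → ℕ) (g : RSpace d → ℂ) :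
    letterAct (Sum.inr j) (fun x => (monomialAt β x : ℂ) * g x)
      = fun x => (monomialAt (β + Pi.single j 1) x : ℂ) * g x := by
  funext x
  simp only [letterAct]
  rw [monomialAt_add, monomialAt_single]
  push_cast; ring

theorem multiLength_sub_single {d : ℕ} (j : Fin d) (β : Fin d → ℕ) (h : β j ≠ 0) :
    multiLength (β - Pi.single j 1) + 1 = multiLength β := by
  have e2 : β = (β - Pi.single j 1) + Pi.single j 1 := by
    funext k
    by_cases hk : k = j
    · subst hk; simp; omega
    · simp [Pi.single_eq_of_ne hk]
  conv_rhs => rw [e2, multiLength_add, multiLength_single]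

theorem le_multiLength {d : ℕ} (j : Fin d) (β : Fin d → ℕ) : β j ≤ multiLength β :=
  Finset.single_le_sum (f := β) (fun _ _ => Nat.zero_le _) (Finset.mem_univ j)

/-- The induction on the word is run for all `x^β ∂^α f` at once. A multiplication only raises `β`;
a derivative splits into two terms, whence `2 ^ n`. The commutator term carries a factor `β j` but
has total degree lower by two, and the square root of the factorial compensates exactly. The
condition `1 ≤ h` permits raising the power of `h`. -/
theorem GSEstimate.wordAct_le {d : ℕ} {h M : ℝ} {f : RSpace d → ℂ} (hf : ContDiff ℝ ∞ f)
    (hh : 1 ≤ h) (e : GSEstimate (1 / 2) h M f) (w : List (Fin d ⊕ Fin d)) :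
    ∀ (α β : Fin d → ℕ) (x : RSpace d),
      ‖wordAct w (fun x => (monomialAt β x : ℂ) * multiDeriv α f x) x‖
        ≤ M * (2 ^ w.length * h ^ (w.length + (multiLength α + multiLength β))
          * √((w.length + (multiLength α + multiLength β)).factorial)) := by
  have hM := e.nonneg
  have hh0 : 0 < h := by linarith
  induction w with
  | nil =>
    intro α β x
    refine (e α β x).trans ?_
    simp only [List.length_nil, pow_zero, one_mul, zero_add]
    rw [← Real.mul_rpow (by positivity) (by positivity), ← Real.sqrt_eq_rpow]
    gcongr
    have h1 := Nat.mul_le_mul (multiFactorial_le_factorial α) (multiFactorial_le_factorial β)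
    have h2 := Nat.le_of_dvd (Nat.factorial_pos _)
      (Nat.factorial_mul_factorial_dvd_factorial_add (multiLength α) (multiLength β))
    exact_mod_cast h1.trans h2
  | cons A w ih =>
    intro α β x
    rw [wordAct_cons]
    set n := w.length with hn
    set m := multiLength α + multiLength β with hm
    cases A with
    | inr j =>
      rw [letterAct_monomial_mul]
      have := ih α (β + Pi.single j 1) x
      rw [multiLength_add, multiLength_single] at this
      have e1 : n + (multiLength α + (multiLength β + 1)) = n + 1 + m := by omega
      rw [e1] at this
      refine this.trans ?_
      simp only [List.length_cons, ← hn]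
      gcongr <;> norm_num
    | inl j =>
      rw [letterAct_monomial_deriv j β (multiDeriv_contDiff α hf), ← multiDeriv_add_single α j hf,
        wordAct_combo w _ _ ((monomialAt_contDiff _).mul (multiDeriv_contDiff _ hf))
          ((monomialAt_contDiff _).mul (multiDeriv_contDiff _ hf))]
      simp only [Pi.add_apply, Pi.smul_apply, one_smul, List.length_cons, ← hn]
      refine (norm_add_le _ _).trans ?_
      have h1 := ih (α + Pi.single j 1) β x
      rw [multiLength_add, multiLength_single] at h1
      have e1 : n + (multiLength α + 1 + multiLength β) = n + 1 + m := by omega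
      rw [e1] at h1
      have h2 : ‖(β j : ℂ) • wordAct w (fun x => (monomialAt (β - Pi.single j 1) x : ℂ)
          * multiDeriv α f x) x‖ ≤ M * (2 ^ n * h ^ (n + 1 + m) * √((n + 1 + m).factorial)) := by
        rw [norm_smul, Complex.norm_natCast]
        by_cases h0 : β j = 0
        · rw [h0, Nat.cast_zero, zero_mul]; positivity
        have h3 := ih α (β - Pi.single j 1) x
        have e3 := multiLength_sub_single j β h0
        set q := n + (multiLength α + multiLength (β - Pi.single j 1)) with hq
        have e4 : n + 1 + m = q + 1 + 1 := by omega
        have hβ : β j ≤ q + 1 := (le_multiLength j β).trans (by omega)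
        -- From `β j ≤ q + 1` follows `(β j)^2 ≤ (q + 2)(q + 1)`, the quotient of the two
        -- factorials.
        have h4 : (β j : ℝ) * √(q.factorial) ≤ √((n + 1 + m).factorial) := by
          rw [e4, Nat.factorial_succ, Nat.factorial_succ]
          apply Real.le_sqrt_of_sq_le
          rw [mul_pow, Real.sq_sqrt (by positivity)]
          have : (β j : ℝ) ≤ q + 1 := by exact_mod_cast hβ
          have h5 : (β j : ℝ) ^ 2 ≤ (q + 1 + 1) * (q + 1) := by
            have := pow_le_pow_left₀ (Nat.cast_nonneg _) this 2
            nlinarith [Nat.cast_nonneg (α := ℝ) q]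
          push_cast
          rw [← mul_assoc]
          exact mul_le_mul_of_nonneg_right h5 (by positivity)
        have h5 : h ^ q ≤ h ^ (n + 1 + m) := pow_le_pow_right₀ hh (by omega)
        calc (β j : ℝ) * ‖wordAct w (fun x => (monomialAt (β - Pi.single j 1) x : ℂ)
              * multiDeriv α f x) x‖
            ≤ (β j : ℝ) * (M * (2 ^ n * h ^ q * √(q.factorial))) :=
              mul_le_mul_of_nonneg_left h3 (Nat.cast_nonneg _)
          _ = M * (2 ^ n * h ^ q * ((β j : ℝ) * √(q.factorial))) := by ring
          _ ≤ _ := by gcongr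
      refine (add_le_add h1 h2).trans (le_of_eq ?_)
      rw [pow_succ]; ring

/-- Bounds for the action of all words in the generators. -/
def WordEstimate {d : ℕ} (h M : ℝ) (f : RSpace d → ℂ) : Prop :=
  ∀ (w : List (Fin d ⊕ Fin d)) (x : RSpace d),
    ‖wordAct w f x‖ ≤ M * (h ^ w.length * √(w.length.factorial))

theorem exists_wordEstimate {d : ℕ} {f : RSpace d → ℂ} (hf : f ∈ gelfandShilov d (1 / 2)) :
    ∃ h, 1 ≤ h ∧ ∃ M, 0 ≤ M ∧ WordEstimate h M f := by
  obtain ⟨hs, k, hk, M, e⟩ := hf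
  have hM := e.nonneg
  have e' : GSEstimate (1 / 2) (max k 1) M f := by
    intro α β x
    refine (e α β x).trans ?_
    gcongr
    exact le_max_left _ _
  refine ⟨2 * max k 1, ?_, M, hM, fun w x => ?_⟩
  · have := le_max_right k 1; linarith
  · have := e'.wordAct_le hs (le_max_right _ _) w 0 0 x
    simp only [multiLength_zero, add_zero, monomialAt_zero, multiDeriv_zero, Complex.ofReal_one,
      one_mul] at this
    rwa [← mul_pow] at this

theorem exists_word_eq_multiDeriv {d : ℕ} {f : RSpace d → ℂ} (hf : ContDiff ℝ ∞ f)
    (α β : Fin d → ℕ) : ∃ w : List (Fin d ⊕ Fin d), w.length = multiLength α + multiLength β ∧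
      wordAct w f = fun x => (monomialAt β x : ℂ) * multiDeriv α f x := by
  induction β using multiIndex_induction with
  | h0 =>
    induction α using multiIndex_induction with
    | h0 => exact ⟨[], by simp [multiLength_zero], by
        simp [wordAct_nil, monomialAt_zero, multiDeriv_zero]⟩
    | hs α j ih =>
      obtain ⟨w, hw, e⟩ := ih
      refine ⟨w ++ [Sum.inl j], ?_, ?_⟩
      · simp [hw, multiLength_add, multiLength_single, multiLength_zero]
      · rw [wordAct_append, e]
        simp only [wordAct_cons, wordAct_nil, letterAct, monomialAt_zero, Complex.ofReal_one,
          one_mul]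
        rw [multiDeriv_add_single α j hf]
  | hs β j ih =>
    obtain ⟨w, hw, e⟩ := ih
    refine ⟨w ++ [Sum.inr j], ?_, ?_⟩
    · simp [hw, multiLength_add, multiLength_single]; ring
    · rw [wordAct_append, e, wordAct_cons, wordAct_nil, letterAct_monomial_mul]

/-- The passage back from words: `x^β ∂^α` is itself a word, and `(|α| + |β|)!` exceeds `α! β!` by
at most a geometric factor, which goes into `h`. -/
theorem mem_gelfandShilov_of_wordEstimate {d : ℕ} {h M : ℝ} {f : RSpace d → ℂ}
    (hf : ContDiff ℝ ∞ f) (hh : 0 < h) (hM : 0 ≤ M) (e : WordEstimate h M f) :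
    f ∈ gelfandShilov d (1 / 2) := by
  refine ⟨hf, √2 * √(2 ^ d) * h, by positivity, M, fun α β x => ?_⟩
  obtain ⟨w, hw, ew⟩ := exists_word_eq_multiDeriv hf α β
  have h1 := e w x
  rw [ew, hw] at h1
  refine h1.trans ?_
  rw [← Real.mul_rpow (by positivity) (by positivity), ← Real.sqrt_eq_rpow]
  set n := multiLength α + multiLength β with hn
  have h2 : n.factorial ≤ 2 ^ n * ((2 ^ d) ^ n * (multiFactorial α * multiFactorial β)) := by
    refine (factorial_add_le _ _).trans (Nat.mul_le_mul_left _ ?_)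
    refine (Nat.mul_le_mul (factorial_multiLength_le α) (factorial_multiLength_le β)).trans
      (le_of_eq ?_)
    rw [hn, pow_add]; ring
  have h3 : √(n.factorial : ℝ)
      ≤ (√2 * √(2 ^ d)) ^ n * √((multiFactorial α : ℝ) * multiFactorial β) := by
    apply Real.sqrt_le_iff.2 ⟨by positivity, ?_⟩
    rw [mul_pow, Real.sq_sqrt (by positivity), ← pow_mul, mul_comm n 2, pow_mul, mul_pow,
      Real.sq_sqrt (by positivity), Real.sq_sqrt (by positivity), mul_pow, mul_assoc]
    exact_mod_cast h2
  calc M * (h ^ n * √(n.factorial : ℝ))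
      ≤ M * (h ^ n * ((√2 * √(2 ^ d)) ^ n * √((multiFactorial α : ℝ) * multiFactorial β))) := by
        gcongr
    _ = _ := by rw [mul_pow]; ring

/-- A set of differentiable functions whose partial derivatives are linear combinations of members
of the set consists of smooth functions. -/
theorem contDiff_of_partialDeriv_mem_span {d : ℕ} {S : Set (RSpace d → ℂ)}
    (hdiff : ∀ g ∈ S, Differentiable ℝ g)
    (hact : ∀ g ∈ S, ∀ j, ∃ (K : ℕ) (c : Fin K → ℂ) (G : Fin K → RSpace d → ℂ),
      (∀ k, G k ∈ S) ∧ partialDeriv j g = ∑ k, c k • G k) {g : RSpace d → ℂ} (hg : g ∈ S) :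
    ContDiff ℝ ∞ g := by
  -- All members are treated simultaneously: the derivative of one of them is assembled from others,
  -- which are `C^m` by induction.
  have smoothN : ∀ m : ℕ, ∀ g ∈ S, ContDiff ℝ m g := by
    intro m
    induction m with
    | zero => exact fun g hg => contDiff_zero.2 (hdiff g hg).continuous
    | succ m ih =>
      intro g hg
      have : ((m + 1 : ℕ) : WithTop ℕ∞) = (m : WithTop ℕ∞) + 1 := by push_cast; rfl
      rw [this, contDiff_succ_iff_fderiv]
      refine ⟨hdiff g hg, by simp, ?_⟩
      have e : fderiv ℝ g = fun x => ∑ j, (EuclideanSpace.proj (𝕜 := ℝ) j).smulRight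
          (partialDeriv j g x) := funext (fderiv_eq_sum_partialDeriv g)
      rw [e]
      refine ContDiff.sum fun j _ => ?_
      obtain ⟨K, c, G, hG, e2⟩ := hact g hg j
      have e3 : partialDeriv j g = fun x => ∑ k, c k • G k x := by
        rw [e2]; funext x; simp
      refine ContDiff.smulRight contDiff_const ?_
      rw [e3]
      exact ContDiff.sum fun k _ => (ih _ (hG k)).const_smul (c k)
  exact contDiff_infty.2 fun m => smoothN m g hg

/-- A family of functions, graded by `ℕ`, on which the generators raise the degree by one, belongs
to `S_{1/2}` as soon as its uniform norms grow suitably. -/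
theorem mem_gelfandShilov_of_family {d K : ℕ} (F : ℕ → Set (RSpace d → ℂ)) {C M h : ℝ}
    (hC : 0 ≤ C) (hM : 0 ≤ M) (hh : 0 < h)
    (hdiff : ∀ n, ∀ g ∈ F n, Differentiable ℝ g)
    (hact : ∀ n, ∀ g ∈ F n, ∀ A, ∃ (c : Fin K → ℂ) (G : Fin K → RSpace d → ℂ),
      (∀ k, G k ∈ F (n + 1)) ∧ (∀ k, ‖c k‖ ≤ C) ∧ letterAct A g = ∑ k, c k • G k)
    (hb : ∀ n, ∀ g ∈ F n, ∀ x, ‖g x‖ ≤ M * (h ^ n * √(n.factorial))) {g : RSpace d → ℂ}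
    (hg : g ∈ F 0) : g ∈ gelfandShilov d (1 / 2) := by
  have smooth : ∀ n, ∀ g ∈ F n, ContDiff ℝ ∞ g := fun n g hg =>
    contDiff_of_partialDeriv_mem_span (S := {g | ∃ n, g ∈ F n}) (fun g ⟨n, hg⟩ => hdiff n g hg)
      (fun g ⟨n, hg⟩ j => by
        obtain ⟨c, G, hG, -, e⟩ := hact n g hg (Sum.inl j)
        exact ⟨K, c, G, fun k => ⟨_, hG k⟩, e⟩) ⟨n, hg⟩
  -- One letter produces `K` terms with coefficients at most `C` and moves them up one degree, so a
  -- word costs `(K C)` to its length.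
  have words : ∀ (w : List (Fin d ⊕ Fin d)) (n : ℕ), ∀ g ∈ F n, ∀ x, ‖wordAct w g x‖
      ≤ (K * C) ^ w.length * (M * (h ^ (w.length + n) * √((w.length + n).factorial))) := by
    intro w
    induction w with
    | nil => intro n g hg x; simpa [wordAct_nil] using hb n g hg x
    | cons A w ih =>
      intro n g hg x
      obtain ⟨c, G, hG, hc, e⟩ := hact n g hg A
      rw [wordAct_cons, e, wordAct_sum w _ _ _ fun k => smooth _ _ (hG k)]
      simp only [Finset.sum_apply, Pi.smul_apply, List.length_cons]
      refine (norm_sum_le _ _).trans ?_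
      have e1 : w.length + 1 + n = w.length + (n + 1) := by omega
      rw [e1]
      calc ∑ k, ‖c k • wordAct w (G k) x‖
          ≤ ∑ _k : Fin K, C * ((K * C) ^ w.length * (M * (h ^ (w.length + (n + 1))
            * √((w.length + (n + 1)).factorial)))) := by
            refine Finset.sum_le_sum fun k _ => ?_
            rw [norm_smul]
            exact mul_le_mul (hc k) (ih _ _ (hG k) x) (norm_nonneg _) hC
        _ = _ := by
            simp only [Finset.sum_const, Finset.card_univ, Fintype.card_fin, nsmul_eq_mul]
            ring
  -- The added `1` keeps the parameter positive even if `K * C = 0`.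
  refine mem_gelfandShilov_of_wordEstimate (h := (K * C + 1) * h) (M := M) (smooth 0 g hg)
    (by positivity) hM fun w x => (words w 0 g hg x).trans ?_
  rw [add_zero, mul_pow (K * C + 1 : ℝ)]
  have : (K * C) ^ w.length ≤ (K * C + 1) ^ w.length :=
    pow_le_pow_left₀ (by positivity) (by linarith) _
  calc (K * C) ^ w.length * (M * (h ^ w.length * √(w.length.factorial)))
      ≤ (K * C + 1) ^ w.length * (M * (h ^ w.length * √(w.length.factorial))) := by gcongr
    _ = _ := by ring

/-- Smooth functions on which all words in the generators are bounded (Schwartz functions). -/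
def WordBounded {d : ℕ} (f : RSpace d → ℂ) : Prop :=
  ContDiff ℝ ∞ f ∧ ∀ w : List (Fin d ⊕ Fin d), ∃ B, ∀ x, ‖wordAct w f x‖ ≤ B

theorem WordBounded.letterAct {d : ℕ} {f : RSpace d → ℂ} (hf : WordBounded f)
    (A : Fin d ⊕ Fin d) : WordBounded (letterAct A f) :=
  ⟨letterAct_contDiff A hf.1, fun w => hf.2 (A :: w)⟩

theorem WordBounded.wordAct {d : ℕ} {f : RSpace d → ℂ} (hf : WordBounded f)
    (w : List (Fin d ⊕ Fin d)) : WordBounded (wordAct w f) :=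
  ⟨wordAct_contDiff w hf.1, fun v => by simpa [wordAct_append] using hf.2 (w ++ v)⟩

theorem wordBounded_of_mem_gelfandShilov {d : ℕ} {f : RSpace d → ℂ}
    (hf : f ∈ gelfandShilov d (1 / 2)) : WordBounded f := by
  obtain ⟨h, -, M, -, e⟩ := exists_wordEstimate hf
  exact ⟨hf.1, fun w => ⟨_, e w⟩⟩

theorem wordAct_replicate_inr {d : ℕ} (j : Fin d) (N : ℕ) (f : RSpace d → ℂ) (x : RSpace d) :
    wordAct (List.replicate N (Sum.inr j)) f x = ((x j : ℝ) : ℂ) ^ N * f x := by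
  induction N generalizing f with
  | zero => simp [wordAct_nil]
  | succ N ih =>
    rw [List.replicate_succ, wordAct_cons, ih]
    simp only [letterAct]; ring

theorem one_add_norm_pow_mul_le {d : ℕ} (N : ℕ) (f : RSpace d → ℂ) (x : RSpace d) {B : ℝ}
    (h0 : ‖f x‖ ≤ B) (h1 : ∀ j, ‖wordAct (List.replicate N (Sum.inr j)) f x‖ ≤ B) :
    (1 + ‖x‖) ^ N * ‖f x‖ ≤ (2 * (d + 1)) ^ N * B := by
  have hB : 0 ≤ B := (norm_nonneg _).trans h0
  rcases le_total ‖x‖ 1 with hx | hx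
  · have : (1 + ‖x‖) ^ N ≤ (2 * (d + 1)) ^ N := by
      apply pow_le_pow_left₀ (by positivity)
      nlinarith [Nat.cast_nonneg (α := ℝ) d]
    exact mul_le_mul this h0 (norm_nonneg _) (by positivity)
  · have hx0 : x ≠ 0 := by rintro rfl; simp at hx; linarith
    obtain ⟨j, hj⟩ := exists_coord_norm_le x hx0
    have h2 := h1 j
    rw [wordAct_replicate_inr, norm_mul, norm_pow, Complex.norm_real, Real.norm_eq_abs] at h2
    have h3 : 1 + ‖x‖ ≤ 2 * (d + 1) * |x j| := by
      nlinarith [abs_nonneg (x j)]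
    calc (1 + ‖x‖) ^ N * ‖f x‖ ≤ (2 * (d + 1) * |x j|) ^ N * ‖f x‖ := by gcongr
      _ = (2 * (d + 1)) ^ N * (|x j| ^ N * ‖f x‖) := by rw [mul_pow]; ring
      _ ≤ _ := by gcongr

theorem WordBounded.decay {d : ℕ} {f : RSpace d → ℂ} (hf : WordBounded f) (N : ℕ) :
    ∃ B, 0 ≤ B ∧ ∀ x, (1 + ‖x‖) ^ N * ‖f x‖ ≤ B := by
  choose B hB using hf.2
  have hB0 : ∀ w, 0 ≤ B w := fun w => (norm_nonneg _).trans (hB w 0)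
  have hs : 0 ≤ ∑ j : Fin d, B (List.replicate N (Sum.inr j)) :=
    Finset.sum_nonneg fun j _ => hB0 _
  have h0 := hB0 []
  refine ⟨(2 * (d + 1)) ^ N * (B [] + ∑ j : Fin d, B (List.replicate N (Sum.inr j))),
    by positivity, fun x => one_add_norm_pow_mul_le N f x ?_ fun j => ?_⟩
  · exact (hB [] x).trans (by linarith)
  · refine (hB _ x).trans ?_
    have := Finset.single_le_sum (f := fun j : Fin d => B (List.replicate N (Sum.inr j)))
      (fun j _ => hB0 _) (Finset.mem_univ j)
    linarith

/-- Polynomial decay comes from appending `N` multiplications to the word; `√((n+N)!)` is separated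
into its two factorials at a geometric cost. -/
theorem WordEstimate.decay {d : ℕ} {f : RSpace d → ℂ} {h M : ℝ} (hh : 1 ≤ h) (hM : 0 ≤ M)
    (e : WordEstimate h M f) (N : ℕ) :
    ∃ h', 1 ≤ h' ∧ ∃ M', 0 ≤ M' ∧ ∀ (w : List (Fin d ⊕ Fin d)) (x : RSpace d),
      (1 + ‖x‖) ^ N * ‖wordAct w f x‖ ≤ M' * (h' ^ w.length * √(w.length.factorial)) := by
  refine ⟨2 * h, by linarith, (2 * (d + 1)) ^ N * (M * ((2 * h) ^ N * √(N.factorial))),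
    by positivity, fun w x => ?_⟩
  set n := w.length with hn
  have h1 : √((n + N).factorial : ℝ) ≤ 2 ^ (n + N) * (√(n.factorial) * √(N.factorial)) := by
    rw [← Real.sqrt_mul (by positivity)]
    apply Real.sqrt_le_iff.2 ⟨by positivity, ?_⟩
    rw [mul_pow, Real.sq_sqrt (by positivity)]
    have h2 : ((n + N).factorial : ℝ) ≤ 2 ^ (n + N) * (n.factorial * N.factorial) := by
      exact_mod_cast factorial_add_le n N
    refine h2.trans ?_
    gcongr
    exact le_self_pow₀ (one_le_pow₀ (by norm_num)) (by norm_num)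
  have h0 : M * (h ^ (n + N) * √((n + N).factorial : ℝ))
      ≤ M * ((2 * h) ^ N * √(N.factorial)) * ((2 * h) ^ n * √(n.factorial)) := by
    calc _ ≤ M * (h ^ (n + N) * (2 ^ (n + N) * (√(n.factorial) * √(N.factorial)))) := by gcongr
      _ = _ := by rw [mul_pow, mul_pow, pow_add, pow_add]; ring
  have h3 := one_add_norm_pow_mul_le N (wordAct w f) x
    (B := M * ((2 * h) ^ N * √(N.factorial)) * ((2 * h) ^ n * √(n.factorial))) ?_ fun j => ?_
  · refine h3.trans (le_of_eq ?_); ring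
  · refine (e w x).trans ?_
    have h4 : (1 : ℝ) ≤ (2 * h) ^ N := one_le_pow₀ (by linarith)
    have h5 : (1 : ℝ) ≤ √(N.factorial) := by
      rw [Real.one_le_sqrt]; exact_mod_cast Nat.factorial_pos N
    calc M * (h ^ n * √(n.factorial))
        ≤ M * ((2 * h) ^ n * √(n.factorial)) := by gcongr; linarith
      _ = M * (1 * 1) * ((2 * h) ^ n * √(n.factorial)) := by ring
      _ ≤ _ := by gcongr
  · rw [← wordAct_append]
    refine (e _ x).trans (le_trans (le_of_eq ?_) h0)
    simp [hn]

/-! ### Gaussians belong to `S_{1/2}`. -/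

/-- The Gaussian `e^{-c|x-a|²}`. -/
noncomputable def gaussianAt {d : ℕ} (c : ℝ) (a x : RSpace d) : ℂ :=
  ((Real.exp (-c * ‖x - a‖ ^ 2) : ℝ) : ℂ)

theorem gaussianAt_contDiff {d : ℕ} (c : ℝ) (a : RSpace d) : ContDiff ℝ ∞ (gaussianAt c a) := by
  unfold gaussianAt
  refine Complex.ofRealCLM.contDiff.comp (Real.contDiff_exp.comp ?_)
  exact contDiff_const.mul ((contDiff_id.sub contDiff_const).norm_sq ℝ)

theorem partialDeriv_gaussianAt {d : ℕ} (c : ℝ) (a : RSpace d) (j : Fin d) (x : RSpace d) :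
    partialDeriv j (gaussianAt c a) x = -2 * c * (x j - a j) * gaussianAt c a x := by
  have h1 : HasFDerivAt (fun x : RSpace d => ‖x - a‖ ^ 2) (2 • innerSL ℝ (x - a)) x := by
    simpa using ((hasFDerivAt_id x).sub_const a).norm_sq
  have h2 := ((h1.const_mul (-c)).exp)
  have h3 : HasFDerivAt (gaussianAt c a) _ x := Complex.ofRealCLM.hasFDerivAt.comp x h2
  rw [partialDeriv, h3.fderiv]
  simp [gaussianAt, EuclideanSpace.inner_single_right]
  ring

theorem abs_monomialAt_le {d : ℕ} (β : Fin d → ℕ) (x : RSpace d) :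
    |monomialAt β x| ≤ ‖x‖ ^ multiLength β := by
  unfold monomialAt multiLength
  rw [Finset.abs_prod, ← Finset.prod_pow_eq_pow_sum]
  refine Finset.prod_le_prod (fun i _ => abs_nonneg _) fun i _ => ?_
  rw [abs_pow]
  exact pow_le_pow_left₀ (abs_nonneg _) (PiLp.norm_apply_le x i) _

theorem norm_gaussianAt_le {d : ℕ} {c : ℝ} (hc : 0 < c) (a x : RSpace d) :
    ‖gaussianAt c a x‖ ≤ Real.exp (c * ‖a‖ ^ 2) * Real.exp (-(c / 2) * ‖x‖ ^ 2) := by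
  rw [gaussianAt, Complex.norm_real, Real.norm_of_nonneg (Real.exp_pos _).le, ← Real.exp_add,
    Real.exp_le_exp]
  have h1 : ‖x‖ ≤ ‖x - a‖ + ‖a‖ := by simpa using norm_add_le (x - a) a
  have h2 : ‖x‖ ^ 2 ≤ 2 * ‖x - a‖ ^ 2 + 2 * ‖a‖ ^ 2 := by
    have := pow_le_pow_left₀ (norm_nonneg x) h1 2
    nlinarith [sq_nonneg (‖x - a‖ - ‖a‖)]
  nlinarith

theorem gaussianAt_mem_gelfandShilov {d : ℕ} {c : ℝ} (hc : 0 < c) (a : RSpace d) :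
    gaussianAt c a ∈ gelfandShilov d (1 / 2) := by
  -- Differentiating a monomial yields a factor `β j ≤ |β|`. The weight `‖b‖ √(|β|!) ≤ √(m!)`
  -- absorbs it: one root of `|β|` rebuilds the factorial of the old degree, the other is at most
  -- `√(m+1)`.
  set F : ℕ → Set (RSpace d → ℂ) := fun m => {g | ∃ (β : Fin d → ℕ) (b : ℂ),
    multiLength β ≤ m ∧ ‖b‖ * √((multiLength β).factorial) ≤ √(m.factorial) ∧
      g = fun x => (monomialAt β x : ℂ) * (b * gaussianAt c a x)} with hF
  have hsq : ∀ m : ℕ, √((m + 1).factorial : ℝ) = √(m + 1) * √(m.factorial) := by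
    intro m
    rw [Nat.factorial_succ, Nat.cast_mul, Real.sqrt_mul (by positivity)]
    push_cast; rfl
  have hsmooth : ∀ b : ℂ, ContDiff ℝ ∞ (fun x => b * gaussianAt c a x) := fun b =>
    contDiff_const.mul (gaussianAt_contDiff c a)
  have hmono : ∀ m β (b : ℂ), multiLength β ≤ m →
      ‖b‖ * √((multiLength β).factorial) ≤ √(m.factorial) →
      (fun x => (monomialAt β x : ℂ) * (b * gaussianAt c a x)) ∈ F (m + 1) := by
    intro m β b h1 h2
    refine ⟨β, b, by omega, h2.trans ?_, rfl⟩
    exact Real.sqrt_le_sqrt (by exact_mod_cast Nat.factorial_le (Nat.le_succ m))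
  have hup : ∀ m β (b : ℂ) (j : Fin d), multiLength β ≤ m →
      ‖b‖ * √((multiLength β).factorial) ≤ √(m.factorial) →
      (fun x => (monomialAt (β + Pi.single j 1) x : ℂ) * (b * gaussianAt c a x)) ∈ F (m + 1) := by
    intro m β b j h1 h2
    refine ⟨_, b, ?_, ?_, rfl⟩
    · rw [multiLength_add, multiLength_single]; omega
    · rw [multiLength_add, multiLength_single, hsq, hsq]
      have h3 : √((multiLength β : ℝ) + 1) ≤ √((m : ℝ) + 1) :=
        Real.sqrt_le_sqrt (by have : (multiLength β : ℝ) ≤ m := by exact_mod_cast h1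
                              linarith)
      calc ‖b‖ * (√((multiLength β : ℝ) + 1) * √((multiLength β).factorial))
          = √((multiLength β : ℝ) + 1) * (‖b‖ * √((multiLength β).factorial)) := by ring
        _ ≤ _ := by gcongr
  have hdown : ∀ m β (b : ℂ) (j : Fin d), multiLength β ≤ m →
      ‖b‖ * √((multiLength β).factorial) ≤ √(m.factorial) →
      (fun x => (monomialAt (β - Pi.single j 1) x : ℂ) * ((β j * b) * gaussianAt c a x))
        ∈ F (m + 1) := by
    intro m β b j h1 h2
    by_cases h0 : β j = 0
    · have : (β - Pi.single j 1 : Fin d → ℕ) = β := by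
        funext k
        by_cases hk : k = j
        · subst hk; simp [h0]
        · simp [Pi.single_eq_of_ne hk]
      rw [this]
      refine hmono m β _ h1 ?_
      simp [h0]
    · have e := multiLength_sub_single j β h0
      refine ⟨_, _, by omega, ?_, rfl⟩
      set q := multiLength (β - Pi.single j 1) with hq
      rw [← e, hsq] at h2
      have hβ : (β j : ℝ) ≤ √((q : ℝ) + 1) * √((q : ℝ) + 1) := by
        rw [Real.mul_self_sqrt (by positivity)]
        have := le_multiLength j β
        rw [← e] at this
        exact_mod_cast this
      rw [norm_mul, Complex.norm_natCast, hsq]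
      have h3 : √((q : ℝ) + 1) ≤ √((m : ℝ) + 1) :=
        Real.sqrt_le_sqrt (by have : (q : ℝ) ≤ m := by exact_mod_cast (by omega : q ≤ m)
                              linarith)
      calc β j * ‖b‖ * √(q.factorial)
          ≤ √((q : ℝ) + 1) * √((q : ℝ) + 1) * ‖b‖ * √(q.factorial) := by gcongr
        _ = √((q : ℝ) + 1) * (‖b‖ * (√((q : ℝ) + 1) * √(q.factorial))) := by ring
        _ ≤ _ := by gcongr
  set H := ((1 / 2) / (c / 2)) ^ (1 / 2 : ℝ) with hH
  have hH0 : 0 ≤ H := by positivity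
  refine mem_gelfandShilov_of_family (K := 3) F (C := 1 + 2 * c + 2 * c * ‖a‖)
    (M := Real.exp (c * ‖a‖ ^ 2)) (h := max 1 H) (by positivity) (by positivity) (by positivity)
    ?_ ?_ ?_ (g := gaussianAt c a) ?_
  · rintro m g ⟨β, b, -, -, rfl⟩
    exact ((monomialAt_contDiff β).mul (hsmooth b)).differentiable (by simp)
  · rintro m g ⟨β, b, h1, h2, rfl⟩ A
    have hca : 0 ≤ c * ‖a‖ := by positivity
    cases A with
    | inr j =>
      -- The family criterion asks for exactly `K` terms, so the missing ones get coefficient zero.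
      refine ⟨![1, 0, 0], fun _ => fun x => (monomialAt (β + Pi.single j 1) x : ℂ)
        * (b * gaussianAt c a x), fun k => hup m β b j h1 h2, fun k => ?_, ?_⟩
      · fin_cases k <;> simp <;> nlinarith
      · rw [letterAct_monomial_mul]
        simp [Fin.sum_univ_three]
    | inl j =>
      refine ⟨![1, ((-2 * c : ℝ) : ℂ), ((2 * c * a j : ℝ) : ℂ)],
        ![fun x => (monomialAt (β - Pi.single j 1) x : ℂ) * ((β j * b) * gaussianAt c a x),
          fun x => (monomialAt (β + Pi.single j 1) x : ℂ) * (b * gaussianAt c a x),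
          fun x => (monomialAt β x : ℂ) * (b * gaussianAt c a x)], fun k => ?_, fun k => ?_, ?_⟩
      · fin_cases k
        · exact hdown m β b j h1 h2
        · exact hup m β b j h1 h2
        · exact hmono m β b h1 h2
      · fin_cases k
        · simp; nlinarith
        · show ‖((-2 * c : ℝ) : ℂ)‖ ≤ _
          rw [Complex.norm_real, Real.norm_eq_abs, abs_mul, abs_of_pos hc]; norm_num; linarith
        · show ‖((2 * c * a j : ℝ) : ℂ)‖ ≤ _
          rw [Complex.norm_real, Real.norm_eq_abs, abs_mul, abs_of_pos (by positivity)]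
          have := PiLp.norm_apply_le a j
          rw [Real.norm_eq_abs] at this
          nlinarith
      · rw [letterAct_monomial_deriv j β (hsmooth b)]
        funext x
        have e : partialDeriv j (fun x => b * gaussianAt c a x) x
            = b * (-2 * c * (x j - a j) * gaussianAt c a x) := by
          rw [partialDeriv_mul j x (differentiableAt_const b)
            ((gaussianAt_contDiff c a).differentiable (by simp) x), partialDeriv_gaussianAt]
          simp [partialDeriv]
        simp only [Pi.add_apply, Pi.smul_apply, smul_eq_mul, Fin.sum_univ_three, Matrix.cons_val]
        rw [e, monomialAt_add, monomialAt_single]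
        push_cast; ring
  · rintro m g ⟨β, b, h1, h2, rfl⟩ x
    have h3 := pow_mul_exp_neg_rpow_le (s := 1 / 2) (r := c / 2) (by norm_num) (by positivity)
      (norm_nonneg x) (multiLength β)
    have e : ‖x‖ ^ (1 / (1 / 2 : ℝ)) = ‖x‖ ^ 2 := by norm_num
    rw [e, ← hH, ← Real.sqrt_eq_rpow] at h3
    have h4 : H ^ multiLength β ≤ max 1 H ^ m :=
      (pow_le_pow_left₀ hH0 (le_max_right 1 H) _).trans
        (pow_le_pow_right₀ (le_max_left 1 H) h1)
    rw [norm_mul, norm_mul, Complex.norm_real, Real.norm_eq_abs]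
    calc |monomialAt β x| * (‖b‖ * ‖gaussianAt c a x‖)
        ≤ ‖x‖ ^ multiLength β * (‖b‖ * (Real.exp (c * ‖a‖ ^ 2)
          * Real.exp (-(c / 2) * ‖x‖ ^ 2))) := by
          gcongr
          · exact abs_monomialAt_le β x
          · exact norm_gaussianAt_le hc a x
      _ = Real.exp (c * ‖a‖ ^ 2) * (‖b‖ * (‖x‖ ^ multiLength β
          * Real.exp (-(c / 2) * ‖x‖ ^ 2))) := by ring
      _ ≤ Real.exp (c * ‖a‖ ^ 2) * (‖b‖ * (H ^ multiLength β
          * √((multiLength β).factorial))) := by gcongr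
      _ = Real.exp (c * ‖a‖ ^ 2) * (H ^ multiLength β
          * (‖b‖ * √((multiLength β).factorial))) := by ring
      _ ≤ _ := by gcongr
  · exact ⟨0, 1, by simp [multiLength_zero], by simp [multiLength_zero], by
      funext x; simp [monomialAt_zero]⟩
-- Differentiation of integrals, characters, and coordinates on `ℝ^{2d}`.
/-- Differentiation under the integral sign, for partial derivatives. -/
theorem partialDeriv_integral {d : ℕ} {X : Type*} [MeasurableSpace X] {μ : Measure X}
    {K : RSpace d → X → ℂ} {K' : Fin d → RSpace d → X → ℂ}
    (hd : ∀ a, Differentiable ℝ (fun y => K y a))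
    (hp : ∀ j y a, partialDeriv j (fun y => K y a) y = K' j y a)
    (hm' : ∀ j y, AEStronglyMeasurable (K' j y) μ) (hi : ∀ y, Integrable (K y) μ)
    (hb : ∀ y₀, ∃ b : X → ℝ, Integrable b μ ∧ ∀ y ∈ Metric.ball y₀ 1, ∀ j a, ‖K' j y a‖ ≤ b a) :
    Differentiable ℝ (fun y => ∫ a, K y a ∂μ) ∧
      ∀ j y, partialDeriv j (fun y => ∫ a, K y a ∂μ) y = ∫ a, K' j y a ∂μ := by
  -- The full derivative assembled from its coordinates; its norm is at most `d` times the bound on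
  -- the partial derivatives.
  set L : RSpace d → X → (RSpace d →L[ℝ] ℂ) := fun y a =>
    ∑ j, (EuclideanSpace.proj (𝕜 := ℝ) j).smulRight (K' j y a) with hL
  have hLm : ∀ y, AEStronglyMeasurable (L y) μ := fun y => by
    refine Finset.aestronglyMeasurable_fun_sum _ fun j _ => ?_
    exact ((ContinuousLinearMap.smulRightL ℝ (RSpace d) ℂ
      (EuclideanSpace.proj (𝕜 := ℝ) j)).continuous).comp_aestronglyMeasurable (hm' j y)
  have key : ∀ y₀, HasFDerivAt (fun y => ∫ a, K y a ∂μ) (∫ a, L y₀ a ∂μ) y₀ ∧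
      Integrable (L y₀) μ := by
    intro y₀
    obtain ⟨b, hbi, hbb⟩ := hb y₀
    have hLb : ∀ a, ∀ y ∈ Metric.ball y₀ 1, ‖L y a‖ ≤ d * b a := by
      intro a y hy
      refine (norm_sum_le _ _).trans ?_
      have : ∀ j : Fin d, ‖(EuclideanSpace.proj (𝕜 := ℝ) j :
          RSpace d →L[ℝ] ℝ).smulRight (K' j y a)‖ ≤ b a := by
        intro j
        have h0 := hbb y hy j a
        refine ContinuousLinearMap.opNorm_le_bound _ ((norm_nonneg _).trans h0) fun v => ?_
        rw [ContinuousLinearMap.smulRight_apply, norm_smul, mul_comm]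
        exact mul_le_mul h0 (PiLp.norm_apply_le v j) (norm_nonneg _) ((norm_nonneg _).trans h0)
      refine (Finset.sum_le_sum fun j _ => this j).trans (le_of_eq ?_)
      simp
    refine ⟨hasFDerivAt_integral_of_dominated_of_fderiv_le (Metric.ball_mem_nhds y₀ one_pos)
      (Filter.Eventually.of_forall fun y => (hi y).aestronglyMeasurable) (hi y₀) (hLm y₀)
      (Filter.Eventually.of_forall hLb) (hbi.const_mul _)
      (Filter.Eventually.of_forall fun a y _ => ?_), ?_⟩
    · have h1 := (hd a y).hasFDerivAt
      rw [fderiv_eq_sum_partialDeriv] at h1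
      simpa only [hp] using h1
    · exact (hbi.const_mul (d : ℝ)).mono' (hLm y₀)
        (Filter.Eventually.of_forall fun a => hLb a y₀ (Metric.mem_ball_self one_pos))
  refine ⟨fun y => (key y).1.differentiableAt, fun j y => ?_⟩
  rw [partialDeriv, (key y).1.fderiv, ContinuousLinearMap.integral_apply (key y).2]
  congr 1
  funext a
  simp [hL]

theorem norm_charNeg {d : ℕ} (y ξ : RSpace d) : ‖charNeg y ξ‖ = 1 := by
  rw [charNeg, Complex.norm_exp]; simp

theorem charNeg_comm {d : ℕ} (y ξ : RSpace d) : charNeg y ξ = charNeg ξ y := by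
  rw [charNeg, charNeg, real_inner_comm]

theorem charNeg_contDiff {d : ℕ} :
    ContDiff ℝ ∞ (fun p : RSpace d × RSpace d => charNeg p.1 p.2) := by
  unfold charNeg
  refine Complex.contDiff_exp.comp ?_
  refine (contDiff_const.mul (Complex.ofRealCLM.contDiff.comp ?_)).neg
  exact contDiff_fst.inner ℝ contDiff_snd

theorem continuous_charNeg {X : Type*} [TopologicalSpace X] {d : ℕ} {f g : X → RSpace d}
    (hf : Continuous f) (hg : Continuous g) : Continuous (fun a => charNeg (f a) (g a)) :=
  (charNeg_contDiff (d := d)).continuous.comp (hf.prodMk hg)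

theorem hasFDerivAt_charNeg {d : ℕ} (y ξ : RSpace d) :
    HasFDerivAt (fun y => charNeg y ξ)
      ((-Complex.I * charNeg y ξ) • Complex.ofRealCLM.comp (innerSL ℝ ξ)) y := by
  have h1 : HasFDerivAt (fun y : RSpace d => ((inner ℝ y ξ : ℝ) : ℂ))
      (Complex.ofRealCLM.comp (innerSL ℝ ξ)) y := by
    have e : (fun y : RSpace d => ((inner ℝ y ξ : ℝ) : ℂ))
        = fun y => (Complex.ofRealCLM.comp (innerSL ℝ ξ)) y := by
      funext y; simp [real_inner_comm]
    rw [e]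
    exact ContinuousLinearMap.hasFDerivAt _
  have h2 := (h1.const_mul Complex.I).neg.cexp
  refine h2.congr_fderiv ?_
  ext v
  simp [charNeg]
  ring

theorem charNeg_differentiable {d : ℕ} (ξ : RSpace d) :
    Differentiable ℝ (fun y => charNeg y ξ) :=
  fun y => (hasFDerivAt_charNeg y ξ).differentiableAt

theorem partialDeriv_charNeg {d : ℕ} (j : Fin d) (y ξ : RSpace d) :
    partialDeriv j (fun y => charNeg y ξ) y = -Complex.I * ξ j * charNeg y ξ := by
  rw [partialDeriv, (hasFDerivAt_charNeg y ξ).fderiv]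
  simp [EuclideanSpace.inner_single_right]
  ring

theorem joinPoint_castAdd {d : ℕ} (x ξ : RSpace d) (j : Fin d) :
    joinPoint x ξ (Fin.castAdd d j) = x j := by
  simp [joinPoint]

theorem joinPoint_natAdd {d : ℕ} (x ξ : RSpace d) (j : Fin d) :
    joinPoint x ξ (Fin.natAdd d j) = ξ j := by
  simp [joinPoint, -Fin.natAdd_eq_addNat]

/-- `joinPoint` as a continuous linear map. -/
noncomputable def joinL (d : ℕ) : RSpace d × RSpace d →L[ℝ] RSpace (d + d) :=
  LinearMap.toContinuousLinearMap
    { toFun := fun p => joinPoint p.1 p.2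
      map_add' := fun p q => by
        ext i; refine Fin.addCases (fun j => ?_) (fun j => ?_) i <;>
          simp [joinPoint, -Fin.natAdd_eq_addNat]
      map_smul' := fun c p => by
        ext i; refine Fin.addCases (fun j => ?_) (fun j => ?_) i <;>
          simp [joinPoint, -Fin.natAdd_eq_addNat] }

theorem joinL_apply {d : ℕ} (p : RSpace d × RSpace d) : joinL d p = joinPoint p.1 p.2 := rfl

theorem joinPoint_single_zero {d : ℕ} (j : Fin d) :
    joinPoint (EuclideanSpace.single j (1 : ℝ)) 0
      = EuclideanSpace.single (Fin.castAdd d j) (1 : ℝ) := by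
  ext i
  refine Fin.addCases (fun k => ?_) (fun k => ?_) i
  · rw [joinPoint_castAdd]; simp
  · rw [joinPoint_natAdd]
    have : Fin.natAdd d k ≠ Fin.castAdd d j := by
      intro h; have := congrArg Fin.val h; simp at this; omega
    simp [this, -Fin.natAdd_eq_addNat]

theorem joinPoint_zero_single {d : ℕ} (j : Fin d) :
    joinPoint 0 (EuclideanSpace.single j (1 : ℝ))
      = EuclideanSpace.single (Fin.natAdd d j) (1 : ℝ) := by
  ext i
  refine Fin.addCases (fun k => ?_) (fun k => ?_) i
  · rw [joinPoint_castAdd]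
    have : Fin.castAdd d k ≠ Fin.natAdd d j := by
      intro h; have := congrArg Fin.val h; simp at this; omega
    simp [this, -Fin.natAdd_eq_addNat]
  · rw [joinPoint_natAdd]; simp [-Fin.natAdd_eq_addNat]

theorem norm_joinPoint_sq {d : ℕ} (x ξ : RSpace d) :
    ‖joinPoint x ξ‖ ^ 2 = ‖x‖ ^ 2 + ‖ξ‖ ^ 2 := by
  rw [EuclideanSpace.norm_sq_eq, EuclideanSpace.norm_sq_eq, EuclideanSpace.norm_sq_eq,
    Fin.sum_univ_add]
  simp only [joinPoint_castAdd, joinPoint_natAdd]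

theorem norm_snd_le_joinPoint {d : ℕ} (x ξ : RSpace d) : ‖ξ‖ ≤ ‖joinPoint x ξ‖ := by
  have := norm_joinPoint_sq x ξ
  nlinarith [norm_nonneg ξ, norm_nonneg (joinPoint x ξ), sq_nonneg ‖x‖]

theorem hasFDerivAt_comp_joinPoint {d : ℕ} {Φ : RSpace (d + d) → ℂ} (hΦ : Differentiable ℝ Φ)
    (z ξ y : RSpace d) : HasFDerivAt (fun y => Φ (joinPoint (y - z) ξ))
      ((fderiv ℝ Φ (joinPoint (y - z) ξ)).comp
        ((joinL d).comp (ContinuousLinearMap.inl ℝ (RSpace d) (RSpace d)))) y := by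
  have h1 : HasFDerivAt (fun y : RSpace d => (y - z, ξ))
      (ContinuousLinearMap.inl ℝ (RSpace d) (RSpace d)) y :=
    ((hasFDerivAt_id y).sub_const z).prodMk (hasFDerivAt_const ξ y)
  exact (hΦ _).hasFDerivAt.comp y ((joinL d).hasFDerivAt.comp y h1)

theorem partialDeriv_comp_joinPoint {d : ℕ} {Φ : RSpace (d + d) → ℂ} (hΦ : Differentiable ℝ Φ)
    (j : Fin d) (z ξ y : RSpace d) :
    partialDeriv j (fun y => Φ (joinPoint (y - z) ξ)) y
      = partialDeriv (Fin.castAdd d j) Φ (joinPoint (y - z) ξ) := by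
  rw [partialDeriv, (hasFDerivAt_comp_joinPoint hΦ z ξ y).fderiv, partialDeriv]
  simp [joinL_apply, joinPoint_single_zero]

theorem hasLineDerivAt_comp_joinPoint {d : ℕ} {Φ : RSpace (d + d) → ℂ} (hΦ : Differentiable ℝ Φ)
    (φ : RSpace d → ℂ) (j : Fin d) (y : RSpace d) (p : RSpace d × RSpace d) :
    HasLineDerivAt ℝ (fun p : RSpace d × RSpace d => φ p.1 * Φ (joinPoint (y - p.1) p.2))
      (φ p.1 * partialDeriv (Fin.natAdd d j) Φ (joinPoint (y - p.1) p.2)) p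
      (0, EuclideanSpace.single j 1) := by
  unfold HasLineDerivAt
  simp only [Prod.fst_add, Prod.smul_fst, smul_zero, add_zero, Prod.snd_add, Prod.smul_snd]
  refine HasDerivAt.const_mul _ ?_
  have h1 : HasDerivAt (fun t : ℝ => joinPoint (y - p.1) (p.2 + t • EuclideanSpace.single j 1))
      (EuclideanSpace.single (Fin.natAdd d j) (1 : ℝ)) 0 := by
    have e : (fun t : ℝ => joinPoint (y - p.1) (p.2 + t • EuclideanSpace.single j 1))
        = fun t => joinPoint (y - p.1) p.2 + t • EuclideanSpace.single (Fin.natAdd d j) (1 : ℝ) := by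
      funext t
      have := (joinL d).map_add (y - p.1, p.2) (t • (0, EuclideanSpace.single j (1 : ℝ)))
      rw [(joinL d).map_smul] at this
      simpa [joinL_apply, joinPoint_zero_single] using this
    rw [e]
    simpa using ((hasDerivAt_id (0 : ℝ)).smul_const
      (EuclideanSpace.single (Fin.natAdd d j) (1 : ℝ))).const_add (joinPoint (y - p.1) p.2)
  have h2 : joinPoint (y - p.1) (p.2 + (0 : ℝ) • EuclideanSpace.single j 1)
      = joinPoint (y - p.1) p.2 := by simp
  have h3 := (hΦ (joinPoint (y - p.1) p.2)).hasFDerivAt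
  rw [← h2] at h3
  have h4 := h3.comp_hasDerivAt (0 : ℝ) h1
  rw [h2] at h4
  exact h4

/-! ### The transpose maps `S_{1/2}(ℝ^{2d})` to `S_{1/2}(ℝ^d)`. -/

/-- The transpose of the short-time Fourier transform, after the change of variables
`x ↦ y - x` and without the constant. -/
noncomputable def stftAdj {d : ℕ} (φ : RSpace d → ℂ) (Φ : RSpace (d + d) → ℂ) (y : RSpace d) : ℂ :=
  ∫ p : RSpace d × RSpace d, (φ p.1 * charNeg y p.2) * Φ (joinPoint (y - p.1) p.2)

/-- After the substitution `y` occurs only in `Ψ` and in the character, so the window is never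
differentiated. -/
theorem stftTranspose_eq {d : ℕ} (φ : RSpace d → ℂ) (Ψ : RSpace (d + d) → ℂ) :
    stftTranspose φ Ψ
      = (fourierConst d : ℂ) • stftAdj (fun z => (starRingEnd ℂ) (φ z)) Ψ := by
  funext y
  simp only [stftTranspose, stftAdj, Pi.smul_apply, smul_eq_mul]
  congr 1
  have hmp : MeasurePreserving (fun p : RSpace d × RSpace d => (y - p.1, p.2)) volume volume :=
    (Measure.measurePreserving_sub_left volume y).prod (MeasurePreserving.id volume)
  have he : MeasurableEmbedding (fun p : RSpace d × RSpace d => (y - p.1, p.2)) :=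
    ((MeasurableEquiv.subLeft y).prodCongr (MeasurableEquiv.refl (RSpace d))).measurableEmbedding
  rw [← hmp.integral_comp he]
  simp

theorem WordBounded.continuous {d : ℕ} {f : RSpace d → ℂ} (hf : WordBounded f) : Continuous f :=
  hf.1.continuous

theorem WordBounded.differentiable {d : ℕ} {f : RSpace d → ℂ} (hf : WordBounded f) :
    Differentiable ℝ f :=
  hf.1.differentiable (by simp)

/-- Only the decay of `Φ` in its second component is used; the integrable window takes care of the
first variable, and the bound is uniform in `y`. -/
theorem norm_stftAdj_integrand_le {d : ℕ} {φ : RSpace d → ℂ} {Φ : RSpace (d + d) → ℂ} {B : ℝ}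
    (hB : ∀ q, (1 + ‖q‖) ^ (d + 1) * ‖Φ q‖ ≤ B) (y : RSpace d) (p : RSpace d × RSpace d) :
    ‖(φ p.1 * charNeg y p.2) * Φ (joinPoint (y - p.1) p.2)‖
      ≤ B * (‖φ p.1‖ * ((1 + ‖p.2‖) ^ (d + 1))⁻¹) := by
  rw [norm_mul, norm_mul, norm_charNeg, mul_one]
  have h1 : ‖Φ (joinPoint (y - p.1) p.2)‖ ≤ B * ((1 + ‖p.2‖) ^ (d + 1))⁻¹ := by
    rw [← div_eq_mul_inv, le_div_iff₀ (by positivity), mul_comm]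
    refine le_trans ?_ (hB (joinPoint (y - p.1) p.2))
    gcongr
    exact norm_snd_le_joinPoint _ _
  calc _ ≤ ‖φ p.1‖ * (B * ((1 + ‖p.2‖) ^ (d + 1))⁻¹) := by gcongr
    _ = _ := by ring

theorem integrable_stftAdj_bound {d : ℕ} {φ : RSpace d → ℂ} (hφi : Integrable φ) (B : ℝ) :
    Integrable (fun p : RSpace d × RSpace d => B * (‖φ p.1‖ * ((1 + ‖p.2‖) ^ (d + 1))⁻¹)) :=
  (hφi.norm.mul_prod (integrable_one_add_norm_pow_inv d)).const_mul B

theorem continuous_stftAdj_integrand {d : ℕ} {φ : RSpace d → ℂ} (hφ : Continuous φ)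
    {Φ : RSpace (d + d) → ℂ} (hΦ : Continuous Φ) (y : RSpace d) :
    Continuous (fun p : RSpace d × RSpace d =>
      (φ p.1 * charNeg y p.2) * Φ (joinPoint (y - p.1) p.2)) := by
  exact ((hφ.comp continuous_fst).mul (continuous_charNeg continuous_const continuous_snd)).mul
    (hΦ.comp ((joinL d).continuous.comp
      ((continuous_const.sub continuous_fst).prodMk continuous_snd)))

theorem integrable_stftAdj_integrand {d : ℕ} {φ : RSpace d → ℂ} (hφ : Continuous φ)
    (hφi : Integrable φ) {Φ : RSpace (d + d) → ℂ} (hΦ : WordBounded Φ) (y : RSpace d) :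
    Integrable (fun p : RSpace d × RSpace d =>
      (φ p.1 * charNeg y p.2) * Φ (joinPoint (y - p.1) p.2)) := by
  obtain ⟨B, -, hB⟩ := hΦ.decay (d + 1)
  exact (integrable_stftAdj_bound hφi B).mono'
    (continuous_stftAdj_integrand hφ hΦ.continuous y).aestronglyMeasurable
    (Filter.Eventually.of_forall fun p => norm_stftAdj_integrand_le hB y p)

/-- The derivative falls on the first slot of `Φ`, or on the character, where it produces `-iξ_j`, a
coordinate multiplication in the second slot. Both are letters acting on `Φ`. -/
theorem partialDeriv_stftAdj {d : ℕ} {φ : RSpace d → ℂ} (hφ : Continuous φ)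
    (hφi : Integrable φ) {Φ : RSpace (d + d) → ℂ} (hΦ : WordBounded Φ) :
    Differentiable ℝ (stftAdj φ Φ) ∧ ∀ j, partialDeriv j (stftAdj φ Φ)
      = (1 : ℂ) • stftAdj φ (letterAct (Sum.inl (Fin.castAdd d j)) Φ)
        + (-Complex.I) • stftAdj φ (letterAct (Sum.inr (Fin.natAdd d j)) Φ) := by
  have hΦ1 := fun j : Fin d => hΦ.letterAct (Sum.inl (Fin.castAdd d j))
  have hΦ2 := fun j : Fin d => hΦ.letterAct (Sum.inr (Fin.natAdd d j))
  have i1 := fun j y => integrable_stftAdj_integrand hφ hφi (hΦ1 j) y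
  have i2 := fun j y => integrable_stftAdj_integrand hφ hφi (hΦ2 j) y
  choose B1 hB10 hB1 using fun j => (hΦ1 j).decay (d + 1)
  choose B2 hB20 hB2 using fun j => (hΦ2 j).decay (d + 1)
  have hdiff : ∀ (p : RSpace d × RSpace d), Differentiable ℝ
      (fun y => (φ p.1 * charNeg y p.2) * Φ (joinPoint (y - p.1) p.2)) := fun p y =>
    (((charNeg_differentiable p.2) y).const_mul (φ p.1)).mul
      (hasFDerivAt_comp_joinPoint hΦ.differentiable p.1 p.2 y).differentiableAt
  have main := partialDeriv_integral (μ := (volume : Measure (RSpace d × RSpace d)))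
    (K := fun y p => (φ p.1 * charNeg y p.2) * Φ (joinPoint (y - p.1) p.2))
    (K' := fun j y p =>
      (φ p.1 * charNeg y p.2) * letterAct (Sum.inl (Fin.castAdd d j)) Φ (joinPoint (y - p.1) p.2)
      + (-Complex.I) * ((φ p.1 * charNeg y p.2)
        * letterAct (Sum.inr (Fin.natAdd d j)) Φ (joinPoint (y - p.1) p.2))) hdiff ?_ ?_ ?_ ?_
  · refine ⟨main.1, fun j => funext fun y => ?_⟩
    refine (main.2 j y).trans ?_
    rw [integral_add (i1 j y) ((i2 j y).const_mul _), integral_const_mul]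
    simp [stftAdj]
  · intro j y p
    rw [partialDeriv_mul j y (((charNeg_differentiable p.2) y).const_mul (φ p.1))
      (hasFDerivAt_comp_joinPoint hΦ.differentiable p.1 p.2 y).differentiableAt,
      partialDeriv_comp_joinPoint hΦ.differentiable,
      partialDeriv_mul j y (differentiableAt_const _) ((charNeg_differentiable p.2) y),
      partialDeriv_charNeg]
    simp only [letterAct, joinPoint_natAdd]
    simp [partialDeriv]
    ring
  · intro j y
    exact ((i1 j y).add ((i2 j y).const_mul _)).aestronglyMeasurable
  · exact integrable_stftAdj_integrand hφ hφi hΦ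
  · intro y₀
    refine ⟨fun p => (∑ j, (B1 j + B2 j)) * (‖φ p.1‖ * ((1 + ‖p.2‖) ^ (d + 1))⁻¹),
      integrable_stftAdj_bound hφi _, fun y _ j p => ?_⟩
    refine (norm_add_le _ _).trans ?_
    rw [norm_mul (-Complex.I), norm_neg, Complex.norm_I, one_mul]
    refine (add_le_add (norm_stftAdj_integrand_le (hB1 j) y p)
      (norm_stftAdj_integrand_le (hB2 j) y p)).trans ?_
    rw [← add_mul]
    refine mul_le_mul_of_nonneg_right ?_ (by positivity)
    exact Finset.single_le_sum (f := fun j => B1 j + B2 j)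
      (fun j _ => add_nonneg (hB10 j) (hB20 j)) (Finset.mem_univ j)

/-- The factor `y_j` times the character is `i ∂_{ξ_j}` of the character; one integration by parts
in `ξ_j` moves the derivative to `Φ`. -/
theorem coord_mul_stftAdj {d : ℕ} {φ : RSpace d → ℂ} (hφ : Continuous φ)
    (hφi : Integrable φ) {Φ : RSpace (d + d) → ℂ} (hΦ : WordBounded Φ) (j : Fin d) :
    (fun y => ((y j : ℝ) : ℂ) * stftAdj φ Φ y)
      = (-Complex.I) • stftAdj φ (letterAct (Sum.inl (Fin.natAdd d j)) Φ) := by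
  funext y
  have i0 := integrable_stftAdj_integrand hφ hφi hΦ y
  have i1 := integrable_stftAdj_integrand hφ hφi
    (hΦ.letterAct (Sum.inl (Fin.natAdd d j))) y
  have key := integral_bilinear_hasLineDerivAt_right_eq_neg_left_of_integrable
    (μ := (volume : Measure (RSpace d)).prod (volume : Measure (RSpace d))) (B := ContinuousLinearMap.mul ℝ ℂ)
    (f := fun p : RSpace d × RSpace d => φ p.1 * Φ (joinPoint (y - p.1) p.2))
    (f' := fun p => φ p.1 * partialDeriv (Fin.natAdd d j) Φ (joinPoint (y - p.1) p.2))
    (g := fun p : RSpace d × RSpace d => charNeg y p.2)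
    (g' := fun p => -Complex.I * y j * charNeg y p.2)
    (v := (0, EuclideanSpace.single j 1)) ?_ ?_ ?_
    (fun p _ => hasLineDerivAt_comp_joinPoint hΦ.differentiable φ j y p) ?_
  · simp only [ContinuousLinearMap.mul_apply'] at key
    have e1 : (∫ p : RSpace d × RSpace d, φ p.1 * Φ (joinPoint (y - p.1) p.2)
        * (-Complex.I * y j * charNeg y p.2)) = (-Complex.I * y j) * stftAdj φ Φ y := by
      rw [stftAdj, ← integral_const_mul]
      congr 1; funext p; ring
    have e2 : (∫ p : RSpace d × RSpace d, φ p.1 * partialDeriv (Fin.natAdd d j) Φ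
        (joinPoint (y - p.1) p.2) * charNeg y p.2)
        = stftAdj φ (letterAct (Sum.inl (Fin.natAdd d j)) Φ) y := by
      rw [stftAdj]
      congr 1; funext p; simp only [letterAct]; ring
    rw [← Measure.volume_eq_prod, e1, e2] at key
    simp only [Pi.smul_apply, smul_eq_mul]
    have hI := Complex.I_mul_I
    linear_combination Complex.I * key + (y j * stftAdj φ Φ y) * hI
  · refine i1.congr (Filter.Eventually.of_forall fun p => ?_)
    simp only [letterAct, ContinuousLinearMap.mul_apply']; ring
  · refine (i0.const_mul (-Complex.I * y j)).congr (Filter.Eventually.of_forall fun p => ?_)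
    simp only [ContinuousLinearMap.mul_apply']; ring
  · refine i0.congr (Filter.Eventually.of_forall fun p => ?_)
    simp only [ContinuousLinearMap.mul_apply']; ring
  · intro p _
    have h1 : HasFDerivAt (fun p : RSpace d × RSpace d => charNeg p.2 y) _ p :=
      (hasFDerivAt_charNeg p.2 y).comp p hasFDerivAt_snd
    have h2 := h1.hasLineDerivAt (0, EuclideanSpace.single j 1)
    simp only [charNeg_comm y]
    convert h2 using 1
    simp [EuclideanSpace.inner_single_right]
    ring

/-- The two preceding identities make the transposes of all `wordAct w Ψ` a family graded by the
length of `w`. Continuity and integrability are all that is required of `φ`. -/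
theorem stftAdj_mem_gelfandShilov {d : ℕ} {φ : RSpace d → ℂ} (hφ : Continuous φ)
    (hφi : Integrable φ) {Ψ : RSpace (d + d) → ℂ} (hΨ : Ψ ∈ gelfandShilov (d + d) (1 / 2)) :
    stftAdj φ Ψ ∈ gelfandShilov d (1 / 2) := by
  obtain ⟨h, hh, M, hM, e⟩ := exists_wordEstimate hΨ
  have hw := wordBounded_of_mem_gelfandShilov hΨ
  obtain ⟨k, hk, N, hN, e'⟩ := e.decay hh hM (d + 1)
  set I := ∫ p : RSpace d × RSpace d, ‖φ p.1‖ * ((1 + ‖p.2‖) ^ (d + 1))⁻¹ with hI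
  have hI0 : 0 ≤ I := integral_nonneg fun p => by positivity
  refine mem_gelfandShilov_of_family (K := 2)
    (fun n => {g | ∃ w : List (Fin (d + d) ⊕ Fin (d + d)), w.length = n ∧
      g = stftAdj φ (wordAct w Ψ)}) (C := 1) (M := N * I) (h := k) zero_le_one (by positivity)
    (by linarith) ?_ ?_ ?_ (g := stftAdj φ Ψ) ⟨[], rfl, rfl⟩
  · rintro n g ⟨w, -, rfl⟩
    exact (partialDeriv_stftAdj hφ hφi (hw.wordAct w)).1
  · rintro n g ⟨w, hn, rfl⟩ A
    have mem : ∀ A, stftAdj φ (letterAct A (wordAct w Ψ)) ∈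
        {g | ∃ w : List (Fin (d + d) ⊕ Fin (d + d)), w.length = n + 1 ∧
          g = stftAdj φ (wordAct w Ψ)} := fun A =>
      ⟨w ++ [A], by simp [hn], by rw [wordAct_append, wordAct_cons, wordAct_nil]⟩
    cases A with
    | inl j =>
      refine ⟨![1, -Complex.I], ![stftAdj φ (letterAct (Sum.inl (Fin.castAdd d j)) (wordAct w Ψ)),
        stftAdj φ (letterAct (Sum.inr (Fin.natAdd d j)) (wordAct w Ψ))], fun k => ?_, fun k => ?_,
        ((partialDeriv_stftAdj hφ hφi (hw.wordAct w)).2 j).trans ?_⟩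
      · fin_cases k
        · exact mem _
        · exact mem _
      · fin_cases k <;> simp
      · rw [Fin.sum_univ_two]; rfl
    | inr j =>
      refine ⟨![-Complex.I, 0], fun _ => stftAdj φ (letterAct (Sum.inl (Fin.natAdd d j))
        (wordAct w Ψ)), fun k => mem _, fun k => ?_,
        (coord_mul_stftAdj hφ hφi (hw.wordAct w) j).trans ?_⟩
      · fin_cases k <;> simp
      · rw [Fin.sum_univ_two]
        simp
  · rintro n g ⟨w, hn, rfl⟩ y
    refine (norm_integral_le_of_norm_le (integrable_stftAdj_bound hφi _)
      (Filter.Eventually.of_forall fun p => norm_stftAdj_integrand_le (e' w) y p)).trans ?_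
    rw [integral_const_mul, hn]
    refine le_of_eq ?_; ring

theorem stftTranspose_mem_gelfandShilov {d : ℕ} {φ : RSpace d → ℂ} (hφ : Continuous φ)
    (hφi : Integrable φ) {Ψ : RSpace (d + d) → ℂ} (hΨ : Ψ ∈ gelfandShilov (d + d) (1 / 2)) :
    stftTranspose φ Ψ ∈ gelfandShilov d (1 / 2) := by
  rw [stftTranspose_eq]
  refine Submodule.smul_mem _ _ (stftAdj_mem_gelfandShilov (Complex.continuous_conj.comp hφ) ?_ hΨ)
  exact (Complex.conjCLE.toContinuousLinearMap).integrable_comp hφi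
-- The short-time Fourier transform of two functions in `S_{1/2}`.
theorem WordBounded.integrable {d : ℕ} {f : RSpace d → ℂ} (hf : WordBounded f) : Integrable f := by
  obtain ⟨B, -, hB⟩ := hf.decay (d + 1)
  refine ((integrable_one_add_norm_pow_inv d).const_mul B).mono'
    hf.continuous.aestronglyMeasurable (Filter.Eventually.of_forall fun x => ?_)
  rw [← div_eq_mul_inv, le_div_iff₀ (by positivity), mul_comm]
  exact hB x

/-- The first component of a point of `ℝ^{2d}`. -/
noncomputable def fstL (d : ℕ) : RSpace (d + d) →L[ℝ] RSpace d :=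
  LinearMap.toContinuousLinearMap
    { toFun := fun q => WithLp.toLp 2 (fun j => q (Fin.castAdd d j))
      map_add' := fun p q => by ext j; simp
      map_smul' := fun c p => by ext j; simp }

/-- The second component of a point of `ℝ^{2d}`. -/
noncomputable def sndL (d : ℕ) : RSpace (d + d) →L[ℝ] RSpace d :=
  LinearMap.toContinuousLinearMap
    { toFun := fun q => WithLp.toLp 2 (fun j => q (Fin.natAdd d j))
      map_add' := fun p q => by ext j; simp
      map_smul' := fun c p => by ext j; simp }

theorem fstL_apply {d : ℕ} (q : RSpace (d + d)) (j : Fin d) :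
    fstL d q j = q (Fin.castAdd d j) := rfl

theorem sndL_apply {d : ℕ} (q : RSpace (d + d)) (j : Fin d) :
    sndL d q j = q (Fin.natAdd d j) := rfl

theorem fstL_joinPoint {d : ℕ} (x ξ : RSpace d) : fstL d (joinPoint x ξ) = x := by
  ext j; rw [fstL_apply, joinPoint_castAdd]

theorem sndL_joinPoint {d : ℕ} (x ξ : RSpace d) : sndL d (joinPoint x ξ) = ξ := by
  ext j; rw [sndL_apply, joinPoint_natAdd]

/-- The function `q = (x, ξ) ↦ ∫ χ(y) ψ(y - x) e^{i⟨y,ξ⟩} dy`. -/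
noncomputable def stftPair {d : ℕ} (χ ψ : RSpace d → ℂ) (q : RSpace (d + d)) : ℂ :=
  ∫ y, χ y * ψ (y - fstL d q) * charNeg (-sndL d q) y

theorem continuous_stftPair_integrand {d : ℕ} {χ ψ : RSpace d → ℂ} (hχ : Continuous χ)
    (hψ : Continuous ψ) (q : RSpace (d + d)) :
    Continuous (fun y => χ y * ψ (y - fstL d q) * charNeg (-sndL d q) y) :=
  (hχ.mul (hψ.comp (continuous_id.sub continuous_const))).mul
    (continuous_charNeg continuous_const continuous_id)

theorem norm_stftPair_integrand_le {d : ℕ} {χ ψ : RSpace d → ℂ} {B : ℝ} (hB : ∀ x, ‖ψ x‖ ≤ B)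
    (q : RSpace (d + d)) (y : RSpace d) :
    ‖χ y * ψ (y - fstL d q) * charNeg (-sndL d q) y‖ ≤ B * ‖χ y‖ := by
  rw [norm_mul, norm_mul, norm_charNeg, mul_one, mul_comm]
  exact mul_le_mul_of_nonneg_right (hB _) (norm_nonneg _)

theorem integrable_stftPair_integrand {d : ℕ} {χ ψ : RSpace d → ℂ} (hχ : WordBounded χ)
    (hψ : WordBounded ψ) (q : RSpace (d + d)) :
    Integrable (fun y => χ y * ψ (y - fstL d q) * charNeg (-sndL d q) y) := by
  obtain ⟨B, hB⟩ := hψ.2 []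
  exact (hχ.integrable.norm.const_mul B).mono'
    (continuous_stftPair_integrand hχ.continuous hψ.continuous q).aestronglyMeasurable
    (Filter.Eventually.of_forall fun y => norm_stftPair_integrand_le hB q y)

theorem hasFDerivAt_comp_sub_fstL {d : ℕ} {ψ : RSpace d → ℂ} (hψ : Differentiable ℝ ψ)
    (y : RSpace d) (q : RSpace (d + d)) :
    HasFDerivAt (fun q => ψ (y - fstL d q)) ((fderiv ℝ ψ (y - fstL d q)).comp (-fstL d)) q :=
  (hψ _).hasFDerivAt.comp q ((fstL d).hasFDerivAt.const_sub y)

theorem hasFDerivAt_charNeg_comp_sndL {d : ℕ} (y : RSpace d) (q : RSpace (d + d)) :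
    HasFDerivAt (fun q => charNeg (-sndL d q) y)
      (((-Complex.I * charNeg (-sndL d q) y) • Complex.ofRealCLM.comp (innerSL ℝ y)).comp
        (-sndL d)) q :=
  HasFDerivAt.comp (g := fun ξ => charNeg ξ y) q (hasFDerivAt_charNeg (-sndL d q) y)
    ((sndL d).hasFDerivAt.neg)

theorem fstL_single_castAdd {d : ℕ} (j : Fin d) :
    fstL d (EuclideanSpace.single (Fin.castAdd d j) (1 : ℝ)) = EuclideanSpace.single j 1 := by
  rw [← joinPoint_single_zero, fstL_joinPoint]

theorem fstL_single_natAdd {d : ℕ} (j : Fin d) :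
    fstL d (EuclideanSpace.single (Fin.natAdd d j) (1 : ℝ)) = 0 := by
  rw [← joinPoint_zero_single, fstL_joinPoint]

theorem sndL_single_castAdd {d : ℕ} (j : Fin d) :
    sndL d (EuclideanSpace.single (Fin.castAdd d j) (1 : ℝ)) = 0 := by
  rw [← joinPoint_single_zero, sndL_joinPoint]

theorem sndL_single_natAdd {d : ℕ} (j : Fin d) :
    sndL d (EuclideanSpace.single (Fin.natAdd d j) (1 : ℝ)) = EuclideanSpace.single j 1 := by
  rw [← joinPoint_zero_single, sndL_joinPoint]

/-- A derivative in `x` falls on `ψ(y - x)` with a minus sign; one in `ξ` falls on the character and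
gives `i y_j`, credited to `χ`. -/
theorem partialDeriv_stftPair {d : ℕ} {χ ψ : RSpace d → ℂ} (hχ : WordBounded χ)
    (hψ : WordBounded ψ) : Differentiable ℝ (stftPair χ ψ) ∧
      (∀ j, partialDeriv (Fin.castAdd d j) (stftPair χ ψ)
        = (-1 : ℂ) • stftPair χ (letterAct (Sum.inl j) ψ)) ∧
      (∀ j, partialDeriv (Fin.natAdd d j) (stftPair χ ψ)
        = Complex.I • stftPair (letterAct (Sum.inr j) χ) ψ) := by
  have i1 := fun j q => integrable_stftPair_integrand hχ (hψ.letterAct (Sum.inl j)) q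
  have i2 := fun j q => integrable_stftPair_integrand (hχ.letterAct (Sum.inr j)) hψ q
  obtain ⟨B, hB⟩ := hψ.2 []
  choose B1 hB1 using fun j => (hψ.letterAct (Sum.inl j)).2 []
  have hB0 : 0 ≤ B := (norm_nonneg _).trans (hB 0)
  have hB10 : ∀ j, 0 ≤ B1 j := fun j => (norm_nonneg _).trans (hB1 j 0)
  have d1 : ∀ y q, DifferentiableAt ℝ (fun q => ψ (y - fstL d q)) q := fun y q =>
    (hasFDerivAt_comp_sub_fstL hψ.differentiable y q).differentiableAt
  have d2 : ∀ y q, DifferentiableAt ℝ (fun q => charNeg (-sndL d q) y) q := fun y q =>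
    (hasFDerivAt_charNeg_comp_sndL y q).differentiableAt
  have main := partialDeriv_integral (μ := (volume : Measure (RSpace d)))
    (K := fun q y => χ y * ψ (y - fstL d q) * charNeg (-sndL d q) y)
    (K' := Fin.addCases
      (fun j q y => (-1) * (χ y * letterAct (Sum.inl j) ψ (y - fstL d q) * charNeg (-sndL d q) y))
      (fun j q y => Complex.I *
        (letterAct (Sum.inr j) χ y * ψ (y - fstL d q) * charNeg (-sndL d q) y)))
    (fun y q => ((d1 y q).const_mul _).mul (d2 y q)) ?_ ?_
    (integrable_stftPair_integrand hχ hψ) ?_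
  · refine ⟨main.1, fun j => funext fun q => ?_, fun j => funext fun q => ?_⟩
    · refine (main.2 _ q).trans ?_
      simp only [Fin.addCases_left]
      rw [integral_const_mul]; rfl
    · refine (main.2 _ q).trans ?_
      simp only [Fin.addCases_right]
      rw [integral_const_mul]; rfl
  · intro i q y
    rw [partialDeriv_mul i q ((d1 y q).const_mul _) (d2 y q),
      partialDeriv_mul i q (differentiableAt_const _) (d1 y q)]
    simp only [partialDeriv]
    rw [(hasFDerivAt_comp_sub_fstL hψ.differentiable y q).fderiv,
      (hasFDerivAt_charNeg_comp_sndL y q).fderiv]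
    refine Fin.addCases (fun j => ?_) (fun j => ?_) i
    · simp only [Fin.addCases_left]
      simp [fstL_single_castAdd, sndL_single_castAdd, letterAct, partialDeriv]
    · simp only [Fin.addCases_right]
      simp [fstL_single_natAdd, sndL_single_natAdd, letterAct, -Fin.natAdd_eq_addNat,
        EuclideanSpace.inner_single_right]
      ring
  · intro i q
    refine Fin.addCases (fun j => ?_) (fun j => ?_) i
    · simp only [Fin.addCases_left]; exact ((i1 j q).const_mul _).aestronglyMeasurable
    · simp only [Fin.addCases_right]; exact ((i2 j q).const_mul _).aestronglyMeasurable
  · intro q₀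
    refine ⟨fun y => (∑ j, B1 j) * ‖χ y‖ + ∑ j, B * ‖letterAct (Sum.inr j) χ y‖,
      (hχ.integrable.norm.const_mul _).add (integrable_finsetSum _ fun j _ =>
        (hχ.letterAct (Sum.inr j)).integrable.norm.const_mul _), fun q _ i y => ?_⟩
    have n1 : 0 ≤ ∑ j, B * ‖letterAct (Sum.inr j) χ y‖ :=
      Finset.sum_nonneg fun j _ => by positivity
    have n2 : 0 ≤ ∑ j, B1 j := Finset.sum_nonneg fun j _ => hB10 j
    refine Fin.addCases (fun j => ?_) (fun j => ?_) i
    · simp only [Fin.addCases_left]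
      rw [norm_mul, norm_neg, norm_one, one_mul]
      refine (norm_stftPair_integrand_le (hB1 j) q y).trans ?_
      have : B1 j ≤ ∑ j, B1 j :=
        Finset.single_le_sum (f := B1) (fun j _ => hB10 j) (Finset.mem_univ j)
      have := mul_le_mul_of_nonneg_right this (norm_nonneg (χ y))
      linarith
    · simp only [Fin.addCases_right]
      rw [norm_mul, Complex.norm_I, one_mul]
      refine (norm_stftPair_integrand_le hB q y).trans ?_
      have := Finset.single_le_sum (f := fun j => B * ‖letterAct (Sum.inr j) χ y‖)
        (fun j _ => by positivity) (Finset.mem_univ j)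
      have h3 : 0 ≤ (∑ j, B1 j) * ‖χ y‖ := by positivity
      linarith

/-- Write `x_j = y_j - (y - x)_j` under the integral. -/
theorem coord_castAdd_mul_stftPair {d : ℕ} {χ ψ : RSpace d → ℂ} (hχ : WordBounded χ)
    (hψ : WordBounded ψ) (j : Fin d) :
    (fun q => ((q (Fin.castAdd d j) : ℝ) : ℂ) * stftPair χ ψ q)
      = (1 : ℂ) • stftPair (letterAct (Sum.inr j) χ) ψ
        + (-1 : ℂ) • stftPair χ (letterAct (Sum.inr j) ψ) := by
  funext q
  simp only [Pi.add_apply, Pi.smul_apply, smul_eq_mul, stftPair]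
  rw [← integral_const_mul, ← integral_const_mul, ← integral_const_mul, ← integral_add
    ((integrable_stftPair_integrand (hχ.letterAct (Sum.inr j)) hψ q).const_mul _)
    ((integrable_stftPair_integrand hχ (hψ.letterAct (Sum.inr j)) q).const_mul _)]
  congr 1
  funext y
  simp only [letterAct, PiLp.sub_apply, fstL_apply]
  push_cast; ring

/-- The factor `ξ_j` is produced by differentiating the character in `y_j`; integration by parts and
the Leibniz rule give the two terms. -/
theorem coord_natAdd_mul_stftPair {d : ℕ} {χ ψ : RSpace d → ℂ} (hχ : WordBounded χ)
    (hψ : WordBounded ψ) (j : Fin d) :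
    (fun q => ((q (Fin.natAdd d j) : ℝ) : ℂ) * stftPair χ ψ q)
      = Complex.I • stftPair (letterAct (Sum.inl j) χ) ψ
        + Complex.I • stftPair χ (letterAct (Sum.inl j) ψ) := by
  funext q
  have i0 := integrable_stftPair_integrand hχ hψ q
  have i1 := integrable_stftPair_integrand (hχ.letterAct (Sum.inl j)) hψ q
  have i2 := integrable_stftPair_integrand hχ (hψ.letterAct (Sum.inl j)) q
  have dψ : Differentiable ℝ (fun y => ψ (y - fstL d q)) :=
    hψ.differentiable.comp (differentiable_id.sub_const _)
  have e1 : ∀ y, fderiv ℝ (fun y => χ y * ψ (y - fstL d q)) y (EuclideanSpace.single j 1)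
      = letterAct (Sum.inl j) χ y * ψ (y - fstL d q)
        + χ y * letterAct (Sum.inl j) ψ (y - fstL d q) := by
    intro y
    have := partialDeriv_mul j y (hχ.differentiable y) (dψ y)
    simp only [partialDeriv] at this
    rw [this]
    simp only [letterAct, partialDeriv]
    rw [fderiv_comp_sub (f := ψ)]
  have e2 : ∀ y, fderiv ℝ (fun y => charNeg (-sndL d q) y) y (EuclideanSpace.single j 1)
      = (Complex.I * q (Fin.natAdd d j)) * charNeg (-sndL d q) y := by
    intro y
    simp only [charNeg_comm (-sndL d q)]
    have := partialDeriv_charNeg j y (-sndL d q)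
    rw [partialDeriv] at this
    rw [this]
    simp only [PiLp.neg_apply, sndL_apply]
    push_cast; ring
  have key := integral_mul_fderiv_eq_neg_fderiv_mul_of_integrable
    (μ := (volume : Measure (RSpace d)))
    (f := fun y => χ y * ψ (y - fstL d q)) (g := fun y => charNeg (-sndL d q) y)
    (v := EuclideanSpace.single j 1) ?_ ?_ i0 (fun y _ => (hχ.differentiable.mul dψ) y)
    (fun y _ => by
      simp only [charNeg_comm (-sndL d q)]
      exact charNeg_differentiable _ y)
  · simp only [e1, e2] at key
    have e3 : (∫ y, χ y * ψ (y - fstL d q) * ((Complex.I * q (Fin.natAdd d j))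
        * charNeg (-sndL d q) y)) = (Complex.I * q (Fin.natAdd d j)) * stftPair χ ψ q := by
      rw [stftPair, ← integral_const_mul]
      congr 1; funext y; ring
    have e4 : (∫ y, (letterAct (Sum.inl j) χ y * ψ (y - fstL d q)
        + χ y * letterAct (Sum.inl j) ψ (y - fstL d q)) * charNeg (-sndL d q) y)
        = stftPair (letterAct (Sum.inl j) χ) ψ q + stftPair χ (letterAct (Sum.inl j) ψ) q := by
      simp only [add_mul]
      exact integral_add i1 i2
    rw [e3, e4] at key
    simp only [Pi.add_apply, Pi.smul_apply, smul_eq_mul]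
    have hI := Complex.I_mul_I
    linear_combination (-Complex.I) * key + (q (Fin.natAdd d j) * stftPair χ ψ q) * hI
  · simp only [e1, add_mul]
    exact i1.add i2
  · simp only [e2]
    refine (i0.const_mul (Complex.I * q (Fin.natAdd d j))).congr
      (Filter.Eventually.of_forall fun y => ?_)
    simp only; ring

/-- The degree is the total length of a word acting on `χ` and a word acting on `ψ`; the product of
the two factorials is at most the factorial of the sum. -/
theorem stftPair_mem_gelfandShilov {d : ℕ} {χ ψ : RSpace d → ℂ}
    (hχ : χ ∈ gelfandShilov d (1 / 2)) (hψ : ψ ∈ gelfandShilov d (1 / 2)) :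
    stftPair χ ψ ∈ gelfandShilov (d + d) (1 / 2) := by
  obtain ⟨h₁, hh₁, M₁, hM₁, e₁⟩ := exists_wordEstimate hχ
  obtain ⟨h₂, hh₂, M₂, hM₂, e₂⟩ := exists_wordEstimate hψ
  have wχ := wordBounded_of_mem_gelfandShilov hχ
  have wψ := wordBounded_of_mem_gelfandShilov hψ
  obtain ⟨k, hk, N, hN, e'⟩ := e₁.decay hh₁ hM₁ (d + 1)
  set I := ∫ x : RSpace d, ((1 + ‖x‖) ^ (d + 1))⁻¹ with hI
  have hI0 : 0 ≤ I := integral_nonneg fun p => by positivity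
  set F : ℕ → Set (RSpace (d + d) → ℂ) := fun n => {g | ∃ v w : List (Fin d ⊕ Fin d),
    v.length + w.length = n ∧ g = stftPair (wordAct v χ) (wordAct w ψ)} with hF
  have mem1 : ∀ n (v w : List (Fin d ⊕ Fin d)) A, v.length + w.length = n →
      stftPair (letterAct A (wordAct v χ)) (wordAct w ψ) ∈ F (n + 1) := fun n v w A hn =>
    ⟨v ++ [A], w, by simp; omega, by rw [wordAct_append, wordAct_cons, wordAct_nil]⟩
  have mem2 : ∀ n (v w : List (Fin d ⊕ Fin d)) A, v.length + w.length = n →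
      stftPair (wordAct v χ) (letterAct A (wordAct w ψ)) ∈ F (n + 1) := fun n v w A hn =>
    ⟨v, w ++ [A], by simp; omega, by rw [wordAct_append, wordAct_cons, wordAct_nil]⟩
  refine mem_gelfandShilov_of_family (K := 2) F (C := 1) (M := N * I * M₂) (h := max k h₂)
    zero_le_one (by positivity) (lt_max_of_lt_left (by linarith)) ?_ ?_ ?_ (g := stftPair χ ψ)
    ⟨[], [], rfl, rfl⟩
  · rintro n g ⟨v, w, -, rfl⟩
    exact (partialDeriv_stftPair (wχ.wordAct v) (wψ.wordAct w)).1
  · rintro n g ⟨v, w, hn, rfl⟩ A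
    have hv := wχ.wordAct v
    have hw := wψ.wordAct w
    have hp := partialDeriv_stftPair hv hw
    rcases A with i | i <;> refine Fin.addCases (fun j => ?_) (fun j => ?_) i
    · refine ⟨![-1, 0], fun _ => _, fun k => mem2 n v w (Sum.inl j) hn, fun k => ?_,
        (hp.2.1 j).trans ?_⟩
      · fin_cases k <;> simp
      · rw [Fin.sum_univ_two]; simp
    · refine ⟨![Complex.I, 0], fun _ => _, fun k => mem1 n v w (Sum.inr j) hn, fun k => ?_,
        (hp.2.2 j).trans ?_⟩
      · fin_cases k <;> simp
      · rw [Fin.sum_univ_two]; simp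
    · refine ⟨![1, -1], ![stftPair (letterAct (Sum.inr j) (wordAct v χ)) (wordAct w ψ),
        stftPair (wordAct v χ) (letterAct (Sum.inr j) (wordAct w ψ))], fun k => ?_, fun k => ?_,
        (coord_castAdd_mul_stftPair hv hw j).trans ?_⟩
      · fin_cases k
        · exact mem1 n v w _ hn
        · exact mem2 n v w _ hn
      · fin_cases k <;> simp
      · rw [Fin.sum_univ_two]; rfl
    · refine ⟨![Complex.I, Complex.I], ![stftPair (letterAct (Sum.inl j) (wordAct v χ))
        (wordAct w ψ), stftPair (wordAct v χ) (letterAct (Sum.inl j) (wordAct w ψ))],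
        fun k => ?_, fun k => ?_, (coord_natAdd_mul_stftPair hv hw j).trans ?_⟩
      · fin_cases k
        · exact mem1 n v w _ hn
        · exact mem2 n v w _ hn
      · fin_cases k <;> simp
      · rw [Fin.sum_univ_two]; rfl
  · rintro n g ⟨v, w, hn, rfl⟩ q
    set B := M₂ * (h₂ ^ w.length * √(w.length.factorial)) with hB
    set A := N * (k ^ v.length * √(v.length.factorial)) with hA
    have hB0 : 0 ≤ B := by positivity
    have hA0 : 0 ≤ A := by positivity
    have h1 : ∀ y, ‖wordAct v χ y * wordAct w ψ (y - fstL d q) * charNeg (-sndL d q) y‖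
        ≤ (B * A) * ((1 + ‖y‖) ^ (d + 1))⁻¹ := by
      intro y
      refine (norm_stftPair_integrand_le (e₂ w) q y).trans ?_
      rw [← hB, mul_assoc B A]
      refine mul_le_mul_of_nonneg_left ?_ hB0
      rw [← div_eq_mul_inv, le_div_iff₀ (by positivity), mul_comm]
      exact e' v y
    refine (norm_integral_le_of_norm_le ((integrable_one_add_norm_pow_inv d).const_mul _)
      (Filter.Eventually.of_forall h1)).trans ?_
    rw [integral_const_mul, hA, hB, ← hI]
    have h2 : √(v.length.factorial : ℝ) * √(w.length.factorial) ≤ √(n.factorial) := by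
      rw [← Real.sqrt_mul (by positivity), ← hn]
      refine Real.sqrt_le_sqrt ?_
      exact_mod_cast Nat.le_of_dvd (Nat.factorial_pos _)
        (Nat.factorial_mul_factorial_dvd_factorial_add _ _)
    have hk0 : 0 < k := by linarith
    have h3 : k ^ v.length * h₂ ^ w.length ≤ max k h₂ ^ n := by
      rw [← hn, pow_add]
      gcongr
      · exact le_max_left _ _
      · exact le_max_right _ _
    calc _ = N * I * M₂ * ((k ^ v.length * h₂ ^ w.length)
          * (√(v.length.factorial : ℝ) * √(w.length.factorial))) := by ring
      _ ≤ _ := by gcongr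

/-! ### Fourier inversion and the reproducing test functions. -/

open FourierTransform in
-- Fourier inversion in the normalisation `e^{-2πi⟨x,w⟩}`, rescaled by `ξ = 2πw`; the Jacobian is
-- `(2π)^d`.
theorem integral_charNeg_mul_integral {d : ℕ} {k : RSpace d → ℂ} (hk : Continuous k)
    (hki : Integrable k) (hG : Integrable (fun ξ => ∫ y, k y * charNeg (-ξ) y)) (y : RSpace d) :
    ∫ ξ, charNeg y ξ * ∫ z, k z * charNeg (-ξ) z = (2 * Real.pi) ^ d * k y := by
  set G : RSpace d → ℂ := fun ξ => ∫ z, k z * charNeg (-ξ) z with hGdef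
  have h2π : (0 : ℝ) < 2 * Real.pi := by positivity
  have e1 : ∀ w, 𝓕⁻ k w = G ((2 * Real.pi) • w) := by
    intro w
    rw [Real.fourierInv_eq']
    simp only [hGdef]
    congr 1; funext v
    rw [smul_eq_mul, mul_comm, charNeg]
    congr 2
    rw [inner_neg_left, inner_smul_left, real_inner_comm]
    simp; ring
  have i1 : Integrable (𝓕⁻ k) := by
    have : 𝓕⁻ k = fun w => G ((2 * Real.pi) • w) := funext e1
    rw [this]
    exact hG.comp_smul h2π.ne'
  have i2 : Integrable (𝓕 k) := by
    have : 𝓕 k = fun w => 𝓕⁻ k (-w) := by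
      funext w; rw [Real.fourierInv_eq_fourier_neg, neg_neg]
    rw [this]
    exact i1.comp_neg
  have e2 : 𝓕 (𝓕⁻ k) y = k y := congrFun (hk.fourier_fourierInv_eq hki i2) y
  rw [Real.fourier_eq'] at e2
  have e3 : (fun v => Complex.exp (↑(-2 * Real.pi * inner ℝ v y) * Complex.I) • 𝓕⁻ k v)
      = fun v => (fun ξ => charNeg y ξ * G ξ) ((2 * Real.pi) • v) := by
    funext v
    simp only
    rw [e1, smul_eq_mul, charNeg]
    congr 2
    rw [inner_smul_right, real_inner_comm]
    push_cast; ring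
  rw [e3, Measure.integral_comp_smul volume (fun ξ => charNeg y ξ * G ξ), finrank_euclideanSpace, Fintype.card_fin,
    abs_of_pos (by positivity), Complex.real_smul] at e2
  rw [← e2]
  push_cast
  rw [← mul_assoc, mul_inv_cancel₀, one_mul]
  have : (2 * (Real.pi : ℂ)) ≠ 0 := by
    exact_mod_cast h2π.ne'
  exact pow_ne_zero _ this

theorem fourierConst_pos (d : ℕ) : 0 < fourierConst d := by
  unfold fourierConst; positivity

theorem fourierConst_mul_self (d : ℕ) : fourierConst d * fourierConst d * (2 * Real.pi) ^ d = 1 := by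
  have h2π : (0 : ℝ) < 2 * Real.pi := by positivity
  rw [fourierConst, ← Real.rpow_natCast, ← Real.rpow_add h2π, ← Real.rpow_add h2π]
  ring_nf
  simp

theorem WordBounded.integrable_joinPoint {d : ℕ} {Φ : RSpace (d + d) → ℂ} (hΦ : WordBounded Φ)
    (x : RSpace d) : Integrable (fun ξ => Φ (joinPoint x ξ)) := by
  obtain ⟨B, -, hB⟩ := hΦ.decay (d + 1)
  refine ((integrable_one_add_norm_pow_inv d).const_mul B).mono' ?_
    (Filter.Eventually.of_forall fun ξ => ?_)
  · exact (hΦ.continuous.comp ((joinL d).continuous.comp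
      (continuous_const.prodMk continuous_id))).aestronglyMeasurable
  · rw [← div_eq_mul_inv, le_div_iff₀ (by positivity), mul_comm]
    refine le_trans ?_ (hB (joinPoint x ξ))
    gcongr
    exact norm_snd_le_joinPoint _ _

/-- The inversion formula for the short-time Fourier transform, on test functions. -/
theorem stftTranspose_stftPair {d : ℕ} {φ χ ψ : RSpace d → ℂ} (hφ : Continuous φ)
    (hφi : Integrable φ) (hχ : χ ∈ gelfandShilov d (1 / 2)) (hψ : ψ ∈ gelfandShilov d (1 / 2)) :
    stftTranspose φ ((fourierConst d : ℂ) • stftPair χ ψ)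
      = (∫ z, (starRingEnd ℂ) (φ z) * ψ z) • χ := by
  have wχ := wordBounded_of_mem_gelfandShilov hχ
  have wψ := wordBounded_of_mem_gelfandShilov hψ
  have hS := stftPair_mem_gelfandShilov hχ hψ
  have wS := wordBounded_of_mem_gelfandShilov hS
  have wcS := wordBounded_of_mem_gelfandShilov
    (Submodule.smul_mem _ (fourierConst d : ℂ) hS)
  have hφc : Continuous (fun z => (starRingEnd ℂ) (φ z)) := Complex.continuous_conj.comp hφ
  have hφci : Integrable (fun z => (starRingEnd ℂ) (φ z)) :=
    (Complex.conjCLE.toContinuousLinearMap).integrable_comp hφi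
  rw [stftTranspose_eq]
  funext y
  simp only [Pi.smul_apply _ (stftAdj _ _), Pi.smul_apply _ χ, smul_eq_mul, stftAdj]
  have hint := integrable_stftAdj_integrand hφc hφci wcS y
  rw [Measure.volume_eq_prod, integral_prod _ hint]
  -- For fixed `z` the integral over `ξ` is a Fourier inversion of `v ↦ χ(v) ψ(v - (y - z))`
  -- evaluated at `v = y`, which leaves `χ(y) ψ(z)`.
  have inner_eq : ∀ z, ∫ ξ, (starRingEnd ℂ) (φ z) * charNeg y ξ
      * ((fourierConst d : ℂ) • stftPair χ ψ) (joinPoint (y - z) ξ)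
      = ((fourierConst d : ℂ) * (2 * Real.pi) ^ d * χ y) * ((starRingEnd ℂ) (φ z) * ψ z) := by
    intro z
    have e1 : ∀ ξ, stftPair χ ψ (joinPoint (y - z) ξ)
        = ∫ v, (χ v * ψ (v - (y - z))) * charNeg (-ξ) v := by
      intro ξ; simp only [stftPair, fstL_joinPoint, sndL_joinPoint]
    have hk : Continuous (fun v => χ v * ψ (v - (y - z))) :=
      wχ.continuous.mul (wψ.continuous.comp (continuous_id.sub continuous_const))
    have hki : Integrable (fun v => χ v * ψ (v - (y - z))) := by
      obtain ⟨B, hB⟩ := wψ.2 []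
      refine (wχ.integrable.norm.const_mul B).mono' hk.aestronglyMeasurable
        (Filter.Eventually.of_forall fun v => ?_)
      rw [norm_mul, mul_comm]
      exact mul_le_mul_of_nonneg_right (hB _) (norm_nonneg _)
    have hG : Integrable (fun ξ => ∫ v, (χ v * ψ (v - (y - z))) * charNeg (-ξ) v) := by
      simp only [← e1]
      exact wS.integrable_joinPoint _
    have key := integral_charNeg_mul_integral hk hki hG y
    calc _ = ∫ ξ, ((starRingEnd ℂ) (φ z) * (fourierConst d : ℂ)) * (charNeg y ξ
            * ∫ v, (χ v * ψ (v - (y - z))) * charNeg (-ξ) v) := by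
          congr 1; funext ξ
          rw [← e1]
          simp only [Pi.smul_apply, smul_eq_mul]; ring
      _ = _ := by
          rw [integral_const_mul, key, sub_sub_cancel]; ring
  simp only [inner_eq]
  rw [integral_const_mul]
  have hc : (fourierConst d : ℂ) * fourierConst d * (2 * Real.pi) ^ d = 1 := by
    exact_mod_cast fourierConst_mul_self d
  linear_combination (χ y * ∫ z, (starRingEnd ℂ) (φ z) * ψ z) * hc

open Filter Topology in
/-- Some Gaussian is not orthogonal to a given non-zero continuous integrable function. -/
theorem exists_gaussianAt_integral_ne_zero {d : ℕ} {φ : RSpace d → ℂ} (hφ : Continuous φ)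
    (hφi : Integrable φ) (h0 : φ ≠ 0) :
    ∃ c > 0, ∃ a, ∫ z, (starRingEnd ℂ) (φ z) * gaussianAt c a z ≠ 0 := by
  obtain ⟨a, ha⟩ := Function.ne_iff.1 h0
  have hφci : Integrable (fun z => (starRingEnd ℂ) (φ z)) :=
    (Complex.conjCLE.toContinuousLinearMap).integrable_comp hφi
  have hφc : Continuous (fun z => (starRingEnd ℂ) (φ z)) := Complex.continuous_conj.comp hφ
  set J := ∫ x : RSpace d, Real.exp (-1 * ‖x‖ ^ 2) with hJ
  have hJ0 : 0 < J := by
    rw [hJ, GaussianFourier.integral_rexp_neg_mul_sq_norm one_pos]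
    positivity
  -- Normalised, contracted Gaussians are an approximate identity at `a`, where `φ` does not vanish;
  -- so some contracted Gaussian has nonzero integral.
  have hlim := tendsto_integral_comp_smul_smul_of_integrable' (μ := (volume : Measure (RSpace d)))
    (φ := fun x => J⁻¹ * Real.exp (-1 * ‖x‖ ^ 2)) (fun x => by positivity)
    (by rw [integral_const_mul, ← hJ, inv_mul_cancel₀ hJ0.ne']) ?_ hφci (hφc.continuousAt (x := a))
  · have hne : (starRingEnd ℂ) (φ a) ≠ 0 := by
      simpa using ha
    obtain ⟨c, hc1, hc2⟩ := ((hlim.eventually_ne hne).and (eventually_gt_atTop 0)).exists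
    refine ⟨c ^ 2, by positivity, a, fun hcon => hc1 ?_⟩
    have : ∀ x, (c ^ Module.finrank ℝ (RSpace d) * (J⁻¹ * Real.exp (-1 * ‖c • (a - x)‖ ^ 2)))
        • (starRingEnd ℂ) (φ x) = ((c ^ Module.finrank ℝ (RSpace d) * J⁻¹ : ℝ) : ℂ)
          * ((starRingEnd ℂ) (φ x) * gaussianAt (c ^ 2) a x) := by
      intro x
      rw [Complex.real_smul, gaussianAt, norm_smul, mul_pow, Real.norm_eq_abs, sq_abs,
        norm_sub_rev]
      push_cast
      rw [neg_one_mul, neg_mul]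
      ring
    simp only [this]
    rw [integral_const_mul, hcon, mul_zero]
  · obtain ⟨C, hC⟩ := one_add_pow_mul_exp_le (Module.finrank ℝ (RSpace d) + 1) (r := 1) (p := 2)
      one_pos two_pos
    have hlim0 : Tendsto (fun x : RSpace d => J⁻¹ * C * ‖x‖⁻¹) (Bornology.cobounded (RSpace d))
        (𝓝 0) := by
      simpa using (tendsto_inv_atTop_zero.comp (tendsto_norm_cobounded_atTop
        (E := RSpace d))).const_mul (J⁻¹ * C)
    refine squeeze_zero' (Eventually.of_forall fun x => by positivity) ?_ hlim0
    filter_upwards [tendsto_norm_cobounded_atTop.eventually_gt_atTop 0] with x hx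
    have h1 := hC ‖x‖ hx.le
    have e : ‖x‖ ^ (2 : ℝ) = ‖x‖ ^ 2 := by norm_num
    rw [e] at h1
    have h2 : ‖x‖ ^ (Module.finrank ℝ (RSpace d) + 1) * Real.exp (-1 * ‖x‖ ^ 2) ≤ C := by
      refine le_trans ?_ h1
      gcongr
      linarith
    rw [mul_assoc J⁻¹ C, ← div_eq_mul_inv, mul_left_comm]
    refine mul_le_mul_of_nonneg_left ?_ (by positivity)
    rw [le_div_iff₀ hx]
    refine le_trans (le_of_eq ?_) h2
    rw [pow_succ]; ring
-- From derivative bounds to bounds on the transform.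
theorem partialDeriv_conj {d : ℕ} (j : Fin d) (f : RSpace d → ℂ) :
    partialDeriv j (fun x => (starRingEnd ℂ) (f x))
      = fun x => (starRingEnd ℂ) (partialDeriv j f x) := by
  funext x
  have := Complex.conjCLE.comp_fderiv (f := f) (x := x)
  have e : (fun x => (starRingEnd ℂ) (f x)) = Complex.conjCLE ∘ f := by
    funext x; simp
  rw [partialDeriv, e, this]
  simp [partialDeriv]

theorem conj_comp_contDiff {d : ℕ} {f : RSpace d → ℂ} (hf : ContDiff ℝ ∞ f) :
    ContDiff ℝ ∞ (fun x => (starRingEnd ℂ) (f x)) :=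
  Complex.conjCLE.contDiff.comp hf

theorem multiDeriv_conj {d : ℕ} (α : Fin d → ℕ) {f : RSpace d → ℂ} (hf : ContDiff ℝ ∞ f) :
    multiDeriv α (fun x => (starRingEnd ℂ) (f x))
      = fun x => (starRingEnd ℂ) (multiDeriv α f x) := by
  induction α using multiIndex_induction with
  | h0 => simp [multiDeriv_zero]
  | hs α j ih =>
    rw [multiDeriv_add_single α j (conj_comp_contDiff hf), ih, partialDeriv_conj,
      multiDeriv_add_single α j hf]

theorem WindowBound.conj {d : ℕ} {s k r : ℝ} {φ : RSpace d → ℂ} (hφ : ContDiff ℝ ∞ φ)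
    (h : WindowBound s k r φ) : WindowBound s k r (fun x => (starRingEnd ℂ) (φ x)) := by
  obtain ⟨C, hC, hb⟩ := h
  refine ⟨C, hC, fun γ x => ?_⟩
  rw [multiDeriv_conj γ hφ, RCLike.norm_conj]
  exact hb γ x

theorem WindowBound.norm_le {d : ℕ} {s k r : ℝ} {φ : RSpace d → ℂ} (h : WindowBound s k r φ) :
    ∃ C, 0 ≤ C ∧ ∀ x, ‖φ x‖ ≤ C * Real.exp (-r * ‖x‖ ^ (1 / s)) := by
  obtain ⟨C, hC, hb⟩ := h
  refine ⟨C, hC, fun x => ?_⟩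
  simpa [multiDeriv_zero, multiLength_zero, multiFactorial_zero] using hb 0 x

theorem WindowBound.integrable {d : ℕ} {s k r : ℝ} {φ : RSpace d → ℂ} (hs : 0 < s) (hr : 0 < r)
    (hφ : Continuous φ) (h : WindowBound s k r φ) : Integrable φ := by
  obtain ⟨C, hC, hb⟩ := h.norm_le
  exact ((integrable_exp_neg_mul_norm_rpow d hr (one_div_pos.2 hs)).const_mul C).mono'
    hφ.aestronglyMeasurable (Filter.Eventually.of_forall hb)

theorem DerivBound.exists_nonneg {d : ℕ} {s h ε : ℝ} {u : RSpace d → ℂ}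
    (hu : DerivBound s h ε u) : ∃ C, 0 ≤ C ∧ ∀ (α : Fin d → ℕ) (x : RSpace d),
      ‖multiDeriv α u x‖ ≤ C * (Real.exp (h * ‖x‖ ^ (1 / s)) * ε ^ multiLength α
        * (multiFactorial α : ℝ) ^ s) := by
  obtain ⟨C, hC⟩ := hu
  refine ⟨C, ?_, hC⟩
  have := (norm_nonneg _).trans (hC 0 0)
  simp only [multiLength_zero, multiFactorial_zero, pow_zero, Nat.cast_one, Real.one_rpow,
    mul_one] at this
  exact nonneg_of_mul_nonneg_left this (Real.exp_pos _)

theorem exp_mul_exp_shift_le {d : ℕ} {s : ℝ} (hs : 0 < s) (h r : ℝ) (x z : RSpace d) :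
    Real.exp (h * ‖x + z‖ ^ (1 / s)) * Real.exp (-r * ‖z‖ ^ (1 / s))
      ≤ Real.exp (changedExponent s h * ‖x‖ ^ (1 / s))
        * Real.exp (-(r - |h| * kappa (1 / s)) * ‖z‖ ^ (1 / s)) := by
  rw [← Real.exp_add, ← Real.exp_add, Real.exp_le_exp]
  have := mul_norm_add_rpow_le hs h x z
  linarith

theorem partialDeriv_comp_sub {d : ℕ} (j : Fin d) (θ : RSpace d → ℂ) (x y : RSpace d) :
    partialDeriv j (fun y => θ (y - x)) y = partialDeriv j θ (y - x) := by
  rw [partialDeriv, fderiv_comp_sub (f := θ)]; rfl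

/-- Weighted integrability of the product of a function of growth `e^{h|·|^{1/s}}` and a translate
of a function of decay `e^{-r|·|^{1/s}}`. -/
theorem integrable_mul_translate {d : ℕ} {s h r C D : ℝ} {v θ : RSpace d → ℂ} (hs : 0 < s)
    (hr : |h| * kappa (1 / s) < r) (hC : 0 ≤ C)
    (hv : Continuous v) (hθ : Continuous θ)
    (hvb : ∀ y, ‖v y‖ ≤ C * Real.exp (h * ‖y‖ ^ (1 / s)))
    (hθb : ∀ y, ‖θ y‖ ≤ D * Real.exp (-r * ‖y‖ ^ (1 / s))) (x : RSpace d) :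
    Integrable (fun y => v y * θ (y - x)) ∧
      ∫ y, ‖v y * θ (y - x)‖ ≤ C * D * (∫ z : RSpace d,
        Real.exp (-(r - |h| * kappa (1 / s)) * ‖z‖ ^ (1 / s)))
          * Real.exp (changedExponent s h * ‖x‖ ^ (1 / s)) := by
  -- In the variable `z = y - x` the growth of `v` at `x + z` is split between `x` and `z`, and the
  -- excess in `z` is covered by `r > |h| κ(1/s)`.
  have hz : ∀ z, ‖v (x + z) * θ z‖ ≤ (C * D * Real.exp (changedExponent s h * ‖x‖ ^ (1 / s)))
      * Real.exp (-(r - |h| * kappa (1 / s)) * ‖z‖ ^ (1 / s)) := by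
    intro z
    have hD : 0 ≤ D := by
      have := (norm_nonneg _).trans (hθb 0)
      exact nonneg_of_mul_nonneg_left this (Real.exp_pos _)
    rw [norm_mul]
    calc ‖v (x + z)‖ * ‖θ z‖ ≤ (C * Real.exp (h * ‖x + z‖ ^ (1 / s)))
          * (D * Real.exp (-r * ‖z‖ ^ (1 / s))) := by
          gcongr
          · exact hvb _
          · exact hθb _
      _ = C * D * (Real.exp (h * ‖x + z‖ ^ (1 / s)) * Real.exp (-r * ‖z‖ ^ (1 / s))) := by ring
      _ ≤ C * D * (Real.exp (changedExponent s h * ‖x‖ ^ (1 / s))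
        * Real.exp (-(r - |h| * kappa (1 / s)) * ‖z‖ ^ (1 / s))) :=
          mul_le_mul_of_nonneg_left (exp_mul_exp_shift_le hs h r x z) (by positivity)
      _ = _ := by ring
  have hg := (integrable_exp_neg_mul_norm_rpow d (sub_pos.2 hr) (one_div_pos.2 hs)).const_mul
    (C * D * Real.exp (changedExponent s h * ‖x‖ ^ (1 / s)))
  have hi : Integrable (fun z => v (x + z) * θ z) :=
    hg.mono' ((hv.comp (continuous_const.add continuous_id)).mul hθ).aestronglyMeasurable
      (Filter.Eventually.of_forall hz)
  have e : (fun y => v y * θ (y - x)) = fun y => (fun z => v (x + z) * θ z) (y - x) := by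
    funext y; simp
  refine ⟨by rw [e]; exact hi.comp_sub_right x, ?_⟩
  have e2 : ∫ y, ‖v y * θ (y - x)‖ = ∫ z, ‖v (x + z) * θ z‖ := by
    rw [← integral_sub_right_eq_self (fun z => ‖v (x + z) * θ z‖) x]
    simp
  rw [e2]
  refine (integral_mono hi.norm hg hz).trans (le_of_eq ?_)
  rw [integral_const_mul]; ring

/-- The functions `∫ ∂^α u(y) ∂^β θ(y-x) e^{-i⟨y,ξ⟩} dy`. -/
noncomputable def stftDeriv {d : ℕ} (u θ : RSpace d → ℂ) (α β : Fin d → ℕ) (x ξ : RSpace d) : ℂ :=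
  ∫ y, multiDeriv α u y * multiDeriv β θ (y - x) * charNeg y ξ

theorem stftIntegral_eq_stftDeriv {d : ℕ} (φ u : RSpace d → ℂ) (x ξ : RSpace d) :
    stftIntegral φ u x ξ
      = (fourierConst d : ℂ) * stftDeriv u (fun x => (starRingEnd ℂ) (φ x)) 0 0 x ξ := by
  simp [stftIntegral, stftDeriv, multiDeriv_zero]

theorem Integrable.mul_charNeg {d : ℕ} {v : RSpace d → ℂ} (hv : Integrable v) (ξ : RSpace d) :
    Integrable (fun y => v y * charNeg y ξ) := by
  refine hv.norm.mono' (hv.aestronglyMeasurable.mul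
    (continuous_charNeg continuous_id continuous_const).aestronglyMeasurable)
    (Filter.Eventually.of_forall fun y => ?_)
  rw [norm_mul, norm_charNeg, mul_one]

/-- One integration by parts: `ξ_j` times the character is `i ∂_{y_j}` of it. Integrability of all
the products makes boundary terms vanish. -/
theorem coord_mul_stftDeriv {d : ℕ} {u θ : RSpace d → ℂ} (hu : ContDiff ℝ ∞ u)
    (hθ : ContDiff ℝ ∞ θ) (x ξ : RSpace d)
    (hi : ∀ α β, Integrable (fun y => multiDeriv α u y * multiDeriv β θ (y - x)))
    (α β : Fin d → ℕ) (j : Fin d) :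
    (ξ j : ℂ) * stftDeriv u θ α β x ξ
      = -Complex.I * (stftDeriv u θ (α + Pi.single j 1) β x ξ
        + stftDeriv u θ α (β + Pi.single j 1) x ξ) := by
  have i0 := Integrable.mul_charNeg (hi α β) ξ
  have i1 := Integrable.mul_charNeg (hi (α + Pi.single j 1) β) ξ
  have i2 := Integrable.mul_charNeg (hi α (β + Pi.single j 1)) ξ
  have d1 : Differentiable ℝ (multiDeriv α u) := (multiDeriv_contDiff α hu).differentiable (by simp)
  have d2 : Differentiable ℝ (fun y => multiDeriv β θ (y - x)) :=
    ((multiDeriv_contDiff β hθ).differentiable (by simp)).comp (differentiable_id.sub_const _)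
  have e1 : ∀ y, fderiv ℝ (fun y => multiDeriv α u y * multiDeriv β θ (y - x)) y
      (EuclideanSpace.single j 1) = multiDeriv (α + Pi.single j 1) u y * multiDeriv β θ (y - x)
        + multiDeriv α u y * multiDeriv (β + Pi.single j 1) θ (y - x) := by
    intro y
    have := partialDeriv_mul j y (d1 y) (d2 y)
    rw [partialDeriv_comp_sub] at this
    rw [multiDeriv_add_single α j hu, multiDeriv_add_single β j hθ, ← this]
    rfl
  have e2 : ∀ y, fderiv ℝ (fun y => charNeg y ξ) y (EuclideanSpace.single j 1)
      = (-Complex.I * ξ j) * charNeg y ξ := fun y => partialDeriv_charNeg j y ξ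
  have key := integral_mul_fderiv_eq_neg_fderiv_mul_of_integrable
    (μ := (volume : Measure (RSpace d)))
    (f := fun y => multiDeriv α u y * multiDeriv β θ (y - x)) (g := fun y => charNeg y ξ)
    (v := EuclideanSpace.single j 1) ?_ ?_ i0 (fun y _ => (d1.mul d2) y)
    (fun y _ => charNeg_differentiable _ y)
  · simp only [e1, e2] at key
    have e3 : (∫ y, multiDeriv α u y * multiDeriv β θ (y - x) * ((-Complex.I * ξ j)
        * charNeg y ξ)) = (-Complex.I * ξ j) * stftDeriv u θ α β x ξ := by
      rw [stftDeriv, ← integral_const_mul]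
      congr 1; funext y; ring
    have e4 : (∫ y, (multiDeriv (α + Pi.single j 1) u y * multiDeriv β θ (y - x)
        + multiDeriv α u y * multiDeriv (β + Pi.single j 1) θ (y - x)) * charNeg y ξ)
        = stftDeriv u θ (α + Pi.single j 1) β x ξ + stftDeriv u θ α (β + Pi.single j 1) x ξ := by
      simp only [add_mul]
      exact integral_add i1 i2
    rw [e3, e4] at key
    have hI := Complex.I_mul_I
    linear_combination Complex.I * key + (ξ j * stftDeriv u θ α β x ξ) * hI
  · simp only [e1, add_mul]
    exact i1.add i2
  · simp only [e2]
    refine (i0.const_mul (-Complex.I * ξ j)).congr (Filter.Eventually.of_forall fun y => ?_)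
    simp only; ring

theorem norm_stftDeriv_le {d : ℕ} {s h ε k r : ℝ} {u θ : RSpace d → ℂ} (hs : 0 < s)
    (hε : 0 < ε) (hk : 0 < k) (hr : |h| * kappa (1 / s) < r) (hu : ContDiff ℝ ∞ u)
    (hθ : ContDiff ℝ ∞ θ) (hub : DerivBound s h ε u) (hθb : WindowBound s k r θ) :
    ∃ A, 0 ≤ A ∧ ∀ (α β : Fin d → ℕ) (x : RSpace d),
      Integrable (fun y => multiDeriv α u y * multiDeriv β θ (y - x)) ∧
      ∫ y, ‖multiDeriv α u y * multiDeriv β θ (y - x)‖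
        ≤ A * (max ε k ^ (multiLength α + multiLength β)
          * ((multiFactorial α : ℝ) ^ s * (multiFactorial β : ℝ) ^ s))
          * Real.exp (changedExponent s h * ‖x‖ ^ (1 / s)) := by
  obtain ⟨C, hC, hCb⟩ := hub.exists_nonneg
  obtain ⟨D, hD, hDb⟩ := hθb
  set J := ∫ z : RSpace d, Real.exp (-(r - |h| * kappa (1 / s)) * ‖z‖ ^ (1 / s)) with hJ
  have hJ0 : 0 ≤ J := integral_nonneg fun z => (Real.exp_pos _).le
  refine ⟨C * D * J, by positivity, fun α β x => ?_⟩
  obtain ⟨h1, h2⟩ := integrable_mul_translate (s := s) (h := h) (r := r)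
    (C := C * (ε ^ multiLength α * (multiFactorial α : ℝ) ^ s))
    (D := D * (k ^ multiLength β * (multiFactorial β : ℝ) ^ s)) hs hr (by positivity)
    (multiDeriv_contDiff α hu).continuous (multiDeriv_contDiff β hθ).continuous
    (fun y => (hCb α y).trans (le_of_eq (by ring)))
    (fun y => (hDb β y).trans (le_of_eq (by ring))) x
  refine ⟨h1, h2.trans ?_⟩
  rw [← hJ]
  have h3 : ε ^ multiLength α * k ^ multiLength β
      ≤ max ε k ^ (multiLength α + multiLength β) := by
    rw [pow_add]
    gcongr
    · exact le_max_left _ _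
    · exact le_max_right _ _
  calc _ = C * D * J * ((ε ^ multiLength α * k ^ multiLength β)
        * ((multiFactorial α : ℝ) ^ s * (multiFactorial β : ℝ) ^ s))
        * Real.exp (changedExponent s h * ‖x‖ ^ (1 / s)) := by ring
    _ ≤ _ := by gcongr

/-- Integrating by parts `m` times in the coordinate dominating `ξ` gives `2^m` terms, each bounded
by `ρ^m (m!)^s`; the moment criterion with `k = (d+1)·2ρ` produces the stated rate. -/
theorem phaseBound_stftIntegral {d : ℕ} {s h ε k r : ℝ} {φ u : RSpace d → ℂ} (hs : 0 < s)
    (hε : 0 < ε) (hk : 0 < k) (hr : |h| * kappa (1 / s) < r) (hu : ContDiff ℝ ∞ u)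
    (hφ : ContDiff ℝ ∞ φ) (hub : DerivBound s h ε u) (hφb : WindowBound s k r φ) :
    PhaseBound s (changedExponent s h) (s / (2 * ((d + 1) * (2 * max ε k)) ^ (1 / s)))
      (stftIntegral φ u) := by
  set θ : RSpace d → ℂ := fun x => (starRingEnd ℂ) (φ x) with hθdef
  have hθ : ContDiff ℝ ∞ θ := conj_comp_contDiff hφ
  obtain ⟨A, hA, hAb⟩ := norm_stftDeriv_le hs hε hk hr hu hθ hub (hφb.conj hφ)
  set ρ := max ε k with hρ
  have hρ0 : 0 < ρ := lt_max_of_lt_left hε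
  refine ⟨fourierConst d * (2 ^ s * A), fun x ξ => ?_⟩
  set E := Real.exp (changedExponent s h * ‖x‖ ^ (1 / s)) with hE
  have hW : ∀ α β, ‖stftDeriv u θ α β x ξ‖ ≤ A * (ρ ^ (multiLength α + multiLength β)
      * ((multiFactorial α : ℝ) ^ s * (multiFactorial β : ℝ) ^ s)) * E := by
    intro α β
    refine (norm_integral_le_integral_norm _).trans (le_trans (le_of_eq ?_) (hAb α β x).2)
    congr 1; funext y
    rw [norm_mul _ (charNeg y ξ), norm_charNeg, mul_one]
  -- Derivatives already spent on the two factors are kept as free parameters `a` and `b`, so that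
  -- the recursion closes.
  have step : ∀ (j : Fin d) (m a b : ℕ), |ξ j| ^ m
      * ‖stftDeriv u θ (Pi.single j a) (Pi.single j b) x ξ‖
        ≤ 2 ^ m * (A * (ρ ^ (a + b + m) * ((a + b + m).factorial : ℝ) ^ s) * E) := by
    intro j m
    induction m with
    | zero =>
      intro a b
      have := hW (Pi.single j a) (Pi.single j b)
      rw [multiLength_single, multiLength_single, multiFactorial_single,
        multiFactorial_single] at this
      rw [pow_zero, pow_zero, one_mul, one_mul, add_zero]
      refine this.trans ?_
      rw [← Real.mul_rpow (by positivity) (by positivity)]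
      gcongr
      exact_mod_cast Nat.le_of_dvd (Nat.factorial_pos _)
        (Nat.factorial_mul_factorial_dvd_factorial_add a b)
    | succ m ih =>
      intro a b
      have e := coord_mul_stftDeriv hu hθ x ξ (fun α β => (hAb α β x).1) (Pi.single j a)
        (Pi.single j b) j
      rw [← Pi.single_add, ← Pi.single_add] at e
      have e' := congrArg norm e
      rw [norm_mul, norm_mul, norm_neg, Complex.norm_I, one_mul, Complex.norm_real,
        Real.norm_eq_abs] at e'
      have h1 := ih (a + 1) b
      have h2 := ih a (b + 1)
      have e1 : a + 1 + b + m = a + b + (m + 1) := by omega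
      have e2 : a + (b + 1) + m = a + b + (m + 1) := by omega
      rw [e1] at h1
      rw [e2] at h2
      calc |ξ j| ^ (m + 1) * ‖stftDeriv u θ (Pi.single j a) (Pi.single j b) x ξ‖
          = |ξ j| ^ m * (|ξ j| * ‖stftDeriv u θ (Pi.single j a) (Pi.single j b) x ξ‖) := by
            rw [pow_succ]; ring
        _ ≤ |ξ j| ^ m * (‖stftDeriv u θ (Pi.single j (a + 1)) (Pi.single j b) x ξ‖
            + ‖stftDeriv u θ (Pi.single j a) (Pi.single j (b + 1)) x ξ‖) := by
            rw [e']; gcongr; exact norm_add_le _ _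
        _ ≤ _ := by rw [mul_add, pow_succ]; linarith
  have moments : ∀ m : ℕ, ‖ξ‖ ^ m * ‖stftDeriv u θ 0 0 x ξ‖
      ≤ (A * E) * (((d + 1) * (2 * ρ)) ^ m * (m.factorial : ℝ) ^ s) := by
    intro m
    rcases Nat.eq_zero_or_pos m with rfl | hm
    · simpa [multiLength_zero, multiFactorial_zero] using hW 0 0
    by_cases hξ : ξ = 0
    · rw [hξ, norm_zero, zero_pow hm.ne', zero_mul]
      positivity
    obtain ⟨j, hj⟩ := exists_coord_norm_le ξ hξ
    have hj' : ‖ξ‖ ≤ (d + 1) * |ξ j| := hj.trans (by gcongr; linarith)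
    have h1 := step j m 0 0
    simp only [Pi.single_zero, zero_add] at h1
    calc ‖ξ‖ ^ m * ‖stftDeriv u θ 0 0 x ξ‖
        ≤ ((d + 1) * |ξ j|) ^ m * ‖stftDeriv u θ 0 0 x ξ‖ := by gcongr
      _ = (d + 1) ^ m * (|ξ j| ^ m * ‖stftDeriv u θ 0 0 x ξ‖) := by rw [mul_pow]; ring
      _ ≤ (d + 1) ^ m * (2 ^ m * (A * (ρ ^ m * (m.factorial : ℝ) ^ s) * E)) := by gcongr
      _ = _ := by rw [mul_pow, mul_pow]; ring
  have key := le_exp_of_moment_le hs (by positivity) (norm_nonneg ξ) (norm_nonneg _)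
    (by positivity) moments
  rw [stftIntegral_eq_stftDeriv, norm_mul, Complex.norm_real,
    Real.norm_of_nonneg (fourierConst_pos d).le, mul_assoc (fourierConst d)]
  refine mul_le_mul_of_nonneg_left (key.trans (le_of_eq ?_)) (fourierConst_pos d).le
  rw [sub_eq_add_neg, Real.exp_add, ← hE, neg_mul]
  ring

/-- Growth of order at most that of every Gaussian, in the form in which it is used for functions
in the classes `Γ`. -/
def SubGaussianGrowth {d : ℕ} (s r : ℝ) (u : RSpace d → ℂ) : Prop :=
  ∀ c > 0, ∃ h C : ℝ, 0 ≤ C ∧ |h| * kappa (1 / s) < r ∧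
    (∀ y, ‖u y‖ ≤ C * Real.exp (h * ‖y‖ ^ (1 / s))) ∧
    ∃ C', 0 ≤ C' ∧ ∀ t : ℝ, 0 ≤ t →
      Real.exp (changedExponent s h * t ^ (1 / s)) ≤ C' * Real.exp (c * t ^ 2)

/-- In the variable `z = y - x` the window no longer moves, and one dominating function serves all
points near `p₀`. -/
theorem continuous_stftIntegral {d : ℕ} {s h r C D : ℝ} {φ u : RSpace d → ℂ} (hs : 0 < s)
    (hr : |h| * kappa (1 / s) < r) (hu : Continuous u) (hφ : Continuous φ) (hC : 0 ≤ C)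
    (hub : ∀ y, ‖u y‖ ≤ C * Real.exp (h * ‖y‖ ^ (1 / s)))
    (hD : 0 ≤ D) (hφb : ∀ y, ‖φ y‖ ≤ D * Real.exp (-r * ‖y‖ ^ (1 / s))) :
    Continuous (fun p : RSpace d × RSpace d => stftIntegral φ u p.1 p.2) := by
  have e : ∀ p : RSpace d × RSpace d, stftIntegral φ u p.1 p.2 = (fourierConst d : ℂ)
      * ∫ z, u (p.1 + z) * (starRingEnd ℂ) (φ z) * charNeg (p.1 + z) p.2 := by
    intro p
    rw [stftIntegral, ← integral_sub_right_eq_self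
      (fun z => u (p.1 + z) * (starRingEnd ℂ) (φ z) * charNeg (p.1 + z) p.2) p.1]
    simp
  simp only [e]
  refine continuous_const.mul (continuous_iff_continuousAt.2 fun p₀ => ?_)
  have hp : 0 < 1 / s := one_div_pos.2 hs
  refine continuousAt_of_dominated (bound := fun z => (C * D
    * Real.exp (|changedExponent s h| * (‖p₀.1‖ + 1) ^ (1 / s)))
    * Real.exp (-(r - |h| * kappa (1 / s)) * ‖z‖ ^ (1 / s))) ?_ ?_ ?_ ?_
  · refine Filter.Eventually.of_forall fun p => Continuous.aestronglyMeasurable ?_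
    exact ((hu.comp (continuous_const.add continuous_id)).mul
      (Complex.continuous_conj.comp hφ)).mul
      (continuous_charNeg (continuous_const.add continuous_id) continuous_const)
  · have hev : ∀ᶠ p : RSpace d × RSpace d in nhds p₀, ‖p.1‖ < ‖p₀.1‖ + 1 :=
      (continuous_fst.norm.tendsto p₀).eventually_lt_const (by linarith)
    filter_upwards [hev] with p hp1
    refine Filter.Eventually.of_forall fun z => ?_
    rw [norm_mul, norm_mul, norm_charNeg, mul_one, RCLike.norm_conj]
    have h1 : Real.exp (changedExponent s h * ‖p.1‖ ^ (1 / s))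
        ≤ Real.exp (|changedExponent s h| * (‖p₀.1‖ + 1) ^ (1 / s)) := by
      rw [Real.exp_le_exp]
      have : ‖p.1‖ ^ (1 / s) ≤ (‖p₀.1‖ + 1) ^ (1 / s) :=
        Real.rpow_le_rpow (norm_nonneg _) hp1.le hp.le
      exact mul_le_mul (le_abs_self _) this (by positivity) (abs_nonneg _)
    calc ‖u (p.1 + z)‖ * ‖φ z‖ ≤ (C * Real.exp (h * ‖p.1 + z‖ ^ (1 / s)))
          * (D * Real.exp (-r * ‖z‖ ^ (1 / s))) := by
          gcongr
          · exact hub _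
          · exact hφb _
      _ = C * D * (Real.exp (h * ‖p.1 + z‖ ^ (1 / s)) * Real.exp (-r * ‖z‖ ^ (1 / s))) := by ring
      _ ≤ C * D * (Real.exp (changedExponent s h * ‖p.1‖ ^ (1 / s))
        * Real.exp (-(r - |h| * kappa (1 / s)) * ‖z‖ ^ (1 / s))) :=
          mul_le_mul_of_nonneg_left (exp_mul_exp_shift_le hs h r p.1 z) (by positivity)
      _ ≤ C * D * (Real.exp (|changedExponent s h| * (‖p₀.1‖ + 1) ^ (1 / s))
        * Real.exp (-(r - |h| * kappa (1 / s)) * ‖z‖ ^ (1 / s))) := by gcongr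
      _ = _ := by ring
  · exact (integrable_exp_neg_mul_norm_rpow d (sub_pos.2 hr) hp).const_mul _
  · refine Filter.Eventually.of_forall fun z => Continuous.continuousAt ?_
    exact ((hu.comp (continuous_fst.add continuous_const)).mul continuous_const).mul
      (continuous_charNeg (continuous_fst.add continuous_const) continuous_snd)

theorem norm_le_gaussian_of_mem_gelfandShilov {d : ℕ} {Ψ : RSpace d → ℂ}
    (hΨ : Ψ ∈ gelfandShilov d (1 / 2)) :
    ∃ r > 0, ∃ D, 0 ≤ D ∧ ∀ q, ‖Ψ q‖ ≤ D * Real.exp (-r * ‖q‖ ^ 2) := by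
  obtain ⟨k, hk, r, hr, hb⟩ := windowBound_of_mem_gelfandShilov (by norm_num) hΨ
  obtain ⟨D, hD, hDb⟩ := hb.norm_le
  refine ⟨r, hr, D, hD, fun q => (hDb q).trans (le_of_eq ?_)⟩
  norm_num

/-- Fubini for the kernel in `(x, ξ, y)`. Integrating in `y` first leaves growth `e^{h^*|x|^{1/s}}`,
which the Gaussian decay of the test function has to beat. -/
theorem isSTFT_stftIntegral {d : ℕ} {s k r : ℝ} {φ u : RSpace d → ℂ} {f : GSDistribution d}
    (hs : 0 < s) (hr0 : 0 < r) (hu : Continuous u) (hφ : Continuous φ) (hfu : f.EqFun u)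
    (hφb : WindowBound s k r φ) (hgrow : SubGaussianGrowth s r u) :
    IsSTFT φ f (stftIntegral φ u) := by
  obtain ⟨D, hD, hDb⟩ := hφb.norm_le
  have hφi := hφb.integrable hs hr0 hφ
  have hφc : Continuous (fun x => (starRingEnd ℂ) (φ x)) := Complex.continuous_conj.comp hφ
  constructor
  · obtain ⟨h, C, hC, hr, hub, -⟩ := hgrow 1 one_pos
    exact continuous_stftIntegral hs hr hu hφ hC hub hD hDb
  intro Ψ hΨ
  have wΨ := wordBounded_of_mem_gelfandShilov hΨ
  obtain ⟨ρ, hρ, N, hN, hNb⟩ := norm_le_gaussian_of_mem_gelfandShilov hΨ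
  -- The exponent is chosen after `Ψ`, so that its growth costs only half of the Gaussian rate. At
  -- `s = 1/2` no fixed exponent would serve for every `Ψ`.
  obtain ⟨h, C, hC, hr, hub, C', hC', hexp⟩ := hgrow (ρ / 2) (by positivity)
  have hT := fun x => integrable_mul_translate hs hr hC hu hφc hub
    (D := D) (fun y => by rw [RCLike.norm_conj]; exact hDb y) x
  set J := ∫ z : RSpace d, Real.exp (-(r - |h| * kappa (1 / s)) * ‖z‖ ^ (1 / s)) with hJ
  have hJ0 : 0 ≤ J := integral_nonneg fun z => (Real.exp_pos _).le
  set K : (RSpace d × RSpace d) × RSpace d → ℂ := fun q =>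
    (u q.2 * (starRingEnd ℂ) (φ (q.2 - q.1.1)) * charNeg q.2 q.1.2)
      * Ψ (joinPoint q.1.1 q.1.2) with hK
  have hKc : Continuous K := by
    refine (((hu.comp continuous_snd).mul (hφc.comp
      (continuous_snd.sub continuous_fst.fst))).mul
      (continuous_charNeg continuous_snd continuous_fst.snd)).mul
      (wΨ.continuous.comp ((joinL d).continuous.comp continuous_fst))
  have hKnorm : ∀ p y, ‖K (p, y)‖
      = ‖Ψ (joinPoint p.1 p.2)‖ * ‖u y * (starRingEnd ℂ) (φ (y - p.1))‖ := by
    intro p y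
    simp only [hK]
    rw [norm_mul, norm_mul _ (charNeg _ _), norm_charNeg, mul_one, mul_comm]
  have hg2 : ∀ {c : ℝ}, 0 < c → Integrable (fun x : RSpace d => Real.exp (-c * ‖x‖ ^ 2)) := by
    intro c hc
    have := integrable_exp_neg_mul_norm_rpow d hc two_pos
    refine this.congr (Filter.Eventually.of_forall fun x => ?_)
    simp
  have hKi : Integrable K ((volume : Measure (RSpace d × RSpace d)).prod volume) := by
    rw [integrable_prod_iff hKc.aestronglyMeasurable]
    constructor
    · refine Filter.Eventually.of_forall fun p => ?_
      exact (Integrable.mul_charNeg (hT p.1).1 p.2).mul_const (Ψ (joinPoint p.1 p.2))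
    · have hbi : Integrable (fun p : RSpace d × RSpace d => (N * (C * D * J) * C')
          * (Real.exp (-(ρ / 2) * ‖p.1‖ ^ 2) * Real.exp (-ρ * ‖p.2‖ ^ 2)))
          ((volume : Measure (RSpace d)).prod volume) :=
        ((hg2 (by positivity)).mul_prod (hg2 hρ)).const_mul _
      refine hbi.mono' hKc.norm.aestronglyMeasurable.integral_prod_right'
        (Filter.Eventually.of_forall fun p => ?_)
      simp only [hKnorm]
      rw [integral_const_mul, Real.norm_of_nonneg (mul_nonneg (norm_nonneg _)
        (integral_nonneg fun y => norm_nonneg _))]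
      have h1 : Real.exp (-ρ * ‖joinPoint p.1 p.2‖ ^ 2)
          * Real.exp (changedExponent s h * ‖p.1‖ ^ (1 / s))
          ≤ C' * (Real.exp (-(ρ / 2) * ‖p.1‖ ^ 2) * Real.exp (-ρ * ‖p.2‖ ^ 2)) := by
        rw [norm_joinPoint_sq]
        calc _ ≤ Real.exp (-ρ * (‖p.1‖ ^ 2 + ‖p.2‖ ^ 2))
              * (C' * Real.exp (ρ / 2 * ‖p.1‖ ^ 2)) := by
              gcongr; exact hexp _ (norm_nonneg _)
          _ = C' * (Real.exp (-ρ * (‖p.1‖ ^ 2 + ‖p.2‖ ^ 2)) * Real.exp (ρ / 2 * ‖p.1‖ ^ 2)) := by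
              ring
          _ = _ := by
              rw [← Real.exp_add, ← Real.exp_add]; congr 2; ring
      calc _ ≤ (N * Real.exp (-ρ * ‖joinPoint p.1 p.2‖ ^ 2))
            * (C * D * J * Real.exp (changedExponent s h * ‖p.1‖ ^ (1 / s))) :=
            mul_le_mul (hNb _) (hT p.1).2 (integral_nonneg fun y => norm_nonneg _)
              (by positivity)
        _ = (N * (C * D * J)) * (Real.exp (-ρ * ‖joinPoint p.1 p.2‖ ^ 2)
            * Real.exp (changedExponent s h * ‖p.1‖ ^ (1 / s))) := by ring
        _ ≤ (N * (C * D * J)) * (C' * (Real.exp (-(ρ / 2) * ‖p.1‖ ^ 2)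
            * Real.exp (-ρ * ‖p.2‖ ^ 2))) := by gcongr
        _ = _ := by ring
  have eF : ∀ p : RSpace d × RSpace d, stftIntegral φ u p.1 p.2 * Ψ (joinPoint p.1 p.2)
      = (fourierConst d : ℂ) * ∫ y, K (p, y) := by
    intro p
    simp only [hK]
    rw [stftIntegral, integral_mul_const]; ring
  refine ⟨?_, stftTranspose_mem_gelfandShilov hφ hφi hΨ, ?_⟩
  · simp only [eF]
    exact hKi.integral_prod_left.const_mul _
  · rw [(hfu _).2]
    simp only [eF]
    rw [integral_const_mul, ← integral_integral_swap (f := fun y p => K (p, y)) hKi.swap,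
      ← integral_const_mul]
    congr 1
    funext y
    simp only [stftTranspose, hK]
    rw [mul_left_comm, ← integral_const_mul]
    congr 2
    funext p
    ring
-- Synthesis: from bounds on the transform to derivative bounds.
theorem PhaseBound.exists_nonneg {d : ℕ} {s h ε : ℝ} {F : RSpace d → RSpace d → ℂ}
    (hF : PhaseBound s h ε F) : ∃ C, 0 ≤ C ∧ ∀ x ξ : RSpace d,
      ‖F x ξ‖ ≤ C * Real.exp (h * ‖x‖ ^ (1 / s) - ε * ‖ξ‖ ^ (1 / s)) := by
  obtain ⟨C, hC⟩ := hF
  exact ⟨C, nonneg_of_mul_nonneg_left ((norm_nonneg _).trans (hC 0 0)) (Real.exp_pos _), hC⟩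

/-- The exponential is shared out among the coordinates, each receiving the rate `r / (d + 1)`, and
the one-variable estimate is applied to each factor. -/
theorem abs_monomialAt_mul_exp_le {d : ℕ} {s r : ℝ} (hs : 0 < s) (hr : 0 < r) (β : Fin d → ℕ)
    (ξ : RSpace d) : |monomialAt β ξ| * Real.exp (-r * ‖ξ‖ ^ (1 / s))
      ≤ ((s / (r / (d + 1))) ^ s) ^ multiLength β * (multiFactorial β : ℝ) ^ s := by
  set r₁ := r / (d + 1) with hr₁
  have hr₁0 : 0 < r₁ := by positivity
  have h1 : Real.exp (-r * ‖ξ‖ ^ (1 / s)) ≤ ∏ i, Real.exp (-r₁ * |ξ i| ^ (1 / s)) := by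
    rw [← Real.exp_sum, Real.exp_le_exp, ← Finset.mul_sum]
    have h2 : ∑ i, |ξ i| ^ (1 / s) ≤ (d + 1) * ‖ξ‖ ^ (1 / s) := by
      calc ∑ i, |ξ i| ^ (1 / s) ≤ ∑ _i : Fin d, ‖ξ‖ ^ (1 / s) :=
            Finset.sum_le_sum fun i _ => Real.rpow_le_rpow (abs_nonneg _)
              (PiLp.norm_apply_le ξ i) (one_div_pos.2 hs).le
        _ = d * ‖ξ‖ ^ (1 / s) := by simp
        _ ≤ _ := by
          have : 0 ≤ ‖ξ‖ ^ (1 / s) := by positivity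
          linarith
    have h3 : r = r₁ * (d + 1) := by rw [hr₁]; field_simp
    have := mul_le_mul_of_nonneg_left h2 hr₁0.le
    rw [← mul_assoc, ← h3] at this
    linarith
  calc |monomialAt β ξ| * Real.exp (-r * ‖ξ‖ ^ (1 / s))
      ≤ |monomialAt β ξ| * ∏ i, Real.exp (-r₁ * |ξ i| ^ (1 / s)) := by gcongr
    _ = ∏ i, (|ξ i| ^ β i * Real.exp (-r₁ * |ξ i| ^ (1 / s))) := by
        rw [Finset.prod_mul_distrib, monomialAt, Finset.abs_prod]
        simp only [abs_pow]
    _ ≤ ∏ i, (((s / r₁) ^ s) ^ β i * ((β i).factorial : ℝ) ^ s) :=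
        Finset.prod_le_prod (fun i _ => by positivity) fun i _ =>
          pow_mul_exp_neg_rpow_le hs hr₁0 (abs_nonneg _) (β i)
    _ = _ := by
        rw [Finset.prod_mul_distrib, Finset.prod_pow_eq_pow_sum]
        congr 1
        simp only [multiFactorial, Nat.cast_prod]
        exact Real.finsetProd_rpow _ _ (fun i _ => by positivity) _

/-- The integrand of the synthesis operator, after differentiations in `y`. -/
noncomputable def synthKernel {d : ℕ} (F : RSpace d → RSpace d → ℂ) (ψ : RSpace d → ℂ)
    (β γ : Fin d → ℕ) (y : RSpace d) (p : RSpace d × RSpace d) : ℂ :=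
  F p.1 p.2 * (Complex.I ^ multiLength β * (monomialAt β p.2 : ℂ)) * multiDeriv γ ψ (y - p.1)
    * charNeg y (-p.2)

/-- The synthesis operator `y ↦ ∬ F(x,ξ) (iξ)^β ∂^γ ψ(y-x) e^{i⟨y,ξ⟩} dx dξ`. -/
noncomputable def synth {d : ℕ} (F : RSpace d → RSpace d → ℂ) (ψ : RSpace d → ℂ)
    (β γ : Fin d → ℕ) (y : RSpace d) : ℂ :=
  ∫ p : RSpace d × RSpace d, synthKernel F ψ β γ y p

theorem continuous_synthKernel {d : ℕ} {F : RSpace d → RSpace d → ℂ} {ψ : RSpace d → ℂ}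
    (hF : Continuous (fun p : RSpace d × RSpace d => F p.1 p.2)) (hψ : ContDiff ℝ ∞ ψ)
    (β γ : Fin d → ℕ) :
    Continuous (fun q : RSpace d × (RSpace d × RSpace d) => synthKernel F ψ β γ q.1 q.2) := by
  unfold synthKernel
  refine (((hF.comp continuous_snd).mul (continuous_const.mul
    ((monomialAt_contDiff β).continuous.comp continuous_snd.snd))).mul
    ((multiDeriv_contDiff γ hψ).continuous.comp (continuous_fst.sub continuous_snd.fst))).mul ?_
  exact continuous_charNeg continuous_fst continuous_snd.snd.neg

/-- The constant in the bound of the synthesis kernel. -/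
noncomputable def synthConst {d : ℕ} (s σ k : ℝ) (β γ : Fin d → ℕ) : ℝ :=
  (σ ^ multiLength β * (multiFactorial β : ℝ) ^ s) * (k ^ multiLength γ
    * (multiFactorial γ : ℝ) ^ s)

/-- Half of the decay in `ξ` pays for the monomial `ξ^β`, the other half is kept for integrability.
The growth of `F` in `x` is moved to `y` at the expense of the decay of `ψ`. -/
theorem exists_norm_synthKernel_le {d : ℕ} {s h ε k r : ℝ} {F : RSpace d → RSpace d → ℂ}
    {ψ : RSpace d → ℂ} (hs : 0 < s) (hε : 0 < ε) (hk : 0 < k) (hF : PhaseBound s h ε F)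
    (hψ : WindowBound s k r ψ) :
    ∃ A, 0 ≤ A ∧ ∀ (β γ : Fin d → ℕ) (y : RSpace d) (p : RSpace d × RSpace d),
      ‖synthKernel F ψ β γ y p‖ ≤ A * synthConst s ((s / (ε / 2 / (d + 1))) ^ s) k β γ
        * Real.exp (changedExponent s h * ‖y‖ ^ (1 / s))
        * (Real.exp (-(r - |h| * kappa (1 / s)) * ‖p.1 - y‖ ^ (1 / s))
          * Real.exp (-(ε / 2) * ‖p.2‖ ^ (1 / s))) := by
  obtain ⟨C, hC, hCb⟩ := hF.exists_nonneg
  obtain ⟨D, hD, hDb⟩ := hψ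
  refine ⟨C * D, by positivity, fun β γ y p => ?_⟩
  set σ := (s / (ε / 2 / (d + 1))) ^ s with hσ
  have h1 := abs_monomialAt_mul_exp_le hs (half_pos hε) β p.2
  rw [← hσ] at h1
  have h2 := exp_mul_exp_shift_le hs h r y (p.1 - y)
  rw [add_sub_cancel] at h2
  have h3 := hDb γ (y - p.1)
  rw [norm_sub_rev] at h3
  unfold synthKernel synthConst
  rw [norm_mul, norm_mul, norm_mul, norm_mul, norm_charNeg, norm_pow, Complex.norm_I, one_pow,
    one_mul, mul_one, Complex.norm_real, Real.norm_eq_abs]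
  have h4 : Real.exp (h * ‖p.1‖ ^ (1 / s) - ε * ‖p.2‖ ^ (1 / s))
      = Real.exp (h * ‖p.1‖ ^ (1 / s)) * (Real.exp (-(ε / 2) * ‖p.2‖ ^ (1 / s))
        * Real.exp (-(ε / 2) * ‖p.2‖ ^ (1 / s))) := by
    rw [← Real.exp_add, ← Real.exp_add]; congr 1; ring
  set e := Real.exp (-(ε / 2) * ‖p.2‖ ^ (1 / s)) with he
  set G := k ^ multiLength γ * (multiFactorial γ : ℝ) ^ s with hG
  have hG0 : 0 ≤ G := by positivity
  have hσ0 : 0 ≤ σ := by positivity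
  calc ‖F p.1 p.2‖ * |monomialAt β p.2| * ‖multiDeriv γ ψ (y - p.1)‖
      ≤ (C * (Real.exp (h * ‖p.1‖ ^ (1 / s)) * (e * e))) * |monomialAt β p.2|
        * (D * (G * Real.exp (-r * ‖p.1 - y‖ ^ (1 / s)))) := by
        gcongr
        rw [← h4]; exact hCb _ _
    _ = C * D * (|monomialAt β p.2| * e) * G * (Real.exp (h * ‖p.1‖ ^ (1 / s))
        * Real.exp (-r * ‖p.1 - y‖ ^ (1 / s))) * e := by ring
    _ ≤ C * D * (σ ^ multiLength β * (multiFactorial β : ℝ) ^ s) * G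
        * (Real.exp (changedExponent s h * ‖y‖ ^ (1 / s))
          * Real.exp (-(r - |h| * kappa (1 / s)) * ‖p.1 - y‖ ^ (1 / s))) * e := by gcongr
    _ = _ := by ring

theorem integrable_synth_bound {d : ℕ} {s a b : ℝ} (hs : 0 < s) (ha : 0 < a) (hb : 0 < b)
    (y : RSpace d) : Integrable (fun p : RSpace d × RSpace d =>
      Real.exp (-a * ‖p.1 - y‖ ^ (1 / s)) * Real.exp (-b * ‖p.2‖ ^ (1 / s))) :=
  ((integrable_exp_neg_mul_norm_rpow d ha (one_div_pos.2 hs)).comp_sub_right y).mul_prod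
    (integrable_exp_neg_mul_norm_rpow d hb (one_div_pos.2 hs))

theorem integral_synth_bound {d : ℕ} (s a b : ℝ) (y : RSpace d) :
    ∫ p : RSpace d × RSpace d,
        Real.exp (-a * ‖p.1 - y‖ ^ (1 / s)) * Real.exp (-b * ‖p.2‖ ^ (1 / s))
      = (∫ x : RSpace d, Real.exp (-a * ‖x‖ ^ (1 / s)))
        * ∫ ξ : RSpace d, Real.exp (-b * ‖ξ‖ ^ (1 / s)) := by
  rw [Measure.volume_eq_prod, integral_prod_mul (fun x : RSpace d =>
    Real.exp (-a * ‖x - y‖ ^ (1 / s))) (fun ξ : RSpace d => Real.exp (-b * ‖ξ‖ ^ (1 / s))),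
    integral_sub_right_eq_self (fun x : RSpace d => Real.exp (-a * ‖x‖ ^ (1 / s))) y]

theorem integrable_synthKernel {d : ℕ} {s h ε k r : ℝ} {F : RSpace d → RSpace d → ℂ}
    {ψ : RSpace d → ℂ} (hs : 0 < s) (hε : 0 < ε) (hk : 0 < k) (hr : |h| * kappa (1 / s) < r)
    (hFc : Continuous (fun p : RSpace d × RSpace d => F p.1 p.2)) (hψs : ContDiff ℝ ∞ ψ)
    (hF : PhaseBound s h ε F) (hψ : WindowBound s k r ψ) (β γ : Fin d → ℕ) (y : RSpace d) :
    Integrable (synthKernel F ψ β γ y) := by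
  obtain ⟨A, hA, hAb⟩ := exists_norm_synthKernel_le hs hε hk hF hψ
  exact ((integrable_synth_bound hs (sub_pos.2 hr) (half_pos hε) y).const_mul _).mono'
    ((continuous_synthKernel hFc hψs β γ).comp
      (continuous_const.prodMk continuous_id)).aestronglyMeasurable
    (Filter.Eventually.of_forall (hAb β γ y))

theorem exists_nonneg_upper_bound {ι : Type*} [Fintype ι] (T : ι → ℝ) :
    ∃ S, 0 ≤ S ∧ ∀ j, T j ≤ S :=
  ⟨∑ j, |T j|, Finset.sum_nonneg fun _ _ => abs_nonneg _, fun j => (le_abs_self _).trans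
    (Finset.single_le_sum (f := fun j => |T j|) (fun _ _ => abs_nonneg _) (Finset.mem_univ j))⟩

/-- Provides a dominating function uniform for `y` in the unit ball about `y₀`. Recentring at `y₀`
divides the rate by `κ(1/s)` and costs the constant `e^a`. -/
theorem exp_mul_exp_le_of_norm_sub_lt {d : ℕ} {s a : ℝ} (hs : 0 < s) (ha0 : 0 < a) (b : ℝ)
    {y y₀ : RSpace d} (hy : ‖y - y₀‖ < 1) (x : RSpace d) :
    Real.exp (b * ‖y‖ ^ (1 / s)) * Real.exp (-a * ‖x - y‖ ^ (1 / s))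
      ≤ Real.exp (|b| * (‖y₀‖ + 1) ^ (1 / s)) * Real.exp a
        * Real.exp (-(a / kappa (1 / s)) * ‖x - y₀‖ ^ (1 / s)) := by
  have hp : 0 < 1 / s := one_div_pos.2 hs
  have hκ := kappa_pos (1 / s)
  rw [mul_assoc]
  refine mul_le_mul (Real.exp_le_exp.2 ?_) ?_ (Real.exp_pos _).le (Real.exp_pos _).le
  · have h2 : ‖y‖ ≤ ‖y₀‖ + 1 := by
      have := norm_add_le y₀ (y - y₀)
      rw [add_sub_cancel] at this
      linarith
    exact mul_le_mul (le_abs_self _) (Real.rpow_le_rpow (norm_nonneg _) h2 hp.le)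
      (by positivity) (abs_nonneg _)
  · rw [← Real.exp_add, Real.exp_le_exp]
    have h4 := norm_add_rpow_le hp.le (x - y) (y - y₀)
    rw [sub_add_sub_cancel] at h4
    have h5 : ‖y - y₀‖ ^ (1 / s) ≤ 1 := Real.rpow_le_one (norm_nonneg _) hy.le hp.le
    have h6 : ‖x - y₀‖ ^ (1 / s) / kappa (1 / s) ≤ ‖x - y‖ ^ (1 / s) + 1 := by
      rw [div_le_iff₀ hκ]
      have := mul_le_mul_of_nonneg_left h5 hκ.le
      linarith
    have h7 := mul_le_mul_of_nonneg_left h6 ha0.le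
    have e : -(a / kappa (1 / s)) * ‖x - y₀‖ ^ (1 / s)
        = -(a * (‖x - y₀‖ ^ (1 / s) / kappa (1 / s))) := by ring
    rw [e]; linarith

/-- A derivative falls either on the character, adding a factor `iξ_j`, or on `ψ`. Tracking both
multi-indices keeps the family closed, which gives smoothness and the derivative bounds. -/
theorem partialDeriv_synth {d : ℕ} {s h ε k r : ℝ} {F : RSpace d → RSpace d → ℂ}
    {ψ : RSpace d → ℂ} (hs : 0 < s) (hε : 0 < ε) (hk : 0 < k) (hr : |h| * kappa (1 / s) < r)
    (hFc : Continuous (fun p : RSpace d × RSpace d => F p.1 p.2)) (hψs : ContDiff ℝ ∞ ψ)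
    (hF : PhaseBound s h ε F) (hψ : WindowBound s k r ψ) (β γ : Fin d → ℕ) :
    Differentiable ℝ (synth F ψ β γ) ∧ ∀ j, partialDeriv j (synth F ψ β γ)
      = (1 : ℂ) • synth F ψ (β + Pi.single j 1) γ + (1 : ℂ) • synth F ψ β (γ + Pi.single j 1) := by
  have hi := integrable_synthKernel hs hε hk hr hFc hψs hF hψ
  obtain ⟨A, hA, hAb⟩ := exists_norm_synthKernel_le hs hε hk hF hψ
  set σ := (s / (ε / 2 / (d + 1))) ^ s with hσ
  have hσ0 : 0 ≤ σ := by positivity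
  set a := r - |h| * kappa (1 / s) with ha
  have ha0 : 0 < a := sub_pos.2 hr
  have hp : 0 < 1 / s := one_div_pos.2 hs
  have hκ := kappa_pos (1 / s)
  have dψ : ∀ (p : RSpace d × RSpace d) y,
      DifferentiableAt ℝ (fun y => multiDeriv γ ψ (y - p.1)) y := fun p y =>
    (((multiDeriv_contDiff γ hψs).differentiable (by simp)).comp (differentiable_id.sub_const _)) y
  have main := partialDeriv_integral (μ := (volume : Measure (RSpace d × RSpace d)))
    (K := synthKernel F ψ β γ)
    (K' := fun j y p => synthKernel F ψ (β + Pi.single j 1) γ y p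
      + synthKernel F ψ β (γ + Pi.single j 1) y p) ?_ ?_ ?_ (hi β γ) ?_
  · refine ⟨main.1, fun j => funext fun y => ?_⟩
    refine (main.2 j y).trans ?_
    rw [integral_add (hi _ _ y) (hi _ _ y)]
    simp [synth]
  · exact fun p y => ((dψ p y).const_mul _).mul (charNeg_differentiable _ y)
  · intro j y p
    unfold synthKernel
    rw [partialDeriv_mul j y ((dψ p y).const_mul _) (charNeg_differentiable _ y),
      partialDeriv_mul j y (differentiableAt_const _) (dψ p y), partialDeriv_charNeg,
      partialDeriv_comp_sub, multiDeriv_add_single γ j hψs, multiLength_add, multiLength_single,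
      monomialAt_add, monomialAt_single]
    simp [partialDeriv]
    ring
  · exact fun j y => ((hi _ _ y).add (hi _ _ y)).aestronglyMeasurable
  · intro y₀
    obtain ⟨S, hS0, hS⟩ := exists_nonneg_upper_bound (fun j : Fin d =>
      synthConst s σ k (β + Pi.single j 1) γ + synthConst s σ k β (γ + Pi.single j 1))
    refine ⟨fun p => (A * S * (Real.exp (|changedExponent s h| * (‖y₀‖ + 1) ^ (1 / s))
      * Real.exp a)) * (Real.exp (-(a / kappa (1 / s))
      * ‖p.1 - y₀‖ ^ (1 / s)) * Real.exp (-(ε / 2) * ‖p.2‖ ^ (1 / s))),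
      (integrable_synth_bound hs (div_pos ha0 hκ) (half_pos hε) y₀).const_mul _,
      fun y hy j p => ?_⟩
    rw [Metric.mem_ball, dist_eq_norm] at hy
    refine (norm_add_le _ _).trans ((add_le_add (hAb _ _ y p) (hAb _ _ y p)).trans ?_)
    have h8 := hS j
    have h9 := exp_mul_exp_le_of_norm_sub_lt hs ha0 (changedExponent s h) hy p.1
    have h10 := mul_le_mul (mul_le_mul_of_nonneg_left h8 hA) h9
      (mul_nonneg (Real.exp_pos _).le (Real.exp_pos _).le) (mul_nonneg hA hS0)
    have h11 := mul_le_mul_of_nonneg_right h10 (Real.exp_pos (-(ε / 2) * ‖p.2‖ ^ (1 / s))).le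
    refine le_trans (le_of_eq ?_) (h11.trans (le_of_eq ?_)) <;> ring

theorem synth_contDiff {d : ℕ} {s h ε k r : ℝ} {F : RSpace d → RSpace d → ℂ}
    {ψ : RSpace d → ℂ} (hs : 0 < s) (hε : 0 < ε) (hk : 0 < k) (hr : |h| * kappa (1 / s) < r)
    (hFc : Continuous (fun p : RSpace d × RSpace d => F p.1 p.2)) (hψs : ContDiff ℝ ∞ ψ)
    (hF : PhaseBound s h ε F) (hψ : WindowBound s k r ψ) (β γ : Fin d → ℕ) :
    ContDiff ℝ ∞ (synth F ψ β γ) := by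
  have hp := partialDeriv_synth hs hε hk hr hFc hψs hF hψ
  refine contDiff_of_partialDeriv_mem_span (S := {g | ∃ β γ, g = synth F ψ β γ}) ?_ ?_
    ⟨β, γ, rfl⟩
  · rintro g ⟨β, γ, rfl⟩
    exact (hp β γ).1
  · rintro g ⟨β, γ, rfl⟩ j
    refine ⟨2, fun _ => 1, ![synth F ψ (β + Pi.single j 1) γ, synth F ψ β (γ + Pi.single j 1)],
      fun i => ?_, ?_⟩
    · fin_cases i
      · exact ⟨_, _, rfl⟩
      · exact ⟨_, _, rfl⟩
    · rw [(hp β γ).2 j, Fin.sum_univ_two]; rfl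

theorem exists_integral_norm_synthKernel_le {d : ℕ} {s h ε k r : ℝ}
    {F : RSpace d → RSpace d → ℂ} {ψ : RSpace d → ℂ} (hs : 0 < s) (hε : 0 < ε) (hk : 0 < k)
    (hr : |h| * kappa (1 / s) < r)
    (hFc : Continuous (fun p : RSpace d × RSpace d => F p.1 p.2)) (hψs : ContDiff ℝ ∞ ψ)
    (hF : PhaseBound s h ε F) (hψ : WindowBound s k r ψ) :
    ∃ A, 0 ≤ A ∧ ∀ (β γ : Fin d → ℕ) (y : RSpace d), ∫ p, ‖synthKernel F ψ β γ y p‖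
      ≤ A * synthConst s ((s / (ε / 2 / (d + 1))) ^ s) k β γ
        * Real.exp (changedExponent s h * ‖y‖ ^ (1 / s)) := by
  have hi := integrable_synthKernel hs hε hk hr hFc hψs hF hψ
  obtain ⟨A, hA, hAb⟩ := exists_norm_synthKernel_le hs hε hk hF hψ
  set a := r - |h| * kappa (1 / s) with ha
  set J := (∫ x : RSpace d, Real.exp (-a * ‖x‖ ^ (1 / s)))
    * ∫ ξ : RSpace d, Real.exp (-(ε / 2) * ‖ξ‖ ^ (1 / s)) with hJ
  have hJ0 : 0 ≤ J := mul_nonneg (integral_nonneg fun _ => (Real.exp_pos _).le)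
    (integral_nonneg fun _ => (Real.exp_pos _).le)
  refine ⟨A * J, by positivity, fun β γ y => ?_⟩
  refine (integral_mono (hi β γ y).norm ((integrable_synth_bound hs (sub_pos.2 hr)
    (half_pos hε) y).const_mul _) (hAb β γ y)).trans (le_of_eq ?_)
  rw [integral_const_mul, integral_synth_bound, ← ha, ← hJ]; ring

/-- The derivative of order `α` consists of `2^{|α|}` terms with `β + γ = α`, each bounded by
`ρ^{|α|} (α!)^s` because `β! γ! ≤ (β + γ)!`; hence the rate `2ρ`. -/
theorem derivBound_synth {d : ℕ} {s h ε k r : ℝ} {F : RSpace d → RSpace d → ℂ}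
    {ψ : RSpace d → ℂ} (hs : 0 < s) (hε : 0 < ε) (hk : 0 < k) (hr : |h| * kappa (1 / s) < r)
    (hFc : Continuous (fun p : RSpace d × RSpace d => F p.1 p.2)) (hψs : ContDiff ℝ ∞ ψ)
    (hF : PhaseBound s h ε F) (hψ : WindowBound s k r ψ) (c : ℂ) :
    DerivBound s (changedExponent s h) (2 * max ((s / (ε / 2 / (d + 1))) ^ s) k)
      (c • synth F ψ 0 0) := by
  obtain ⟨A, hA, hAb⟩ := exists_integral_norm_synthKernel_le hs hε hk hr hFc hψs hF hψ
  have hsm := synth_contDiff hs hε hk hr hFc hψs hF hψ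
  have hpd := fun β γ => (partialDeriv_synth hs hε hk hr hFc hψs hF hψ β γ).2
  set σ := (s / (ε / 2 / (d + 1))) ^ s with hσ
  have hσ0 : 0 < σ := by positivity
  set ρ := max σ k with hρ
  have hρ0 : 0 < ρ := lt_max_of_lt_left hσ0
  have key : ∀ (α β γ : Fin d → ℕ) (y : RSpace d), ‖multiDeriv α (synth F ψ β γ) y‖
      ≤ 2 ^ multiLength α * (A * (ρ ^ (multiLength (α + β + γ))
        * (multiFactorial (α + β + γ) : ℝ) ^ s)
        * Real.exp (changedExponent s h * ‖y‖ ^ (1 / s))) := by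
    intro α
    induction α using multiIndex_induction with
    | h0 =>
      intro β γ y
      rw [multiDeriv_zero, multiLength_zero, pow_zero, one_mul, zero_add]
      refine (norm_integral_le_integral_norm _).trans ((hAb β γ y).trans ?_)
      have h1 : σ ^ multiLength β * k ^ multiLength γ ≤ ρ ^ multiLength (β + γ) := by
        rw [multiLength_add, pow_add]
        gcongr
        · exact le_max_left _ _
        · exact le_max_right _ _
      have h2 : (multiFactorial β : ℝ) ^ s * (multiFactorial γ : ℝ) ^ s
          ≤ (multiFactorial (β + γ) : ℝ) ^ s := by
        rw [← Real.mul_rpow (by positivity) (by positivity)]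
        gcongr
        exact_mod_cast multiFactorial_mul_le_add β γ
      have h3 : synthConst s σ k β γ
          ≤ ρ ^ multiLength (β + γ) * (multiFactorial (β + γ) : ℝ) ^ s := by
        unfold synthConst
        calc _ = (σ ^ multiLength β * k ^ multiLength γ) * ((multiFactorial β : ℝ) ^ s
              * (multiFactorial γ : ℝ) ^ s) := by ring
          _ ≤ _ := by gcongr
      gcongr
    | hs α j ih =>
      intro β γ y
      rw [multiDeriv_add_single α j (hsm β γ), ← multiDeriv_partialDeriv α j (hsm β γ), hpd,
        multiDeriv_combo α 1 1 (hsm _ _) (hsm _ _)]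
      simp only [Pi.add_apply, one_smul]
      refine (norm_add_le _ _).trans ?_
      have h1 := ih (β + Pi.single j 1) γ y
      have h2 := ih β (γ + Pi.single j 1) y
      have e1 : α + (β + Pi.single j 1) + γ = α + Pi.single j 1 + β + γ := by abel
      have e2 : α + β + (γ + Pi.single j 1) = α + Pi.single j 1 + β + γ := by abel
      rw [e1] at h1
      rw [e2] at h2
      have e3 : multiLength (α + Pi.single j 1) = multiLength α + 1 := by
        rw [multiLength_add, multiLength_single]
      rw [e3, pow_succ]
      linarith
  refine ⟨‖c‖ * A, fun α x => ?_⟩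
  have h1 := key α 0 0 x
  rw [add_zero, add_zero] at h1
  have e : multiDeriv α (c • synth F ψ 0 0) = c • multiDeriv α (synth F ψ 0 0) := by
    simpa using multiDeriv_combo α c 0 (hsm 0 0) (hsm 0 0)
  rw [e, Pi.smul_apply, norm_smul]
  calc _ ≤ ‖c‖ * (2 ^ multiLength α * (A * (ρ ^ multiLength α * (multiFactorial α : ℝ) ^ s)
        * Real.exp (changedExponent s h * ‖x‖ ^ (1 / s)))) := by gcongr
    _ = _ := by rw [mul_pow]; ring

/-- Growth in `x` of order at most that of every Gaussian, together with decay in `ξ`. -/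
def PhaseSubGaussian {d : ℕ} (s r : ℝ) (F : RSpace d → RSpace d → ℂ) : Prop :=
  ∀ c > 0, ∃ h : ℝ, ∃ ε > 0, |h| * kappa (1 / s) < r ∧ PhaseBound s h ε F ∧
    ∃ C', 0 ≤ C' ∧ ∀ t : ℝ, 0 ≤ t →
      Real.exp (changedExponent s h * t ^ (1 / s)) ≤ C' * Real.exp (c * t ^ 2)

/-- Reconstruction of a distribution from its short-time Fourier transform. -/
theorem eqFun_synth {d : ℕ} {s k r : ℝ} {F : RSpace d → RSpace d → ℂ} {φ ψ : RSpace d → ℂ}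
    {f : GSDistribution d} (hs : 0 < s) (hk : 0 < k) (hφ : Continuous φ) (hφi : Integrable φ)
    (hψ : ψ ∈ gelfandShilov d (1 / 2)) (hψb : WindowBound s k r ψ)
    (hF : IsSTFT φ f F) (hgrow : PhaseSubGaussian s r F)
    (hne : ∫ z, (starRingEnd ℂ) (φ z) * ψ z ≠ 0) :
    f.EqFun (((∫ z, (starRingEnd ℂ) (φ z) * ψ z)⁻¹ * (fourierConst d : ℂ)) • synth F ψ 0 0) := by
  set a := ∫ z, (starRingEnd ℂ) (φ z) * ψ z with ha
  intro χ
  obtain ⟨hFc, hFΨ⟩ := hF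
  have hψs : ContDiff ℝ ∞ ψ := hψ.1
  have wχ := wordBounded_of_mem_gelfandShilov χ.2
  obtain ⟨ρ, hρ, N, hN, hNb⟩ := norm_le_gaussian_of_mem_gelfandShilov χ.2
  -- As in the direct transform, the exponent may depend on the Gaussian rate of the test function.
  obtain ⟨h, ε, hε, hr, hFb, C', hC', hexp⟩ := hgrow (ρ / 2) (by positivity)
  have hi := integrable_synthKernel hs hε hk hr hFc hψs hFb hψb
  obtain ⟨A, hA, hAb⟩ := exists_integral_norm_synthKernel_le hs hε hk hr hFc hψs hFb hψb
  set B := A * synthConst s ((s / (ε / 2 / (d + 1))) ^ s) k (0 : Fin d → ℕ) 0 with hB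
  have hB0 : 0 ≤ B := by rw [hB, synthConst]; positivity
  set K : RSpace d × (RSpace d × RSpace d) → ℂ := fun q =>
    (χ : RSpace d → ℂ) q.1 * synthKernel F ψ 0 0 q.1 q.2 with hK
  have hKc : Continuous K :=
    (wχ.continuous.comp continuous_fst).mul (continuous_synthKernel hFc hψs 0 0)
  have hKi : Integrable K ((volume : Measure (RSpace d)).prod volume) := by
    rw [integrable_prod_iff hKc.aestronglyMeasurable]
    constructor
    · exact Filter.Eventually.of_forall fun y => (hi 0 0 y).const_mul ((χ : RSpace d → ℂ) y)
    · have hg := (integrable_exp_neg_mul_norm_rpow d (half_pos hρ) two_pos).const_mul (N * B * C')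
      refine hg.mono' hKc.norm.aestronglyMeasurable.integral_prod_right'
        (Filter.Eventually.of_forall fun y => ?_)
      simp only [hK, norm_mul]
      rw [integral_const_mul, norm_mul, norm_norm, Real.norm_of_nonneg
        (integral_nonneg fun p => norm_nonneg _)]
      have e2 : ‖y‖ ^ (2 : ℝ) = ‖y‖ ^ 2 := by norm_num
      rw [e2]
      calc _ ≤ (N * Real.exp (-ρ * ‖y‖ ^ 2))
            * (B * Real.exp (changedExponent s h * ‖y‖ ^ (1 / s))) :=
            mul_le_mul (hNb y) (hAb 0 0 y) (integral_nonneg fun p => norm_nonneg _)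
              (by positivity)
        _ ≤ (N * Real.exp (-ρ * ‖y‖ ^ 2)) * (B * (C' * Real.exp (ρ / 2 * ‖y‖ ^ 2))) := by
            gcongr; exact hexp _ (norm_nonneg _)
        _ = N * B * C' * (Real.exp (-ρ * ‖y‖ ^ 2) * Real.exp (ρ / 2 * ‖y‖ ^ 2)) := by ring
        _ = _ := by rw [← Real.exp_add]; congr 2; ring
  have e1 : ∀ y, (χ : RSpace d → ℂ) y * synth F ψ 0 0 y = ∫ p, K (y, p) := by
    intro y
    simp only [hK]
    rw [integral_const_mul, synth]
  have hint : Integrable (fun y => (χ : RSpace d → ℂ) y * synth F ψ 0 0 y) := by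
    simp only [e1]
    exact hKi.integral_prod_left
  set c : ℂ := (fourierConst d : ℂ) with hc
  have eχ : ∀ y, ((a⁻¹ * c) • synth F ψ 0 0) y * (χ : RSpace d → ℂ) y
      = (a⁻¹ * c) * ((χ : RSpace d → ℂ) y * synth F ψ 0 0 y) := by
    intro y; simp only [Pi.smul_apply, smul_eq_mul]; ring
  simp only [eχ]
  refine ⟨hint.const_mul _, ?_⟩
  rw [integral_const_mul]
  -- The transpose of this test function is `a • χ`, so the duality expresses `a ⟨f, χ⟩` through
  -- `F`; after Fubini, dividing by `a` gives the synthesis formula.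
  obtain ⟨-, hg, hval⟩ := hFΨ (c • stftPair (χ : RSpace d → ℂ) ψ)
    (Submodule.smul_mem _ _ (stftPair_mem_gelfandShilov χ.2 hψ))
  have e3 : (⟨stftTranspose φ (c • stftPair (χ : RSpace d → ℂ) ψ), hg⟩ :
      gelfandShilov d (1 / 2)) = a • χ := by
    apply Subtype.ext
    exact stftTranspose_stftPair hφ hφi χ.2 hψ
  rw [e3, map_smul, smul_eq_mul] at hval
  have e4 : ∀ p : RSpace d × RSpace d, F p.1 p.2
      * (c • stftPair (χ : RSpace d → ℂ) ψ) (joinPoint p.1 p.2) = c * ∫ y, K (y, p) := by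
    intro p
    simp only [Pi.smul_apply, smul_eq_mul, stftPair, fstL_joinPoint, sndL_joinPoint]
    rw [mul_left_comm, ← integral_const_mul]
    congr 2
    funext y
    simp only [hK, synthKernel, multiLength_zero, monomialAt_zero, multiDeriv_zero]
    rw [charNeg_comm (-p.2)]
    push_cast; ring
  simp only [e4] at hval
  rw [integral_const_mul, ← integral_integral_swap (f := fun y p => K (y, p)) hKi] at hval
  simp only [← e1] at hval
  rw [mul_assoc, ← hval, inv_mul_cancel_left₀ hne]
-- Choice of the parameters and the equivalences.
theorem PhaseBound.mono {d : ℕ} {s h h' ε ε' : ℝ} {F : RSpace d → RSpace d → ℂ} (hh : h ≤ h')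
    (hε : ε' ≤ ε) (hF : PhaseBound s h ε F) : PhaseBound s h' ε' F := by
  obtain ⟨C, hC⟩ := hF
  have hC0 : 0 ≤ C := nonneg_of_mul_nonneg_left ((norm_nonneg _).trans (hC 0 0)) (Real.exp_pos _)
  refine ⟨C, fun x ξ => (hC x ξ).trans ?_⟩
  gcongr

theorem DerivBound.mono {d : ℕ} {s h h' ε ε' : ℝ} {u : RSpace d → ℂ} (hh : h ≤ h')
    (hε0 : 0 ≤ ε) (hε : ε ≤ ε') (hu : DerivBound s h ε u) : DerivBound s h' ε' u := by
  obtain ⟨C, hC, hb⟩ := hu.exists_nonneg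
  have : 0 ≤ ε' := hε0.trans hε
  refine ⟨C, fun α x => (hb α x).trans ?_⟩
  gcongr

theorem DerivBound.exists_norm_le {d : ℕ} {s h ε : ℝ} {u : RSpace d → ℂ}
    (hu : DerivBound s h ε u) :
    ∃ C, 0 ≤ C ∧ ∀ x, ‖u x‖ ≤ C * Real.exp (h * ‖x‖ ^ (1 / s)) := by
  obtain ⟨C, hC, hb⟩ := hu.exists_nonneg
  refine ⟨C, hC, fun x => ?_⟩
  simpa [multiLength_zero, multiFactorial_zero, multiDeriv_zero] using hb 0 x

theorem changedExponent_pos {s h : ℝ} (hh : 0 < h) : 0 < changedExponent s h := by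
  rw [changedExponent, if_pos hh.le]
  exact mul_pos (kappa_pos _) hh

/-- Integrability of the integrand of the short-time Fourier transform. -/
theorem integrable_stft_integrand {d : ℕ} {s h ε k r : ℝ} {φ u : RSpace d → ℂ} (hs : 0 < s)
    (hr : |h| * kappa (1 / s) < r) (hu : ContDiff ℝ ∞ u) (hφ : ContDiff ℝ ∞ φ)
    (hub : DerivBound s h ε u) (hφb : WindowBound s k r φ) (x ξ : RSpace d) :
    Integrable (fun y => u y * (starRingEnd ℂ) (φ (y - x)) * charNeg y ξ) := by
  obtain ⟨C, hC, hCb⟩ := hub.exists_norm_le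
  obtain ⟨D, -, hDb⟩ := hφb.norm_le
  exact Integrable.mul_charNeg (integrable_mul_translate (θ := fun z => (starRingEnd ℂ) (φ z)) hs
    hr hC hu.continuous (Complex.continuous_conj.comp hφ.continuous) hCb
    (fun y => by rw [RCLike.norm_conj]; exact hDb y) x).1 ξ

theorem exists_exp_changedExponent_le {s : ℝ} (hs : 1 / 2 < s) (h : ℝ) {c : ℝ} (hc : 0 < c) :
    ∃ C', 0 ≤ C' ∧ ∀ t : ℝ, 0 ≤ t →
      Real.exp (changedExponent s h * t ^ (1 / s)) ≤ C' * Real.exp (c * t ^ 2) := by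
  have hs0 : 0 < s := by linarith
  exact exp_mul_rpow_le_exp_sq (by positivity) (by rw [div_lt_iff₀ hs0]; linarith) _ hc

/-- Exponents small enough for every purpose, down to the critical case `s = 1/2`. -/
theorem exists_small_exponent {s : ℝ} (hs : 1 / 2 ≤ s) {r c δ : ℝ} (hr : 0 < r) (hc : 0 < c)
    (hδ : 0 < δ) : ∃ h > 0, |h| * kappa (1 / s) < r ∧ changedExponent s h ≤ δ ∧
      ∃ C', 0 ≤ C' ∧ ∀ t : ℝ, 0 ≤ t →
        Real.exp (changedExponent s h * t ^ (1 / s)) ≤ C' * Real.exp (c * t ^ 2) := by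
  have hκ := kappa_pos (1 / s)
  -- The exponent `h = m / κ(1/s)` has `h^* = m` exactly, so all the requirements become upper
  -- bounds on `m`.
  set m := min (r / 2) (min c δ) with hm
  have hm0 : 0 < m := lt_min (by positivity) (lt_min hc hδ)
  have hmr : m ≤ r / 2 := min_le_left _ _
  have hmc : m ≤ c := (min_le_right _ _).trans (min_le_left _ _)
  have hmδ : m ≤ δ := (min_le_right _ _).trans (min_le_right _ _)
  have h0 : 0 < m / kappa (1 / s) := by positivity
  have e : changedExponent s (m / kappa (1 / s)) = m := by
    rw [changedExponent, if_pos h0.le]; field_simp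
  refine ⟨m / kappa (1 / s), h0, ?_, e.trans_le hmδ, ?_⟩
  · rw [abs_of_pos h0, div_mul_cancel₀ _ hκ.ne']; linarith
  · rcases hs.eq_or_lt with rfl | hs
    · refine ⟨1, zero_le_one, fun t ht => ?_⟩
      rw [e, one_mul, Real.exp_le_exp]
      have : t ^ (1 / (1 / 2) : ℝ) = t ^ 2 := by norm_num
      rw [this]
      gcongr
    · exact exists_exp_changedExponent_le hs _ hc

/-- Every decay rate in `ξ` is attained by a suitable derivative rate `δ`, used for the function and
for the window alike. -/
theorem phase_decay_of_deriv_rate {s ε : ℝ} (d : ℕ) (hs : 0 < s) (hε : 0 < ε) :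
    ∃ δ > 0, s / (2 * ((d + 1) * (2 * max δ δ)) ^ (1 / s)) = ε := by
  refine ⟨(s / (2 * ε)) ^ s / (2 * (d + 1)), by positivity, ?_⟩
  have e : ((d : ℝ) + 1) * (2 * ((s / (2 * ε)) ^ s / (2 * (d + 1)))) = (s / (2 * ε)) ^ s := by
    field_simp
  rw [max_self, e, ← Real.rpow_mul (by positivity), mul_one_div_cancel hs.ne', Real.rpow_one]
  field_simp

/-- Conversely every derivative rate is attained by balancing the decay `δ` against the rate `k` of
the synthesis window. -/
theorem deriv_rate_of_phase_decay {s ε : ℝ} (d : ℕ) (hs : 0 < s) (hε : 0 < ε) :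
    ∃ δ > 0, ∃ k > 0, 2 * max ((s / (δ / 2 / (d + 1))) ^ s) k = ε := by
  refine ⟨2 * (d + 1) * s / (ε / 2) ^ (1 / s), by positivity, ε / 2, by positivity, ?_⟩
  have e : s / (2 * ((d : ℝ) + 1) * s / (ε / 2) ^ (1 / s) / 2 / (d + 1)) = (ε / 2) ^ (1 / s) := by
    field_simp
  rw [e, ← Real.rpow_mul (by positivity), one_div_mul_cancel hs.ne', Real.rpow_one, max_self]
  ring

theorem isSTFT_of_derivBound {d : ℕ} {s h ε : ℝ} {φ u : RSpace d → ℂ} {f : GSDistribution d}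
    (hs : 1 / 2 < s) (hφ : φ ∈ gelfandShilovBeurling d s) (hu : ContDiff ℝ ∞ u) (hfu : f.EqFun u)
    (hub : DerivBound s h ε u) :
    (∀ x ξ : RSpace d, Integrable (fun y => u y * (starRingEnd ℂ) (φ (y - x)) * charNeg y ξ)) ∧
      IsSTFT φ f (stftIntegral φ u) := by
  have hs0 : 0 < s := by linarith
  have hκ := kappa_pos (1 / s)
  have hw := windowBound_of_mem_gelfandShilovBeurling hs0 hφ one_pos (|h| * kappa (1 / s) + 1)
  refine ⟨integrable_stft_integrand hs0 (lt_add_one _) hu hφ.1 hub hw,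
    isSTFT_stftIntegral hs0 (by positivity) hu.continuous hφ.1.continuous hfu hw fun c hc => ?_⟩
  obtain ⟨C, hC, hCb⟩ := hub.exists_norm_le
  exact ⟨h, C, hC, lt_add_one _, hCb, exists_exp_changedExponent_le hs h hc⟩

theorem exists_phaseBound_of_derivBound {d : ℕ} {s h ε : ℝ} {φ u : RSpace d → ℂ}
    (hs : 1 / 2 < s) (hφ : φ ∈ gelfandShilovBeurling d s) (hu : ContDiff ℝ ∞ u)
    (hε : 0 < ε) (hub : DerivBound s h ε u) :
    ∃ ε > 0, PhaseBound s (changedExponent s h) ε (stftIntegral φ u) := by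
  have hs0 : 0 < s := by linarith
  exact ⟨_, by positivity, phaseBound_stftIntegral hs0 hε hε (lt_add_one _) hu hφ.1 hub
    (windowBound_of_mem_gelfandShilovBeurling hs0 hφ hε _)⟩

theorem phaseBound_of_forall_derivBound {d : ℕ} {s h : ℝ} {φ u : RSpace d → ℂ}
    (hs : 1 / 2 < s) (hφ : φ ∈ gelfandShilovBeurling d s) (hu : ContDiff ℝ ∞ u)
    (hub : ∀ ε > 0, DerivBound s h ε u) {ε : ℝ} (hε : 0 < ε) :
    PhaseBound s (changedExponent s h) ε (stftIntegral φ u) := by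
  have hs0 : 0 < s := by linarith
  obtain ⟨δ, hδ, rfl⟩ := phase_decay_of_deriv_rate d hs0 hε
  exact phaseBound_stftIntegral hs0 hδ hδ (lt_add_one _) hu hφ.1 (hub δ hδ)
    (windowBound_of_mem_gelfandShilovBeurling hs0 hφ hδ _)

/-- The representing function is built once and does not depend on the rates, so a single `u`
satisfies the bounds for every admissible `ε` and `k`. The window `φ` enters only through its
continuity, its integrability and a nonzero pairing with a Gaussian. -/
theorem exists_eqFun_of_phaseBound {d : ℕ} {s h ε₀ : ℝ} {φ : RSpace d → ℂ}
    {f : GSDistribution d} {F : RSpace d → RSpace d → ℂ} (hs : 1 / 2 < s)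
    (hφ : φ ∈ gelfandShilovBeurling d s) (h0 : φ ≠ 0) (hF : IsSTFT φ f F) (hε₀ : 0 < ε₀)
    (hFb : PhaseBound s h ε₀ F) :
    ∃ u : RSpace d → ℂ, ContDiff ℝ ∞ u ∧ f.EqFun u ∧ ∀ ε > 0, ∀ k > 0, PhaseBound s h ε F →
      DerivBound s (changedExponent s h) (2 * max ((s / (ε / 2 / (d + 1))) ^ s) k) u := by
  have hs0 : 0 < s := by linarith
  have hφi := (windowBound_of_mem_gelfandShilovBeurling hs0 hφ one_pos 1).integrable hs0 one_pos
    hφ.1.continuous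
  obtain ⟨c, hc, a, hne⟩ := exists_gaussianAt_integral_ne_zero hφ.1.continuous hφi h0
  have hψ := gaussianAt_mem_gelfandShilov hc a
  obtain ⟨k₀, hk₀, r₀, hr₀, hψ₀⟩ := windowBound_of_mem_gelfandShilov (by norm_num) hψ
  have hψb : ∀ k > 0, WindowBound s k (|h| * kappa (1 / s) + 1) (gaussianAt c a) := fun k hk =>
    hψ₀.of_half hs hk₀ hr₀ hk _
  have hf := eqFun_synth hs0 one_pos hφ.1.continuous hφi hψ (hψb 1 one_pos) hF
    (fun c hc => ⟨h, ε₀, hε₀, lt_add_one _, hFb, exists_exp_changedExponent_le hs h hc⟩) hne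
  have hu := synth_contDiff hs0 hε₀ one_pos (lt_add_one _) hF.1 hψ.1 hFb (hψb 1 one_pos) 0 0
  generalize (∫ z, (starRingEnd ℂ) (φ z) * gaussianAt c a z)⁻¹ * (fourierConst d : ℂ) = b at hf
  exact ⟨b • synth F (gaussianAt c a) 0 0, contDiff_const.smul hu, hf, fun ε hε k hk hb =>
    derivBound_synth hs0 hε hk (lt_add_one _) hF.1 hψ.1 hb (hψb k hk) b⟩

theorem exists_derivBound_of_phaseBound {d : ℕ} {s h ε : ℝ} {φ : RSpace d → ℂ}
    {f : GSDistribution d} {F : RSpace d → RSpace d → ℂ} (hs : 1 / 2 < s)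
    (hφ : φ ∈ gelfandShilovBeurling d s) (h0 : φ ≠ 0) (hF : IsSTFT φ f F) (hε : 0 < ε)
    (hFb : PhaseBound s h ε F) :
    ∃ u : RSpace d → ℂ, ContDiff ℝ ∞ u ∧ f.EqFun u ∧
      ∃ ε > 0, DerivBound s (changedExponent s h) ε u := by
  have hs0 : 0 < s := by linarith
  obtain ⟨u, hu, hfu, hb⟩ := exists_eqFun_of_phaseBound hs hφ h0 hF hε hFb
  exact ⟨u, hu, hfu, _, by positivity, hb ε hε 1 one_pos hFb⟩

theorem exists_derivBound_of_forall_phaseBound {d : ℕ} {s h : ℝ} {φ : RSpace d → ℂ}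
    {f : GSDistribution d} {F : RSpace d → RSpace d → ℂ} (hs : 1 / 2 < s)
    (hφ : φ ∈ gelfandShilovBeurling d s) (h0 : φ ≠ 0) (hF : IsSTFT φ f F)
    (hFb : ∀ ε > 0, PhaseBound s h ε F) :
    ∃ u : RSpace d → ℂ, ContDiff ℝ ∞ u ∧ f.EqFun u ∧
      ∀ ε > 0, DerivBound s (changedExponent s h) ε u := by
  have hs0 : 0 < s := by linarith
  obtain ⟨u, hu, hfu, hb⟩ := exists_eqFun_of_phaseBound hs hφ h0 hF one_pos (hFb 1 one_pos)
  refine ⟨u, hu, hfu, fun ε hε => ?_⟩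
  obtain ⟨δ, hδ, k, hk, rfl⟩ := deriv_rate_of_phase_decay d hs0 hε
  exact hb δ hδ k hk (hFb δ hδ)

/-- The window decays at one fixed rate only, so the growth exponent of `u` is chosen small against
it. The resulting decay in `ξ` depends on `ε` and `k` alone, hence is the same for every growth
exponent. -/
theorem exists_stft_of_mem_gammaInf {d : ℕ} {s : ℝ} {φ u : RSpace d → ℂ} {f : GSDistribution d}
    (hs : 1 / 2 ≤ s) (hφ : φ ∈ gelfandShilov d s) (hu : u ∈ gammaInf d s) (hfu : f.EqFun u) :
    ∃ F : RSpace d → RSpace d → ℂ, IsSTFT φ f F ∧ ∃ h > 0, ∀ ε > 0, PhaseBound s ε h F := by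
  have hs0 : 0 < s := by linarith
  obtain ⟨hus, ε, hε, hub⟩ := hu
  obtain ⟨k, hk, r, hr, hw⟩ := windowBound_of_mem_gelfandShilov hs0 hφ
  refine ⟨stftIntegral φ u, isSTFT_stftIntegral hs0 hr hus.continuous hφ.1.continuous hfu hw
    fun c hc => ?_, s / (2 * ((d + 1) * (2 * max ε k)) ^ (1 / s)), ?_, fun δ hδ => ?_⟩
  · obtain ⟨h, hh, hhr, -, hexp⟩ := exists_small_exponent hs hr hc one_pos
    obtain ⟨C, hC, hCb⟩ := (hub h hh).exists_norm_le
    exact ⟨h, C, hC, hhr, hCb, hexp⟩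
  · have : 0 < max ε k := lt_max_of_lt_left hε
    positivity
  · obtain ⟨h, hh, hhr, hhδ, -⟩ := exists_small_exponent hs hr one_pos hδ
    exact (phaseBound_stftIntegral hs0 hε hk hhr hus hφ.1 (hub h hh) hw).mono hhδ le_rfl

theorem exists_mem_gammaInf_of_stft {d : ℕ} {s ε : ℝ} {φ : RSpace d → ℂ} {f : GSDistribution d}
    {F : RSpace d → RSpace d → ℂ} (hs : 1 / 2 ≤ s) (hφ : φ ∈ gelfandShilov d s) (h0 : φ ≠ 0)
    (hF : IsSTFT φ f F) (hε : 0 < ε) (hFb : ∀ h > 0, PhaseBound s h ε F) :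
    ∃ u ∈ gammaInf d s, f.EqFun u := by
  have hs0 : 0 < s := by linarith
  obtain ⟨k₁, -, r₁, hr₁, hw⟩ := windowBound_of_mem_gelfandShilov hs0 hφ
  have hφi := hw.integrable hs0 hr₁ hφ.1.continuous
  obtain ⟨c, hc, a, hne⟩ := exists_gaussianAt_integral_ne_zero hφ.1.continuous hφi h0
  have hψ := gaussianAt_mem_gelfandShilov hc a
  -- At `s = 1/2` the Gaussian keeps its own rates; some positive rates are enough here.
  obtain ⟨k, hk, r, hr, hψb⟩ : ∃ k > 0, ∃ r > 0, WindowBound s k r (gaussianAt c a) := by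
    obtain ⟨k₀, hk₀, r₀, hr₀, hψ₀⟩ := windowBound_of_mem_gelfandShilov (by norm_num) hψ
    rcases hs.eq_or_lt with rfl | hs
    · exact ⟨k₀, hk₀, r₀, hr₀, hψ₀⟩
    · exact ⟨1, one_pos, 1, one_pos, hψ₀.of_half hs hk₀ hr₀ one_pos 1⟩
  obtain ⟨h₁, hh₁, hhr₁, -⟩ := exists_small_exponent hs hr one_pos one_pos
  have hf := eqFun_synth hs0 hk hφ.1.continuous hφi hψ hψb hF (fun c hc => by
    obtain ⟨h, hh, hhr, -, hexp⟩ := exists_small_exponent hs hr hc one_pos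
    exact ⟨h, ε, hε, hhr, hFb h hh, hexp⟩) hne
  have hu := synth_contDiff hs0 hε hk hhr₁ hF.1 hψ.1 (hFb h₁ hh₁) hψb 0 0
  generalize (∫ z, (starRingEnd ℂ) (φ z) * gaussianAt c a z)⁻¹ * (fourierConst d : ℂ) = b at hf
  -- This derivative rate does not involve `δ`, as `Γ^∞_s` requires one rate for all growth
  -- exponents.
  have hρ : 0 < 2 * max ((s / (ε / 2 / ((d : ℝ) + 1))) ^ s) k :=
    mul_pos two_pos (lt_max_of_lt_right hk)
  refine ⟨b • synth F (gaussianAt c a) 0 0, ⟨contDiff_const.smul hu, _, hρ, fun δ hδ => ?_⟩, hf⟩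
  obtain ⟨h, hh, hhr, hhδ, -⟩ := exists_small_exponent hs hr one_pos hδ
  exact (derivBound_synth hs0 hε hk hhr hF.1 hψ.1 (hFb h hh) hψb b).mono hhδ hρ.le le_rfl

theorem mainTheorem8 (d : ℕ) :
    -- derivative bounds and bounds on the short-time Fourier transform, with explicit exponents
    (∀ (s h : ℝ) (φ : RSpace d → ℂ) (f : GSDistribution d),
      1 / 2 < s → φ ∈ gelfandShilovBeurling d s → φ ≠ 0 →
      (∀ u : RSpace d → ℂ, ContDiff ℝ ∞ u → f.EqFun u →
        ((∀ ε > 0, DerivBound s h ε u) →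
          (∀ x ξ : RSpace d,
            Integrable (fun y => u y * (starRingEnd ℂ) (φ (y - x)) * charNeg y ξ)) ∧
          IsSTFT φ f (stftIntegral φ u) ∧
          ∀ ε > 0, PhaseBound s (changedExponent s h) ε (stftIntegral φ u)) ∧
        ((∃ ε > 0, DerivBound s h ε u) →
          (∀ x ξ : RSpace d,
            Integrable (fun y => u y * (starRingEnd ℂ) (φ (y - x)) * charNeg y ξ)) ∧
          IsSTFT φ f (stftIntegral φ u) ∧
          ∃ ε > 0, PhaseBound s (changedExponent s h) ε (stftIntegral φ u))) ∧
      (∀ F : RSpace d → RSpace d → ℂ, IsSTFT φ f F →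
        ((∀ ε > 0, PhaseBound s h ε F) →
          ∃ u : RSpace d → ℂ, ContDiff ℝ ∞ u ∧ f.EqFun u ∧
            ∀ ε > 0, DerivBound s (changedExponent s h) ε u) ∧
        ((∃ ε > 0, PhaseBound s h ε F) →
          ∃ u : RSpace d → ℂ, ContDiff ℝ ∞ u ∧ f.EqFun u ∧
            ∃ ε > 0, DerivBound s (changedExponent s h) ε u))) ∧
    -- the classes `Γ^∞_{0,s}` and `Γ^∞_{1,s}`
    (∀ (s : ℝ) (φ : RSpace d → ℂ) (f : GSDistribution d),
      1 / 2 < s → φ ∈ gelfandShilovBeurling d s → φ ≠ 0 →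
      ((∃ u ∈ gammaInfZero d s, f.EqFun u) ↔
        ∃ F : RSpace d → RSpace d → ℂ, IsSTFT φ f F ∧
          ∃ h > 0, ∀ ε > 0, PhaseBound s h ε F) ∧
      ((∃ u ∈ gammaInfOne d s, f.EqFun u) ↔
        ∃ F : RSpace d → RSpace d → ℂ, IsSTFT φ f F ∧
          ∃ h > 0, ∃ ε > 0, PhaseBound s h ε F)) ∧
    -- the class `Γ^∞_s`
    (∀ (s : ℝ) (φ : RSpace d → ℂ) (f : GSDistribution d),
      1 / 2 ≤ s → φ ∈ gelfandShilov d s → φ ≠ 0 →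
      ((∃ u ∈ gammaInf d s, f.EqFun u) ↔
        ∃ F : RSpace d → RSpace d → ℂ, IsSTFT φ f F ∧
          ∃ h > 0, ∀ ε > 0, PhaseBound s ε h F)) := by
  refine ⟨fun s h φ f hs hφ h0 => ⟨fun u hu hfu => ⟨fun hb => ?_, fun ⟨ε, hε, hb⟩ => ?_⟩,
    fun F hF => ⟨fun hb => exists_derivBound_of_forall_phaseBound hs hφ h0 hF hb,
      fun ⟨ε, hε, hb⟩ => exists_derivBound_of_phaseBound hs hφ h0 hF hε hb⟩⟩,
    fun s φ f hs hφ h0 => ⟨⟨?_, ?_⟩, ⟨?_, ?_⟩⟩, fun s φ f hs hφ h0 => ⟨?_, ?_⟩⟩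
  · obtain ⟨h1, h2⟩ := isSTFT_of_derivBound hs hφ hu hfu (hb 1 one_pos)
    exact ⟨h1, h2, fun ε hε => phaseBound_of_forall_derivBound hs hφ hu hb hε⟩
  · obtain ⟨h1, h2⟩ := isSTFT_of_derivBound hs hφ hu hfu hb
    exact ⟨h1, h2, exists_phaseBound_of_derivBound hs hφ hu hε hb⟩
  · rintro ⟨u, ⟨hu, h, hh, hb⟩, hfu⟩
    -- The passage from `h` to `h^*` is harmless here, since only some positive exponent is asked
    -- for.
    exact ⟨_, (isSTFT_of_derivBound hs hφ hu hfu (hb 1 one_pos)).2, _, changedExponent_pos hh,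
      fun ε hε => phaseBound_of_forall_derivBound hs hφ hu hb hε⟩
  · rintro ⟨F, hF, h, hh, hb⟩
    obtain ⟨u, hu, hfu, hub⟩ := exists_derivBound_of_forall_phaseBound hs hφ h0 hF hb
    exact ⟨u, ⟨hu, _, changedExponent_pos hh, hub⟩, hfu⟩
  · rintro ⟨u, ⟨hu, ε, hε, h, hh, hb⟩, hfu⟩
    exact ⟨_, (isSTFT_of_derivBound hs hφ hu hfu hb).2, _, changedExponent_pos hh,
      exists_phaseBound_of_derivBound hs hφ hu hε hb⟩
  · rintro ⟨F, hF, h, hh, ε, hε, hb⟩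
    obtain ⟨u, hu, hfu, ε', hε', hub⟩ := exists_derivBound_of_phaseBound hs hφ h0 hF hε hb
    exact ⟨u, ⟨hu, ε', hε', _, changedExponent_pos hh, hub⟩, hfu⟩
  · rintro ⟨u, hu, hfu⟩
    exact exists_stft_of_mem_gammaInf hs hφ hu hfu
  · rintro ⟨F, hF, ε, hε, hb⟩
    exact exists_mem_gammaInf_of_stft hs hφ h0 hF hε hb
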